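/- Let $k$ be a field and let $G$ be a finite simple graph. The Booth–Lueker graph $BL(G)$ has vertex set $V(G)\cup E(G)$ and edges $uv$ for every pair of distinct vertices $u,v$ of $G$ and $ue$ for every vertex $u$ incident to an edge $e$ of $G$. Let $S=k[x_w : w\in V(G)\cup E(G)]$ and let $I=(x_wx_{w'} : ww'\in E(BL(G)))\subseteq S$ be the edge ideal of $BL(G)$. For a finite regular CW complex $X$ whose vertices are labelled by monomials of $S$, label each face $F$ by $x^{\mathbf a_F}=\operatorname{lcm}\{x^{\mathbf a_v} : v\in F \text{ a vertex}\}$ (the empty face, of dimension $-1$, has label $1$), and let $\mathcal F_X$ be the cellular complex, with $(\mathcal F_X)_i=\bigoplus_{\dim F=i-1}S(-\mathbf a_F)$ and $\partial(F)=\sum_{G\subset F \text{ facet}}\operatorname{sign}(G,F)\,x^{\mathbf a_F-\mathbf a_G}\,G$, where $\operatorname{sign}$ is an incidence function of $X$. For a sequence of monomials $m_1,\dots,m_r$ with $I_j=(m_1,\dots,m_j)$, the iterated mapping cone construction starts with $C^{(0)}=S$ in degree $0$. In step $j$ it takes a minimal multigraded free resolution $K$ of $(S/(I_{j-1}:m_j))(-\deg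 m_j)$ and a multigraded chain map $\varphi_j:K\to C^{(j-1)}$ lifting multiplication by $m_j$, $(S/(I_{j-1}:m_j))(-\deg m_j)\to S/I_{j-1}$, and lets $C^{(j)}$ be the mapping cone of $\varphi_j$. Then $I$ has a minimal cellular resolution coming from this construction. That is, there is a finite regular CW complex $X$ with monomial vertex labels, and an incidence function on it, such that the vertex labels generate $I$, the complex $\mathcal F_X$ has non-zero homology only in degree $0$ (so that it is a free resolution of $S/I$), and $\mathcal F_X$ is minimal, i.e. $\partial(\mathcal F_X)\subseteq(x_w : w)\,\mathcal F_X$. Moreover there is an ordering $m_1,\dots,m_r$ of the monomials $x_wx_{w'}$ with $ww'\in E(BL(G))$ (each listed once) such that every colon ideal $(m_1,\dots,m_{j-1}):m_j$ is generated by a subset of the variables, and such that $\mathcal F_X$ is isomorphic, as a complex of multigraded modules, to a complex $C^{(r)}$ obtained from $m_1,\dots,m_r$ by the iterated mapping cone construction. -/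

import Mathlib

open CategoryTheory Topology

noncomputable section

universe u v

/-! ### Multigraded free modules over a polynomial ring -/

/-- A finitely generated free `ℕ^σ`-graded module over `S = k[x_s : s ∈ σ]` with a chosen
homogeneous basis, that is a finite direct sum `⨁ S(-a)`: `gen` indexes the summands and `deg b`
is the multidegree of the basis element `b`. -/
structure MultiFree (k : Type u) (σ : Type v) where
  gen : Type
  finite_gen : Finite gen
  deg : gen → (σ →₀ ℕ)

namespace MultiFree

variable {k : Type u} [Field k] {σ : Type v}

attribute [instance] MultiFree.finite_gen

/-- The underlying `S`-module. -/
abbrev Elt (M : MultiFree k σ) : Type (max u v) := M.gen →₀ MvPolynomial σ k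

/-- The additive group of multigraded `S`-linear maps `M → N` of degree `0`: if a monomial `x^n`
occurs in the coefficient at the basis element `c` of the image of the basis element `b`, then
`n + deg c = deg b`. -/
def homogeneousMaps (M N : MultiFree k σ) : AddSubgroup (M.Elt →ₗ[MvPolynomial σ k] N.Elt) where
  carrier := {f | ∀ (b : M.gen) (c : N.gen) (n : σ →₀ ℕ),
    MvPolynomial.coeff n (f (Finsupp.single b 1) c) ≠ 0 → n + N.deg c = M.deg b}
  add_mem' := by
    intro f g hf hg b c n h
    by_cases h1 : MvPolynomial.coeff n (f (Finsupp.single b 1) c) = 0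
    · refine hg b c n fun h2 => h ?_
      simp [h1, h2]
    · exact hf b c n h1
  zero_mem' := by intro b c n h; simp at h
  neg_mem' := by
    intro f hf b c n h
    refine hf b c n fun h2 => h ?_
    simp [h2]

theorem id_mem_homogeneousMaps (M : MultiFree k σ) : LinearMap.id ∈ homogeneousMaps M M := by
  classical
  intro b c n h
  rw [LinearMap.id_apply, Finsupp.single_apply] at h
  split_ifs at h with hbc
  · subst hbc
    rw [MvPolynomial.coeff_one] at h
    split_ifs at h with hn
    · simp [← hn]
    · exact absurd rfl h
  · simp at h

theorem comp_mem_homogeneousMaps {M N P : MultiFree k σ} {g : N.Elt →ₗ[MvPolynomial σ k] P.Elt}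
    {f : M.Elt →ₗ[MvPolynomial σ k] N.Elt} (hg : g ∈ homogeneousMaps N P)
    (hf : f ∈ homogeneousMaps M N) : g ∘ₗ f ∈ homogeneousMaps M P := by
  classical
  intro b c n h
  have key : (g ∘ₗ f) (Finsupp.single b 1) c =
      (f (Finsupp.single b 1)).sum fun d p => p * g (Finsupp.single d 1) c := by
    conv_lhs => rw [LinearMap.comp_apply, ← Finsupp.sum_single (f (Finsupp.single b 1))]
    rw [Finsupp.sum, map_sum, Finsupp.finsetSum_apply, Finsupp.sum]
    refine Finset.sum_congr rfl fun d _ => ?_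
    rw [← mul_one (f (Finsupp.single b 1) d), ← smul_eq_mul, ← Finsupp.smul_single, map_smul,
      Finsupp.smul_apply]
    simp
  rw [key, Finsupp.sum, MvPolynomial.coeff_sum] at h
  obtain ⟨d, -, hd⟩ := Finset.exists_ne_zero_of_sum_ne_zero h
  rw [MvPolynomial.coeff_mul] at hd
  obtain ⟨⟨p, q⟩, hpq, hne⟩ := Finset.exists_ne_zero_of_sum_ne_zero hd
  have h1 := hf b d p (left_ne_zero_of_mul hne)
  have h2 := hg d c q (right_ne_zero_of_mul hne)
  replace hpq : p + q = n := Finset.HasAntidiagonal.mem_antidiagonal.1 hpq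
  rw [← hpq, add_assoc, h2, h1]

/-- Finitely generated free multigraded modules and multigraded maps of degree `0`. -/
instance : Category (MultiFree k σ) where
  Hom M N := homogeneousMaps M N
  id M := ⟨LinearMap.id, id_mem_homogeneousMaps M⟩
  comp f g := ⟨g.1 ∘ₗ f.1, comp_mem_homogeneousMaps g.2 f.2⟩

/-- The underlying `S`-linear map of a multigraded map. -/
def lin {M N : MultiFree k σ} (f : M ⟶ N) : M.Elt →ₗ[MvPolynomial σ k] N.Elt := f.1

theorem lin_injective {M N : MultiFree k σ} {f g : M ⟶ N} (h : lin f = lin g) : f = g :=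
  Subtype.ext h

instance : Preadditive (MultiFree k σ) where
  homGroup M N := inferInstanceAs (AddCommGroup (homogeneousMaps M N))
  add_comp _ _ _ f f' g := lin_injective (LinearMap.comp_add f.1 f'.1 g.1)
  comp_add _ _ _ f g g' := lin_injective (LinearMap.add_comp f.1 g'.1 g.1)

@[simp] theorem lin_id (M : MultiFree k σ) : lin (𝟙 M) = LinearMap.id := rfl

@[simp] theorem lin_comp {M N P : MultiFree k σ} (f : M ⟶ N) (g : N ⟶ P) :
    lin (f ≫ g) = lin g ∘ₗ lin f := rfl

@[simp] theorem lin_add {M N : MultiFree k σ} (f g : M ⟶ N) : lin (f + g) = lin f + lin g := rfl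

@[simp] theorem lin_zero {M N : MultiFree k σ} : lin (0 : M ⟶ N) = 0 := rfl

/-- The multigraded map with a given scalar matrix: `b ↦ ∑ c, A b c • x^(deg b - deg c) • c`.
Every nonzero scalar entry must respect the degrees. -/
def ofScalars {M N : MultiFree k σ} (A : M.gen → N.gen → k)
    (hA : ∀ b c, A b c ≠ 0 → N.deg c ≤ M.deg b) : M ⟶ N :=
  ⟨Finsupp.linearCombination (MvPolynomial σ k) fun b => Finsupp.equivFunOnFinite.symm fun c =>
      MvPolynomial.monomial (M.deg b - N.deg c) (A b c), by
    classical
    intro b c n h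
    rw [Finsupp.linearCombination_single, one_smul, Finsupp.equivFunOnFinite_symm_apply_apply,
      MvPolynomial.coeff_monomial] at h
    split_ifs at h with hn
    · rw [← hn, tsub_add_cancel_of_le (hA b c h)]
    · exact absurd rfl h⟩

theorem lin_ofScalars_single {M N : MultiFree k σ} (A : M.gen → N.gen → k)
    (hA : ∀ b c, A b c ≠ 0 → N.deg c ≤ M.deg b) (b : M.gen) (c : N.gen) :
    lin (ofScalars A hA) (Finsupp.single b 1) c =
      MvPolynomial.monomial (M.deg b - N.deg c) (A b c) := by
  change (Finsupp.linearCombination (MvPolynomial σ k) (fun b => Finsupp.equivFunOnFinite.symm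
    fun c => MvPolynomial.monomial (M.deg b - N.deg c) (A b c)) (Finsupp.single b 1) :
      N.Elt) c = _
  rw [Finsupp.linearCombination_single, one_smul, Finsupp.equivFunOnFinite_symm_apply_apply]

theorem lin_ofScalars_single' {M N : MultiFree k σ} (A : M.gen → N.gen → k)
    (hA : ∀ b c, A b c ≠ 0 → N.deg c ≤ M.deg b) (b : M.gen) :
    lin (ofScalars A hA) (Finsupp.single b 1) = Finsupp.equivFunOnFinite.symm fun c =>
      MvPolynomial.monomial (M.deg b - N.deg c) (A b c) := by
  ext1 c
  rw [lin_ofScalars_single, Finsupp.equivFunOnFinite_symm_apply_apply]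

theorem ofScalars_comp_eq_zero {M N P : MultiFree k σ} (A : M.gen → N.gen → k)
    (hA : ∀ b c, A b c ≠ 0 → N.deg c ≤ M.deg b) (B : N.gen → P.gen → k)
    (hB : ∀ b c, B b c ≠ 0 → P.deg c ≤ N.deg b) (h : ∀ b d, ∑ᶠ c, A b c * B c d = 0) :
    ofScalars A hA ≫ ofScalars B hB = 0 := by
  classical
  have : Fintype N.gen := Fintype.ofFinite _
  apply lin_injective
  refine Finsupp.lhom_ext' fun b => LinearMap.ext_ring ?_
  simp only [LinearMap.comp_apply, Finsupp.lsingle_apply, lin_comp, lin_zero,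
    LinearMap.zero_apply]
  rw [lin_ofScalars_single', ← Finsupp.univ_sum_single (Finsupp.equivFunOnFinite.symm _), map_sum]
  ext1 d
  rw [Finsupp.finsetSum_apply, Finsupp.zero_apply]
  have hterm : ∀ c, lin (ofScalars B hB) (Finsupp.single c
      (MvPolynomial.monomial (M.deg b - N.deg c) (A b c))) d =
      MvPolynomial.monomial (M.deg b - P.deg d) (A b c * B c d) := by
    intro c
    rw [← mul_one (MvPolynomial.monomial (M.deg b - N.deg c) (A b c)), ← smul_eq_mul,
      ← Finsupp.smul_single, map_smul, Finsupp.smul_apply, lin_ofScalars_single, smul_eq_mul,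
      MvPolynomial.monomial_mul]
    by_cases h1 : A b c = 0
    · simp [h1]
    by_cases h2 : B c d = 0
    · simp [h2]
    rw [tsub_add_tsub_cancel (hA b c h1) (hB c d h2)]
  simp only [Finsupp.equivFunOnFinite_symm_apply_apply, hterm]
  rw [← map_sum, ← finsum_eq_sum_of_fintype, h b d, map_zero]

instance : Limits.HasBinaryBiproducts (MultiFree k σ) where
  has_binary_biproduct M N := by
    classical
    let P : MultiFree k σ :=
      { gen := M.gen ⊕ N.gen, finite_gen := inferInstance, deg := Sum.elim M.deg N.deg }
    let δ (M : MultiFree k σ) (b c : M.gen) : k := if b = c then 1 else 0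
    let i₁ : M ⟶ P := ofScalars (fun b => Sum.elim (δ M b) fun _ => 0) (by
      rintro b (c | c) h
      · by_cases e : b = c
        · simp [e, P]
        · simp [δ, e] at h
      · simp at h)
    let i₂ : N ⟶ P := ofScalars (fun b => Sum.elim (fun _ => 0) (δ N b)) (by
      rintro b (c | c) h
      · simp at h
      · by_cases e : b = c
        · simp [e, P]
        · simp [δ, e] at h)
    let p₁ : P ⟶ M := ofScalars (Sum.elim (δ M) fun _ _ => 0) (by
      rintro (b | b) c h
      · by_cases e : b = c
        · simp [e, P]
        · simp [δ, e] at h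
      · simp at h)
    let p₂ : P ⟶ N := ofScalars (Sum.elim (fun _ _ => 0) (δ N)) (by
      rintro (b | b) c h
      · simp at h
      · by_cases e : b = c
        · simp [e, P]
        · simp [δ, e] at h)
    have hi₁ : ∀ b, lin i₁ (Finsupp.single b 1) = Finsupp.single (Sum.inl b) 1 := by
      intro b
      ext1 c
      rw [lin_ofScalars_single]
      rcases c with c | c
      · by_cases e : b = c
        · simp [e, P, δ]
        · have e' : (Sum.inl b : M.gen ⊕ N.gen) ≠ Sum.inl c := fun h => e (Sum.inl_injective h)
          simp [e, δ, Finsupp.single_eq_of_ne' e']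
      · simp
    have hi₂ : ∀ b, lin i₂ (Finsupp.single b 1) = Finsupp.single (Sum.inr b) 1 := by
      intro b
      ext1 c
      rw [lin_ofScalars_single]
      rcases c with c | c
      · simp
      · by_cases e : b = c
        · simp [e, P, δ]
        · have e' : (Sum.inr b : M.gen ⊕ N.gen) ≠ Sum.inr c := fun h => e (Sum.inr_injective h)
          simp [e, δ, Finsupp.single_eq_of_ne' e']
    have hp₁ : ∀ b, lin p₁ (Finsupp.single (Sum.inl b) 1) = Finsupp.single b 1 := by
      intro b
      ext1 c
      rw [lin_ofScalars_single]
      by_cases e : b = c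
      · simp [e, P, δ]
      · simp [e, δ]
    have hp₁' : ∀ b, lin p₁ (Finsupp.single (Sum.inr b) 1) = 0 := by
      intro b
      ext1 c
      rw [lin_ofScalars_single]
      simp
    have hp₂ : ∀ b, lin p₂ (Finsupp.single (Sum.inr b) 1) = Finsupp.single b 1 := by
      intro b
      ext1 c
      rw [lin_ofScalars_single]
      by_cases e : b = c
      · simp [e, P, δ]
      · simp [e, δ]
    have hp₂' : ∀ b, lin p₂ (Finsupp.single (Sum.inl b) 1) = 0 := by
      intro b
      ext1 c
      rw [lin_ofScalars_single]
      simp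
    refine Limits.hasBinaryBiproduct_of_total
      { pt := P, fst := p₁, snd := p₂, inl := i₁, inr := i₂, inl_fst := ?_, inl_snd := ?_,
        inr_fst := ?_, inr_snd := ?_ } ?_
    · refine lin_injective (Finsupp.lhom_ext' fun b => LinearMap.ext_ring ?_)
      simp [hi₁, hp₁]
    · refine lin_injective (Finsupp.lhom_ext' fun b => LinearMap.ext_ring ?_)
      simp [hi₁, hp₂']
    · refine lin_injective (Finsupp.lhom_ext' fun b => LinearMap.ext_ring ?_)
      simp [hi₂, hp₁']
    · refine lin_injective (Finsupp.lhom_ext' fun b => LinearMap.ext_ring ?_)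
      simp [hi₂, hp₂]
    · refine lin_injective (Finsupp.lhom_ext' fun b => LinearMap.ext_ring ?_)
      rcases b with b | b
      · simp [hi₁, hp₁, hp₂']
      · simp [hi₂, hp₁', hp₂]

/-- The rank one free module `S(-a)`. -/
def twist (k : Type u) {σ : Type v} (a : σ →₀ ℕ) : MultiFree k σ where
  gen := Unit
  finite_gen := inferInstance
  deg _ := a

/-- Multiplication by the monomial `x^a`, as a multigraded map `S(-a) → S`. -/
def mulMonomial (k : Type u) [Field k] {σ : Type v} (a : σ →₀ ℕ) : twist k a ⟶ twist k 0 :=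
  ofScalars (fun _ _ => 1) (fun _ _ _ => zero_le)

end MultiFree

/-! ### Free resolutions of cyclic modules and iterated mapping cones -/

section Resolutions

variable {k : Type u} [Field k] {σ : Type v}

open MultiFree

/-- The complex is exact in all homological degrees `≥ 1`, so that its homology is concentrated
in degree `0`. -/
def IsAcyclicComplex (C : ChainComplex (MultiFree k σ) ℕ) : Prop :=
  ∀ i : ℕ, Function.Exact (lin (C.d (i + 2) (i + 1))) (lin (C.d (i + 1) i))

/-- The complex is minimal: the image of each differential lies in `𝔪 C`, where `𝔪` is the ideal
generated by all variables. -/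
def IsMinimalComplex (C : ChainComplex (MultiFree k σ) ℕ) : Prop :=
  ∀ i : ℕ, LinearMap.range (lin (C.d (i + 1) i)) ≤
    Ideal.span (Set.range (MvPolynomial.X : σ → MvPolynomial σ k)) •
      (⊤ : Submodule (MvPolynomial σ k) (C.X i).Elt)

/-- `C`, with the augmentation `C₀ → S(-a) → (S/J)(-a)` induced by `η`, is a multigraded free
resolution of `(S/J)(-a)`. -/
structure IsFreeResolution (C : ChainComplex (MultiFree k σ) ℕ) (a : σ →₀ ℕ)
    (η : C.X 0 ⟶ twist k a) (J : Ideal (MvPolynomial σ k)) : Prop where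
  acyclic : IsAcyclicComplex C
  exact_zero : ∀ x, lin η x () ∈ J ↔ x ∈ LinearMap.range (lin (C.d 1 0))
  surjective : ∀ s, ∃ x, lin η x () - s ∈ J

/-- The monomial ideal generated by the monomials with exponents in `L`. -/
def monomialIdeal (k : Type u) [Field k] {σ : Type v} (L : Set (σ →₀ ℕ)) :
    Ideal (MvPolynomial σ k) :=
  Ideal.span ((fun a => MvPolynomial.monomial a (1 : k)) '' L)

/-- The colon ideal `(x^b : b ∈ L) : x^a`. -/
def colonIdeal (k : Type u) [Field k] {σ : Type v} (L : List (σ →₀ ℕ)) (a : σ →₀ ℕ) :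
    Ideal (MvPolynomial σ k) :=
  Submodule.colon (monomialIdeal k {b | b ∈ L}) {MvPolynomial.monomial a (1 : k)}

/-- The list of monomials `m₁, …, m_r` has linear quotients: each `(m₁, …, m_{j-1}) : m_j` is
generated by a subset of the variables. -/
def HasLinearQuotients (k : Type u) [Field k] {σ : Type v} (L : List (σ →₀ ℕ)) : Prop :=
  ∀ (L₁ L₂ : List (σ →₀ ℕ)) (a : σ →₀ ℕ), L = L₁ ++ a :: L₂ →
    ∃ T : Set σ, colonIdeal k L₁ a = Ideal.span (MvPolynomial.X '' T)

/-- `C`, with augmentation `ε : C₀ → S`, arises from the monomials `m₁, …, m_r` (in this order) by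
the iterated mapping cone construction. One starts from `S` in degree `0`. Given the complex `C`
for `m₁, …, m_{j-1}`, put `I = (m₁, …, m_{j-1})`, take a minimal multigraded free resolution `K`
of `(S/(I : m_j))(-deg m_j)` and a multigraded chain map `φ : K → C` lifting the map
`(S/(I : m_j))(-deg m_j) → S/I` given by multiplication by `m_j`; the next complex is the mapping
cone of `φ`. -/
inductive IsIteratedMappingCone :
    (L : List (σ →₀ ℕ)) → (C : ChainComplex (MultiFree k σ) ℕ) → (C.X 0 ⟶ twist k 0) → Prop
  | nil (C : ChainComplex (MultiFree k σ) ℕ) (ε : C.X 0 ⟶ twist k 0) (hε : IsIso ε)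
      (hC : ∀ i : ℕ, Limits.IsZero (C.X (i + 1))) : IsIteratedMappingCone [] C ε
  | cone (L : List (σ →₀ ℕ)) (C : ChainComplex (MultiFree k σ) ℕ) (ε : C.X 0 ⟶ twist k 0)
      (hC : IsIteratedMappingCone L C ε) (a : σ →₀ ℕ)
      (K : ChainComplex (MultiFree k σ) ℕ) (η : K.X 0 ⟶ twist k a)
      (hK : IsFreeResolution K a η (colonIdeal k L a)) (hK' : IsMinimalComplex K)
      (φ : K ⟶ C)
      (hφ : ∀ x, lin (φ.f 0 ≫ ε) x () - lin (η ≫ mulMonomial k a) x () ∈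
        monomialIdeal k {b | b ∈ L})
      (ε' : (HomologicalComplex.homotopyCofiber φ).X 0 ⟶ twist k 0)
      (hε' : (HomologicalComplex.homotopyCofiber.inr φ).f 0 ≫ ε' = ε) :
      IsIteratedMappingCone (L ++ [a]) (HomologicalComplex.homotopyCofiber φ) ε'

end Resolutions

/-! ### Labelled cell complexes and their cellular complexes -/

/-- A finite regular CW complex: every characteristic map is injective on the closed ball (hence
a homeomorphism from the closed ball onto the closed cell). -/
structure RegularCellComplex where
  space : Type
  [topologicalSpace : TopologicalSpace space]
  [t2Space : T2Space space]
  carrier : Set space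
  [cwComplex : CWComplex carrier]
  [finite : RelCWComplex.Finite carrier]
  regular : ∀ (n : ℕ) (e : RelCWComplex.cell carrier n),
    Set.InjOn (RelCWComplex.map n e) (Metric.closedBall 0 1)

namespace RegularCellComplex

attribute [instance] topologicalSpace t2Space cwComplex finite

variable (X : RegularCellComplex)

/-- The faces of dimension `i - 1`; the only face of dimension `-1` is the empty face. -/
def Face : ℕ → Type
  | 0 => Unit
  | n + 1 => RelCWComplex.cell X.carrier n

/-- The closed cell of a face. -/
def closedFace : (i : ℕ) → X.Face i → Set X.space
  | 0, _ => ∅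
  | n + 1, e => RelCWComplex.closedCell (C := X.carrier) n e

/-- `G` is a facet of `F`: a face of one dimension less that is contained in `F`. -/
def IsFacet {i : ℕ} (G : X.Face i) (F : X.Face (i + 1)) : Prop :=
  X.closedFace i G ⊆ X.closedFace (i + 1) F

/-- The vertices of a face. -/
def verts (i : ℕ) (F : X.Face i) : Set (X.Face 1) :=
  {v | X.closedFace 1 v ⊆ X.closedFace i F}

instance finite_face (i : ℕ) : Finite (X.Face i) := by
  cases i with
  | zero => exact inferInstanceAs (Finite Unit)
  | succ n =>
    have : Finite (Σ n, RelCWComplex.cell X.carrier n) :=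
      RelCWComplex.finite_cells_of_finite
    exact Finite.of_injective (fun e : RelCWComplex.cell X.carrier n =>
      (⟨n, e⟩ : Σ n, RelCWComplex.cell X.carrier n)) sigma_mk_injective

end RegularCellComplex

/-- A finite regular CW complex with monomial labels, given by exponent vectors, on the vertices,
and with an incidence function `sign` (the signs of the augmented cellular chain complex for a
choice of orientations of the cells). -/
structure LabelledCellComplex (σ : Type v) extends RegularCellComplex where
  vertexLabel : toRegularCellComplex.Face 1 → (σ →₀ ℕ)
  sign : ∀ i : ℕ, toRegularCellComplex.Face (i + 1) → toRegularCellComplex.Face i → ℤ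
  sign_facet : ∀ i F G, toRegularCellComplex.IsFacet G F → sign i F G = 1 ∨ sign i F G = -1
  sign_not_facet : ∀ i F G, ¬ toRegularCellComplex.IsFacet G F → sign i F G = 0
  sign_vertex : ∀ v G, sign 0 v G = 1
  sign_sign : ∀ i F H, ∑ᶠ G, sign (i + 1) F G * sign i G H = 0

namespace LabelledCellComplex

variable {σ : Type v} (X : LabelledCellComplex σ)

/-- The exponent vector of the label of a face: the least common multiple of the labels of its
vertices. For the empty face this is `0`. -/
def label (i : ℕ) (F : X.Face i) : σ →₀ ℕ :=
  (Set.toFinite (X.verts i F)).toFinset.sup X.vertexLabel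

theorem label_mono {i : ℕ} {G : X.Face i} {F : X.Face (i + 1)} (h : X.IsFacet G F) :
    X.label i G ≤ X.label (i + 1) F := by
  refine Finset.sup_mono fun v hv => ?_
  rw [Set.Finite.mem_toFinset] at hv ⊢
  exact Set.Subset.trans hv h

theorem label_le_of_sign_ne_zero {k : Type u} [Field k] {i : ℕ} (F : X.Face (i + 1))
    (G : X.Face i) (h : (X.sign i F G : k) ≠ 0) : X.label i G ≤ X.label (i + 1) F := by
  by_contra hle
  refine h ?_
  rw [X.sign_not_facet i F G fun hf => hle (X.label_mono hf), Int.cast_zero]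

/-- The cellular complex: in homological degree `i` it is `⨁ S(-a_F)` over the faces `F` of
dimension `i - 1`, with differential `F ↦ ∑ G, sign(G, F) x^(a_F - a_G) G`. -/
def cellularComplex (k : Type u) [Field k] : ChainComplex (MultiFree k σ) ℕ :=
  ChainComplex.of
    (fun i => { gen := X.Face i, finite_gen := inferInstance, deg := X.label i })
    (fun i => MultiFree.ofScalars (fun F G => (X.sign i F G : k))
      (fun F G h => X.label_le_of_sign_ne_zero F G h))
    (fun i => MultiFree.ofScalars_comp_eq_zero _ _ _ _ fun F H => by
      have : Fintype (X.Face (i + 1)) := Fintype.ofFinite _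
      have h := X.sign_sign i F H
      rw [finsum_eq_sum_of_fintype] at h
      change ∑ᶠ G : X.Face (i + 1), ((X.sign (i + 1) F G : k) * (X.sign i G H : k)) = 0
      rw [finsum_eq_sum_of_fintype]
      exact_mod_cast congrArg (Int.cast : ℤ → k) h)

/-- `X` supports a cellular resolution of (the quotient by) the ideal `J`: the labels of the
vertices generate `J`, and the cellular complex has nonzero homology only in degree `0`. -/
def SupportsResolution (k : Type u) [Field k] (J : Ideal (MvPolynomial σ k)) : Prop :=
  monomialIdeal k (Set.range X.vertexLabel) = J ∧ IsAcyclicComplex (X.cellularComplex k)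

end LabelledCellComplex

/-! ### Booth–Lueker graphs and edge ideals -/

/-- The Booth–Lueker graph of `G`: its vertices are the vertices and the edges of `G`; any two
distinct vertices of `G` are adjacent, and a vertex of `G` is adjacent to each edge of `G` that
contains it. -/
def boothLueker {V : Type v} (G : SimpleGraph V) : SimpleGraph (V ⊕ G.edgeSet) where
  Adj
    | Sum.inl u, Sum.inl w => u ≠ w
    | Sum.inl u, Sum.inr e => u ∈ e.1
    | Sum.inr e, Sum.inl u => u ∈ e.1
    | Sum.inr _, Sum.inr _ => False
  symm := ⟨by
    rintro (a | a) (b | b) h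
    · exact Ne.symm h
    · exact h
    · exact h
    · exact h⟩
  loopless := ⟨by
    rintro (a | a) h
    · exact h rfl
    · exact h⟩

/-- The exponent vectors of the monomials `x_u x_w`, for the edges `uw` of a graph. -/
def edgeMonomials {W : Type v} (H : SimpleGraph W) : Set (W →₀ ℕ) :=
  {a | ∃ u w, H.Adj u w ∧ a = Finsupp.single u 1 + Finsupp.single w 1}

/-- The edge ideal of a graph. -/
def edgeIdeal (k : Type u) [Field k] {W : Type v} (H : SimpleGraph W) :
    Ideal (MvPolynomial W k) :=
  Ideal.span {p | ∃ u w, H.Adj u w ∧ p = MvPolynomial.X u * MvPolynomial.X w}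

end

noncomputable section

universe u v

/-! ### Multigraded maps given by scalar matrices -/

namespace MultiFree

variable {k : Type u} [Field k] {σ : Type v}

/-! A Booth–Lueker graph is a split graph: `V` is a clique and the edges of `G` form an independent
set. Number its vertices by `Fin p` with the clique first, and order its edges `i < j`
lexicographically, by `j` and then by `i`. The edge between `i` and any `x < j`, `x ≠ i`, that is in
the clique or adjacent to `i` precedes `ij`, and every preceding edge contains such an `x`. Hence
the colon ideal at `ij` is generated by these variables (`colonIdeal_pairList`), and the iterated
mapping cone has basis elements `(i, j, S)` with `S` a subset of this link (`linkSet`).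

These basis elements are realized as cells. The support `{i, j} ∪ S` is cut at `i` into a left set
`{x ≤ i}` and a right set `{x > i}`; if the support meets the independent part, then `i` is put into
the right set as well. Faces are given by inclusion of both sets. Geometrically a clique edge `ab`
is the direction `δ_b - δ_a`, an edge `ue` with `e` independent is a direction of its own, and
directions are normalized by a linear functional. The left and right sets of a point are read off
from negative and positive supports, so open cells are disjoint; each closed cell is a polytope cut
out by affine inequalities, hence a ball (`exists_characteristicMap`). The relation `(δ_b - δ_u) +
(δ_u - δ_a) = δ_b - δ_a` is the reason why deleting the last independent vertex from a cone with
apex `u` leaves two boxes, with `u` on the left or on the right. Signs are those of a simplex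
corrected by the side of the deleted vertex, and the boundary squares to zero because exactly two
cells lie between a cell and a face of codimension two (`SplitCell.diamond`).

On the algebraic side, filter the cellular complex by the pair of maxima `(hi, lo)` of the right and
left sets. The pieces of constant rank are Koszul complexes up to nonzero scalars, so they resolve
the colon quotients minimally (`isKoszul_quo`, `IsKoszul.isFreeResolution`), and each stage of the
filtration is the mapping cone of the connecting map (`ScalarComplex.coneSplitting`). This exhibits
the complex as an iterated mapping cone (`exists_isIteratedMappingCone`). Acyclicity then comes for
free, since a mapping cone over a lift of multiplication by `m_j` resolves the next quotient
(`cone_isFreeResolution`). Minimality holds because the label of a `d`-cell has total degree `d +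
2`, and that of the empty face has degree `0`. -/

theorem hom_ext_single {M N : MultiFree k σ} {f g : M ⟶ N}
    (h : ∀ b c, lin f (Finsupp.single b 1) c = lin g (Finsupp.single b 1) c) : f = g :=
  lin_injective (Finsupp.lhom_ext' fun b => LinearMap.ext_ring (Finsupp.ext (h b)))

theorem lin_ofScalars_apply {M N : MultiFree k σ} (A : M.gen → N.gen → k)
    (hA : ∀ b c, A b c ≠ 0 → N.deg c ≤ M.deg b) (x : M.Elt) (c : N.gen) :
    lin (ofScalars A hA) x c =
      ∑ᶠ b, x b * MvPolynomial.monomial (M.deg b - N.deg c) (A b c) := by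
  classical
  have : Fintype M.gen := Fintype.ofFinite _
  rw [finsum_eq_sum_of_fintype]
  conv_lhs => rw [← Finsupp.univ_sum_single x, map_sum, Finsupp.finsetSum_apply]
  refine Finset.sum_congr rfl fun b _ => ?_
  rw [← mul_one (x b), ← smul_eq_mul, ← Finsupp.smul_single, map_smul, Finsupp.smul_apply,
    lin_ofScalars_single, smul_eq_mul, smul_eq_mul, mul_one]

theorem ofScalars_congr {M N : MultiFree k σ} {A B : M.gen → N.gen → k}
    {hA : ∀ b c, A b c ≠ 0 → N.deg c ≤ M.deg b} {hB : ∀ b c, B b c ≠ 0 → N.deg c ≤ M.deg b}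
    (h : ∀ b c, A b c = B b c) : ofScalars A hA = ofScalars B hB := by
  obtain rfl : A = B := funext fun b => funext (h b)
  rfl

/-- The monomial factors take care of themselves: wherever both scalars are nonzero the truncated
subtractions are exact and the exponents add up. Identities between multigraded maps thereby reduce
to identities between matrices over `k`. -/
theorem ofScalars_comp {M N P : MultiFree k σ} (A : M.gen → N.gen → k)
    (hA : ∀ b c, A b c ≠ 0 → N.deg c ≤ M.deg b) (B : N.gen → P.gen → k)
    (hB : ∀ b c, B b c ≠ 0 → P.deg c ≤ N.deg b) :
    ofScalars A hA ≫ ofScalars B hB = ofScalars (fun b d => ∑ᶠ c, A b c * B c d) (by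
      intro b d h
      obtain ⟨c, hc⟩ : ∃ c, A b c * B c d ≠ 0 := by
        by_contra! hcon
        exact h (by simp [hcon])
      exact (hB c d (right_ne_zero_of_mul hc)).trans (hA b c (left_ne_zero_of_mul hc))) := by
  classical
  have : Fintype N.gen := Fintype.ofFinite _
  refine hom_ext_single fun b d => ?_
  rw [lin_ofScalars_single, lin_comp, LinearMap.comp_apply, lin_ofScalars_apply,
    finsum_eq_sum_of_fintype, finsum_eq_sum_of_fintype, map_sum]
  refine Finset.sum_congr rfl fun c _ => ?_
  rw [lin_ofScalars_single, MvPolynomial.monomial_mul]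
  by_cases h1 : A b c = 0
  · simp [h1]
  by_cases h2 : B c d = 0
  · simp [h2]
  rw [tsub_add_tsub_cancel (hA b c h1) (hB c d h2)]

theorem ofScalars_add {M N : MultiFree k σ} (A B : M.gen → N.gen → k)
    (hA : ∀ b c, A b c ≠ 0 → N.deg c ≤ M.deg b) (hB : ∀ b c, B b c ≠ 0 → N.deg c ≤ M.deg b) :
    ofScalars A hA + ofScalars B hB = ofScalars (fun b c => A b c + B b c) (by
      intro b c h
      by_cases h1 : A b c = 0
      · exact hB b c fun h2 => h (by rw [h1, h2, add_zero])
      · exact hA b c h1) := by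
  refine hom_ext_single fun b d => ?_
  rw [lin_add, LinearMap.add_apply, Finsupp.add_apply]
  simp only [lin_ofScalars_single, map_add]

theorem ofScalars_zero {M N : MultiFree k σ} (A : M.gen → N.gen → k)
    (hA : ∀ b c, A b c ≠ 0 → N.deg c ≤ M.deg b) (h : ∀ b c, A b c = 0) :
    ofScalars A hA = 0 := by
  refine hom_ext_single fun b d => ?_
  rw [lin_ofScalars_single, h]
  simp

theorem ofScalars_one {M : MultiFree k σ} (A : M.gen → M.gen → k)
    (hA : ∀ b c, A b c ≠ 0 → M.deg c ≤ M.deg b) (h : ∀ b, A b b = 1)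
    (h' : ∀ b c, b ≠ c → A b c = 0) :
    ofScalars A hA = 𝟙 M := by
  classical
  refine hom_ext_single fun b d => ?_
  rw [lin_ofScalars_single, lin_id, LinearMap.id_apply]
  by_cases e : b = d
  · subst e
    simp [h]
  · simp [h' b d e, e]

/-- The ideal generated by all variables. -/
abbrev irrelevant (k : Type u) [Field k] (σ : Type v) : Ideal (MvPolynomial σ k) :=
  Ideal.span (Set.range (MvPolynomial.X : σ → MvPolynomial σ k))

/-- A nonzero entry is a scalar times `x^(deg b - deg c)`, and this exponent is nonzero once the two
degrees differ, so some variable divides the entry. -/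
theorem range_ofScalars_le {M N : MultiFree k σ} (A : M.gen → N.gen → k)
    (hA : ∀ b c, A b c ≠ 0 → N.deg c ≤ M.deg b) (h : ∀ b c, A b c ≠ 0 → N.deg c ≠ M.deg b) :
    LinearMap.range (lin (ofScalars A hA)) ≤
      irrelevant k σ • (⊤ : Submodule (MvPolynomial σ k) N.Elt) := by
  classical
  rintro _ ⟨x, rfl⟩
  have : Fintype M.gen := Fintype.ofFinite _
  have : Fintype N.gen := Fintype.ofFinite _
  have key : ∀ c, lin (ofScalars A hA) x c ∈ irrelevant k σ := by
    intro c
    rw [lin_ofScalars_apply, finsum_eq_sum_of_fintype]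
    refine Ideal.sum_mem _ fun b _ => Ideal.mul_mem_left _ _ ?_
    by_cases hb : A b c = 0
    · simp [hb]
    rw [irrelevant, ← Set.image_univ, MvPolynomial.mem_ideal_span_X_image]
    intro m hm
    rw [MvPolynomial.support_monomial, if_neg hb, Finset.mem_singleton] at hm
    subst hm
    by_contra! hcon
    refine h b c hb (le_antisymm (hA b c hb) ?_)
    rw [← tsub_eq_zero_iff_le]
    ext s
    exact hcon s (Set.mem_univ s)
  rw [← Finsupp.univ_sum_single (lin (ofScalars A hA) x)]
  refine Submodule.sum_mem _ fun c _ => ?_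
  have := Submodule.smul_mem_smul (key c)
    (show (Finsupp.single c 1 : N.Elt) ∈ (⊤ : Submodule (MvPolynomial σ k) N.Elt) from trivial)
  rwa [Finsupp.smul_single, smul_eq_mul, mul_one] at this

theorem isZero_of_isEmpty (M : MultiFree k σ) [IsEmpty M.gen] : Limits.IsZero M := by
  rw [Limits.IsZero.iff_id_eq_zero]
  exact hom_ext_single fun b => isEmptyElim b

end MultiFree

/-! ### Complexes given by scalar matrices -/

open MultiFree

/-- A complex of multigraded free modules given by scalar matrices. -/
structure ScalarComplex (k : Type u) [Field k] (σ : Type v) where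
  gen : ℕ → Type
  finite_gen : ∀ i, Finite (gen i)
  deg : ∀ i, gen i → (σ →₀ ℕ)
  coeff : ∀ i, gen (i + 1) → gen i → k
  deg_le : ∀ i b c, coeff i b c ≠ 0 → deg i c ≤ deg (i + 1) b
  coeff_comp : ∀ i b d, ∑ᶠ c, coeff (i + 1) b c * coeff i c d = 0

namespace ScalarComplex

variable {k : Type u} [Field k] {σ : Type v}

attribute [instance] ScalarComplex.finite_gen

/-- The free module in homological degree `i`. -/
def obj (Q : ScalarComplex k σ) (i : ℕ) : MultiFree k σ :=
  { gen := Q.gen i, finite_gen := inferInstance, deg := Q.deg i }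

/-- The differential. -/
def diff (Q : ScalarComplex k σ) (i : ℕ) : Q.obj (i + 1) ⟶ Q.obj i :=
  ofScalars (M := Q.obj (i + 1)) (N := Q.obj i) (Q.coeff i) (Q.deg_le i)

/-- The associated chain complex of multigraded free modules. -/
def toComplex (Q : ScalarComplex k σ) : ChainComplex (MultiFree k σ) ℕ :=
  ChainComplex.of Q.obj Q.diff (fun i => ofScalars_comp_eq_zero _ _ _ _ (Q.coeff_comp i))

theorem toComplex_d (Q : ScalarComplex k σ) (i : ℕ) : Q.toComplex.d (i + 1) i = Q.diff i :=
  ChainComplex.of_d _ _ _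

/-- A scalar complex is minimal when nonzero entries strictly decrease the multidegree. -/
theorem isMinimalComplex (Q : ScalarComplex k σ)
    (h : ∀ i b c, Q.coeff i b c ≠ 0 → Q.deg i c ≠ Q.deg (i + 1) b) :
    IsMinimalComplex Q.toComplex := by
  intro i
  rw [toComplex_d]
  exact range_ofScalars_le (M := Q.obj (i + 1)) (N := Q.obj i) _ _ (h i)

end ScalarComplex

/-- The cellular complex as a scalar complex. -/
def LabelledCellComplex.scalar (k : Type u) [Field k] {σ : Type v} (X : LabelledCellComplex σ) :
    ScalarComplex k σ where
  gen := X.Face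
  finite_gen := inferInstance
  deg := X.label
  coeff i F G := (X.sign i F G : k)
  deg_le i F G h := X.label_le_of_sign_ne_zero F G h
  coeff_comp i F H := by
    have : Fintype (X.Face (i + 1)) := Fintype.ofFinite _
    have h := X.sign_sign i F H
    rw [finsum_eq_sum_of_fintype] at h
    rw [finsum_eq_sum_of_fintype]
    exact_mod_cast congrArg (Int.cast : ℤ → k) h

/-! ### Exactness in each multidegree -/

namespace MultiFree

variable {k : Type u} [Field k] {σ : Type v}

/-- The element of multidegree `e` with given scalar coordinates. -/
def ofDegree (M : MultiFree k σ) (e : σ →₀ ℕ) (x : M.gen → k) : M.Elt :=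
  Finsupp.equivFunOnFinite.symm fun b => MvPolynomial.monomial (e - M.deg b) (x b)

theorem ofDegree_apply (M : MultiFree k σ) (e : σ →₀ ℕ) (x : M.gen → k) (b : M.gen) :
    ofDegree M e x b = MvPolynomial.monomial (e - M.deg b) (x b) := rfl

theorem lin_ofDegree {M N : MultiFree k σ} (A : M.gen → N.gen → k)
    (hA : ∀ b c, A b c ≠ 0 → N.deg c ≤ M.deg b) (e : σ →₀ ℕ) (x : M.gen → k)
    (hx : ∀ b, x b ≠ 0 → M.deg b ≤ e) :
    lin (ofScalars A hA) (ofDegree M e x) = ofDegree N e fun c => ∑ᶠ b, x b * A b c := by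
  have : Fintype M.gen := Fintype.ofFinite _
  ext1 c
  rw [lin_ofScalars_apply, ofDegree_apply, finsum_eq_sum_of_fintype, finsum_eq_sum_of_fintype,
    map_sum]
  refine Finset.sum_congr rfl fun b _ => ?_
  rw [ofDegree_apply, MvPolynomial.monomial_mul]
  by_cases h1 : x b = 0
  · simp [h1]
  by_cases h2 : A b c = 0
  · simp [h2]
  rw [tsub_add_tsub_cancel (hx b h1) (hA b c h2)]

/-- The scalar coordinates of the component of multidegree `e`. -/
def component {M : MultiFree k σ} (e : σ →₀ ℕ) (y : M.Elt) (b : M.gen) : k :=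
  open Classical in if M.deg b ≤ e then MvPolynomial.coeff (e - M.deg b) (y b) else 0

theorem component_lin {M N : MultiFree k σ} (A : M.gen → N.gen → k)
    (hA : ∀ b c, A b c ≠ 0 → N.deg c ≤ M.deg b) (e : σ →₀ ℕ) (y : M.Elt) (c : N.gen) :
    component e (lin (ofScalars A hA) y) c = ∑ᶠ b, component e y b * A b c := by
  classical
  have : Fintype M.gen := Fintype.ofFinite _
  rw [finsum_eq_sum_of_fintype]
  unfold component
  split_ifs with hc
  · rw [lin_ofScalars_apply, finsum_eq_sum_of_fintype, MvPolynomial.coeff_sum]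
    refine Finset.sum_congr rfl fun b _ => ?_
    by_cases h2 : A b c = 0
    · simp [h2]
    rw [MvPolynomial.coeff_mul_monomial']
    have h3 := hA b c h2
    by_cases hb : M.deg b ≤ e
    · rw [if_pos hb, if_pos (tsub_le_tsub_right hb _), tsub_tsub_tsub_cancel_right h3]
    · rw [if_neg hb, if_neg, zero_mul]
      intro h
      refine hb ?_
      rw [← tsub_add_cancel_of_le h3, ← tsub_add_cancel_of_le hc]
      exact add_le_add_left h _
  · refine (Finset.sum_eq_zero fun b _ => ?_).symm
    split_ifs with hb
    · by_cases h2 : A b c = 0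
      · simp [h2]
      exact absurd ((hA b c h2).trans hb) hc
    · simp

theorem exists_sum_ofDegree_component {M : MultiFree k σ} (y : M.Elt) :
    ∃ s : Finset (σ →₀ ℕ), y = ∑ e ∈ s, ofDegree M e (component e y) := by
  classical
  have : Fintype M.gen := Fintype.ofFinite _
  -- The multidegrees of all terms `x^n b` that occur in `y`.
  refine ⟨Finset.univ.biUnion fun b => (y b).support.image (· + M.deg b), ?_⟩
  ext1 b
  rw [Finsupp.finsetSum_apply]
  ext n
  rw [MvPolynomial.coeff_sum]
  simp only [ofDegree_apply, MvPolynomial.coeff_monomial, component]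
  rw [Finset.sum_eq_single (n + M.deg b)]
  · simp
  · intro e _ he
    by_cases hb : M.deg b ≤ e
    · rw [if_neg]
      rintro rfl
      exact he (tsub_add_cancel_of_le hb).symm
    · simp [hb]
  · intro h
    have : MvPolynomial.coeff n (y b) = 0 := by
      by_contra hne
      refine h (Finset.mem_biUnion.2 ⟨b, Finset.mem_univ _, Finset.mem_image.2 ⟨n, ?_, rfl⟩⟩)
      simpa using hne
    simp [this]

/-- Exactness of multigraded maps can be checked in each multidegree. -/
theorem exact_of_degreewise {M N P : MultiFree k σ} (A : M.gen → N.gen → k)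
    (hA : ∀ b c, A b c ≠ 0 → N.deg c ≤ M.deg b) (B : N.gen → P.gen → k)
    (hB : ∀ b c, B b c ≠ 0 → P.deg c ≤ N.deg b) (hAB : ∀ b d, ∑ᶠ c, A b c * B c d = 0)
    (h : ∀ (e : σ →₀ ℕ) (y : N.gen → k), (∀ b, y b ≠ 0 → N.deg b ≤ e) →
      (∀ d, ∑ᶠ b, y b * B b d = 0) →
      ∃ x : M.gen → k, (∀ a, x a ≠ 0 → M.deg a ≤ e) ∧ ∀ b, ∑ᶠ a, x a * A a b = y b) :
    Function.Exact (lin (ofScalars A hA)) (lin (ofScalars B hB)) := by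
  intro y
  constructor
  · intro hy
    have h' : ∀ e, ∃ x : M.gen → k, (∀ a, x a ≠ 0 → M.deg a ≤ e) ∧
        ∀ b, ∑ᶠ a, x a * A a b = component e y b := by
      intro e
      refine h e _ (fun b hb => ?_) fun d => ?_
      · by_contra hcon
        exact hb (if_neg hcon)
      · rw [← component_lin B hB, hy]
        simp [component]
    choose x hx hxy using h'
    obtain ⟨s, hs⟩ := exists_sum_ofDegree_component y
    refine ⟨∑ e ∈ s, ofDegree M e (x e), ?_⟩
    conv_rhs => rw [hs]
    rw [map_sum]
    refine Finset.sum_congr rfl fun e _ => ?_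
    rw [lin_ofDegree A hA e _ (hx e)]
    exact congrArg _ (funext (hxy e))
  · rintro ⟨x, rfl⟩
    rw [← LinearMap.comp_apply, ← lin_comp, ofScalars_comp_eq_zero A hA B hB hAB, lin_zero,
      LinearMap.zero_apply]

end MultiFree

/-! ### Koszul complexes with arbitrary nonzero coefficients -/

open MultiFree

theorem sum_single_apply_of_injective {σ : Type v} {τ : Type*} [DecidableEq τ] {ν : τ → σ}
    (hν : Function.Injective ν) (S : Finset τ) (t : τ) :
    (∑ x ∈ S, Finsupp.single (ν x) 1 : σ →₀ ℕ) (ν t) = if t ∈ S then 1 else 0 := by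
  classical
  rw [Finsupp.finsetSum_apply]
  simp [Finsupp.single_apply, hν.eq_iff]

theorem sum_single_apply_of_notMem {σ : Type v} {τ : Type*} {ν : τ → σ}
    (S : Finset τ) (s : σ) (hs : ∀ t ∈ S, ν t ≠ s) :
    (∑ x ∈ S, Finsupp.single (ν x) 1 : σ →₀ ℕ) s = 0 := by
  classical
  rw [Finsupp.finsetSum_apply]
  exact Finset.sum_eq_zero fun t ht => Finsupp.single_eq_of_ne' (hs t ht)

theorem add_sum_single_le_iff {σ : Type v} {τ : Type*} {ν : τ → σ}
    (hν : Function.Injective ν) (S : Finset τ) (m e : σ →₀ ℕ) :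
    m + ∑ x ∈ S, Finsupp.single (ν x) 1 ≤ e ↔ m ≤ e ∧ ∀ t ∈ S, m (ν t) + 1 ≤ e (ν t) := by
  classical
  constructor
  · refine fun h => ⟨le_trans le_self_add h, fun t ht => ?_⟩
    have := h (ν t)
    rwa [Finsupp.add_apply, sum_single_apply_of_injective hν, if_pos ht] at this
  · rintro ⟨h1, h2⟩ s
    by_cases hs : ∃ t ∈ S, ν t = s
    · obtain ⟨t, ht, rfl⟩ := hs
      rw [Finsupp.add_apply, sum_single_apply_of_injective hν, if_pos ht]
      exact h2 t ht
    · push Not at hs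
      rw [Finsupp.add_apply, sum_single_apply_of_notMem S s hs]
      exact h1 s

namespace ScalarComplex

variable {k : Type u} [Field k] {σ : Type v}

/-- The basis elements are the subsets of a set `T` of variables, and the differential has nonzero
entries exactly at the inclusions of codimension one; `m` is the degree of the empty subset. -/
structure IsKoszul (Q : ScalarComplex k σ) {τ : Type*} (ν : τ → σ) (m : σ →₀ ℕ) (T : Finset τ)
    (W : ∀ i, Q.gen i → Finset τ) : Prop where
  injective : ∀ i, Function.Injective (W i)
  subset : ∀ i b, W i b ⊆ T
  card : ∀ i b, (W i b).card = i
  surjective : ∀ i α, α ⊆ T → α.card = i → ∃ b, W i b = α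
  deg : ∀ i b, Q.deg i b = m + ∑ t ∈ W i b, Finsupp.single (ν t) 1
  coeff : ∀ i b c, Q.coeff i b c ≠ 0 ↔ W i c ⊆ W (i + 1) b

variable {Q : ScalarComplex k σ} {τ : Type*} {ν : τ → σ} {m : σ →₀ ℕ} {T : Finset τ}
  {W : ∀ i, Q.gen i → Finset τ}

/-- The degrees in consecutive homological positions are `m` times squarefree monomials with `i` and
`i + 1` factors, hence never equal. -/
theorem IsKoszul.isMinimalComplex (h : Q.IsKoszul ν m T W) : IsMinimalComplex Q.toComplex := by
  refine Q.isMinimalComplex fun i b c _ he => ?_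
  rw [h.deg, h.deg, add_right_inj] at he
  have h2 := congrArg (Finsupp.degree) he
  simp only [map_sum, Finsupp.degree_single, Finset.sum_const, h.card] at h2
  simp at h2

/-- The usual contraction "add the element `t₀`", carried out without knowing the signs: only the
support of the matrix and the vanishing of the square of the differential are used. The boundary of
the constructed `x` agrees with `y` on sets avoiding `t₀`; the difference is a cycle supported on
sets containing `t₀`, and such a cycle is zero. -/
theorem IsKoszul.exists_preimage (h : Q.IsKoszul ν m T W) (hν : Function.Injective ν) (i : ℕ)
    (e : σ →₀ ℕ) (y : Q.gen (i + 1) → k) (hy : ∀ b, y b ≠ 0 → Q.deg (i + 1) b ≤ e)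
    (hdy : ∀ d, ∑ᶠ b, y b * Q.coeff i b d = 0) :
    ∃ x : Q.gen (i + 2) → k, (∀ a, x a ≠ 0 → Q.deg (i + 2) a ≤ e) ∧
      ∀ b, ∑ᶠ a, x a * Q.coeff (i + 1) a b = y b := by
  classical
  have F0 : Fintype (Q.gen i) := Fintype.ofFinite _
  have F1 : Fintype (Q.gen (i + 1)) := Fintype.ofFinite _
  have F2 : Fintype (Q.gen (i + 2)) := Fintype.ofFinite _
  replace hy : ∀ b, y b ≠ 0 → m ≤ e ∧ ∀ t ∈ W _ b, m (ν t) + 1 ≤ e (ν t) := by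
    intro b hb
    rw [← add_sum_single_le_iff hν, ← h.deg]
    exact hy b hb
  replace hdy : ∀ d, ∑ b, y b * Q.coeff i b d = 0 := by
    intro d
    rw [← finsum_eq_sum_of_fintype]
    exact hdy d
  have hcc : ∀ a d, ∑ b, Q.coeff (i + 1) a b * Q.coeff i b d = 0 := by
    intro a d
    rw [← finsum_eq_sum_of_fintype]
    exact Q.coeff_comp i a d
  by_cases hy0 : ∀ b, y b = 0
  · exact ⟨fun _ => 0, by simp, fun b => by simp [hy0]⟩
  push Not at hy0
  obtain ⟨b₀, hb₀⟩ := hy0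
  obtain ⟨hme, hb₀'⟩ := hy b₀ hb₀
  obtain ⟨t₀, ht₀⟩ : (W _ b₀).Nonempty := by
    rw [← Finset.card_pos, h.card]
    omega
  -- Since `t₀` occurs in a basis element of degree at most `e` with nonzero coordinate, adding `t₀`
  -- to other sets keeps the degree below `e`.
  have ht₀e := hb₀' t₀ ht₀
  have ht₀T := h.subset _ _ ht₀
  have hface : ∀ a : Q.gen (i + 2), t₀ ∈ W _ a → ∃ b : Q.gen (i + 1), W _ b = (W _ a).erase t₀ :=
    fun a ha => h.surjective _ _ ((Finset.erase_subset _ _).trans (h.subset _ _))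
      (by rw [Finset.card_erase_of_mem ha, h.card]; rfl)
  -- Supported on sets containing `t₀`; dividing by the entry makes the boundary at `W a \ {t₀}`
  -- equal to the value of `y` there.
  let x : Q.gen (i + 2) → k := fun a =>
    if ha : t₀ ∈ W _ a then
      y (Classical.choose (hface a ha)) / Q.coeff (i + 1) a (Classical.choose (hface a ha))
    else 0
  have hx : ∀ a b, t₀ ∈ W _ a → W _ b = (W _ a).erase t₀ → x a = y b / Q.coeff (i + 1) a b := by
    intro a b ha hb
    have : Classical.choose (hface a ha) = b :=
      h.injective _ ((Classical.choose_spec (hface a ha)).trans hb.symm)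
    simp only [x, dif_pos ha, this]
  refine ⟨x, fun a ha => ?_, ?_⟩
  · rw [h.deg, add_sum_single_le_iff hν]
    refine ⟨hme, fun t ht => ?_⟩
    by_cases hta : t₀ ∈ W _ a
    · obtain ⟨b, hb⟩ := hface a hta
      rw [hx a b hta hb] at ha
      by_cases htt : t = t₀
      · rwa [htt]
      · exact (hy b (left_ne_zero_of_mul (by simpa only [div_eq_mul_inv] using ha))).2 t
          (by rw [hb]; exact Finset.mem_erase.2 ⟨htt, ht⟩)
    · exact absurd (dif_neg hta) ha
  · have hcard : ∀ (a : Q.gen (i + 2)) (b : Q.gen (i + 1)), t₀ ∈ W _ a → t₀ ∉ W _ b →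
        Q.coeff (i + 1) a b ≠ 0 → W _ b = (W _ a).erase t₀ := by
      intro a b ha hb hab
      refine Finset.eq_of_subset_of_card_le (fun s hs => Finset.mem_erase.2
        ⟨fun h => hb (h ▸ hs), (h.coeff _ _ _).1 hab hs⟩) ?_
      rw [Finset.card_erase_of_mem ha, h.card, h.card]
      rfl
    have h1 : ∀ b, t₀ ∉ W _ b → ∑ a, x a * Q.coeff (i + 1) a b = y b := by
      intro b hb
      obtain ⟨a, ha⟩ := h.surjective (i + 2) (insert t₀ (W _ b))
        (Finset.insert_subset ht₀T (h.subset _ _)) (by rw [Finset.card_insert_of_notMem hb, h.card])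
      have hta : t₀ ∈ W _ a := ha ▸ Finset.mem_insert_self _ _
      have hba : W _ b = (W _ a).erase t₀ := by rw [ha, Finset.erase_insert hb]
      have hne : Q.coeff (i + 1) a b ≠ 0 := (h.coeff _ _ _).2 (hba ▸ Finset.erase_subset _ _)
      rw [Finset.sum_eq_single a]
      · rw [hx a b hta hba, div_mul_cancel₀ _ hne]
      · intro a' _ haa
        by_cases hta' : t₀ ∈ W _ a'
        · by_contra hne'
          have := hcard a' b hta' hb (right_ne_zero_of_mul hne')
          refine haa (h.injective _ ?_)
          rw [← Finset.insert_erase hta', ← this, ha]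
        · simp [x, hta']
      · simp
    let z : Q.gen (i + 1) → k := fun b => ∑ a, x a * Q.coeff (i + 1) a b - y b
    have hz : ∀ d, ∑ b, z b * Q.coeff i b d = 0 := by
      intro d
      simp only [z, sub_mul, Finset.sum_sub_distrib, hdy, sub_zero, Finset.sum_mul]
      rw [Finset.sum_comm]
      refine Finset.sum_eq_zero fun a _ => ?_
      simp only [mul_assoc]
      rw [← Finset.mul_sum, hcc, mul_zero]
    have hz0 : ∀ b, t₀ ∉ W _ b → z b = 0 := fun b hb => by simp only [z, h1 b hb, sub_self]
    intro b
    rw [finsum_eq_sum_of_fintype, ← sub_eq_zero]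
    change z b = 0
    by_cases hb : t₀ ∈ W _ b
    · obtain ⟨d, hd⟩ := h.surjective i ((W _ b).erase t₀)
        ((Finset.erase_subset _ _).trans (h.subset _ _))
        (by rw [Finset.card_erase_of_mem hb, h.card]; rfl)
      have hne : Q.coeff i b d ≠ 0 := (h.coeff _ _ _).2 (hd ▸ Finset.erase_subset _ _)
      -- At `W b \ {t₀}` the boundary of `z` only sees `b`: every other coface in the support of `z`
      -- would contain `t₀` too and hence be `b`.
      have := hz d
      rw [Finset.sum_eq_single b] at this
      · exact (mul_eq_zero.1 this).resolve_right hne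
      · intro b' _ hbb
        by_contra hne'
        have htb' : t₀ ∈ W _ b' := by
          by_contra hcon
          exact hne' (by rw [hz0 b' hcon, zero_mul])
        have hsub := (h.coeff _ _ _).1 (right_ne_zero_of_mul hne')
        rw [hd] at hsub
        refine hbb (h.injective _ (Finset.eq_of_subset_of_card_le ?_ ?_).symm)
        · rw [← Finset.insert_erase hb]
          exact Finset.insert_subset htb' hsub
        · rw [h.card, h.card]
      · simp
    · exact hz0 b hb

theorem IsKoszul.isAcyclicComplex (h : Q.IsKoszul ν m T W) (hν : Function.Injective ν) :
    IsAcyclicComplex Q.toComplex := by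
  intro i
  rw [toComplex_d, toComplex_d]
  exact exact_of_degreewise (M := Q.obj (i + 2)) (N := Q.obj (i + 1)) (P := Q.obj i)
    _ _ _ _ (Q.coeff_comp i) (h.exists_preimage hν i)

end ScalarComplex

namespace MultiFree

variable {k : Type u} [Field k] {σ : Type v}

theorem ofScalars_neg {M N : MultiFree k σ} (A : M.gen → N.gen → k)
    (hA : ∀ b c, A b c ≠ 0 → N.deg c ≤ M.deg b) :
    ofScalars (fun b c => -A b c) (fun b c h => hA b c (neg_ne_zero.1 h)) = -ofScalars A hA := by
  rw [eq_neg_iff_add_eq_zero, ofScalars_add]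
  exact ofScalars_zero _ _ fun b c => neg_add_cancel _

end MultiFree

open MultiFree

theorem finsum_coe_eq_finsum {α M : Type*} [AddCommMonoid M] (s : Set α) (f : α → M)
    (h : ∀ c, c ∉ s → f c = 0) : ∑ᶠ c : s, f c = ∑ᶠ c, f c := by
  rw [finsum_set_coe_eq_finsum_mem, finsum_mem_def]
  refine finsum_congr fun c => ?_
  by_cases hc : c ∈ s
  · rw [Set.indicator_of_mem hc]
  · rw [Set.indicator_of_notMem hc, h c hc]

open Classical in
theorem finsum_ite_mul {α R : Type*} [NonAssocSemiring R] (s : Set α) (b : α) (hb : b ∈ s)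
    (f : α → R) : ∑ᶠ c : s, (if b = c.1 then 1 else 0) * f c = f b := by
  rw [finsum_eq_single _ ⟨b, hb⟩ fun c hc => by
    rw [if_neg fun e => hc (Subtype.ext e.symm), zero_mul], if_pos rfl, one_mul]

open Classical in
theorem finsum_mul_ite {α R : Type*} [NonAssocSemiring R] (d : α)
    (f : α → R) : ∑ᶠ c, f c * (if c = d then 1 else 0) = f d := by
  rw [finsum_eq_single _ d fun c hc => by rw [if_neg hc, mul_zero], if_pos rfl, mul_one]

/-! ### Recognizing mapping cones -/

section ConeOfSplitting

open HomologicalComplex HomologicalComplex.homotopyCofiber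

theorem down_rel (i : ℕ) : (ComplexShape.down ℕ).Rel (i + 1) i := rfl

theorem not_down_rel_zero :
    ¬ (ComplexShape.down ℕ).Rel 0 ((ComplexShape.down ℕ).next 0) := by simp

variable {𝒞 : Type*} [Category 𝒞] [Preadditive 𝒞] [Limits.HasBinaryBiproducts 𝒞]
  {K G D : ChainComplex 𝒞 ℕ} (φ : K ⟶ G)

/-- The data of degreewise direct sum decompositions `D₀ = G₀` and `D_{i+1} = K_i ⊕ G_{i+1}` that
identify the differential of `D` with that of the mapping cone of `φ`. -/
structure ConeSplitting (φ : K ⟶ G) (D : ChainComplex 𝒞 ℕ) where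
  inG : ∀ i, G.X i ⟶ D.X i
  outG : ∀ i, D.X i ⟶ G.X i
  inK : ∀ i, K.X i ⟶ D.X (i + 1)
  outK : ∀ i, D.X (i + 1) ⟶ K.X i
  inG_outG : ∀ i, inG i ≫ outG i = 𝟙 _
  inK_outK : ∀ i, inK i ≫ outK i = 𝟙 _
  inG_outK : ∀ i, inG (i + 1) ≫ outK i = 0
  inK_outG : ∀ i, inK i ≫ outG (i + 1) = 0
  total_zero : outG 0 ≫ inG 0 = 𝟙 _
  total_succ : ∀ i, outK i ≫ inK i + outG (i + 1) ≫ inG (i + 1) = 𝟙 _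
  inG_d : ∀ i, inG (i + 1) ≫ D.d (i + 1) i = G.d (i + 1) i ≫ inG i
  inK_d_zero : inK 0 ≫ D.d 1 0 = φ.f 0 ≫ inG 0
  inK_d_succ : ∀ i, inK (i + 1) ≫ D.d (i + 2) (i + 1) =
    -K.d (i + 1) i ≫ inK i + φ.f (i + 1) ≫ inG (i + 1)

namespace ConeSplitting

variable {φ} (s : ConeSplitting φ D)

/-- The degreewise isomorphism from the mapping cone. -/
def isoX : ∀ i, (homotopyCofiber φ).X i ≅ D.X i
  | 0 =>
    { hom := sndX φ 0 ≫ s.inG 0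
      inv := s.outG 0 ≫ inrX φ 0
      hom_inv_id := ext_from_X' φ 0 not_down_rel_zero (by
        simp only [Category.assoc, inrX_sndX_assoc, homotopyCofiber_X, Category.comp_id]
        rw [← Category.assoc, s.inG_outG, Category.id_comp])
      inv_hom_id := by
        rw [Category.assoc, inrX_sndX_assoc, s.total_zero] }
  | i + 1 =>
    { hom := fstX φ (i + 1) i (down_rel i) ≫ s.inK i + sndX φ (i + 1) ≫ s.inG (i + 1)
      inv := s.outK i ≫ inlX φ i (i + 1) (down_rel i) + s.outG (i + 1) ≫ inrX φ (i + 1)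
      hom_inv_id := by
        refine ext_from_X φ i (i + 1) (down_rel i) ?_ ?_
        · simp only [Preadditive.add_comp, Preadditive.comp_add, Category.assoc, inlX_fstX_assoc,
            inlX_sndX_assoc, Limits.zero_comp, add_zero, homotopyCofiber_X, Category.comp_id]
          rw [← Category.assoc, s.inK_outK, ← Category.assoc (s.inK i), s.inK_outG,
            Category.id_comp, Limits.zero_comp, add_zero]
        · simp only [Preadditive.add_comp, Preadditive.comp_add, Category.assoc, inrX_fstX_assoc,
            inrX_sndX_assoc, Limits.zero_comp, zero_add, homotopyCofiber_X, Category.comp_id]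
          rw [← Category.assoc, s.inG_outK, ← Category.assoc (s.inG (i + 1)), s.inG_outG,
            Category.id_comp, Limits.zero_comp, zero_add]
      inv_hom_id := by
        simp only [Preadditive.add_comp, Preadditive.comp_add, Category.assoc, inlX_fstX_assoc,
          inlX_sndX_assoc, inrX_fstX_assoc, inrX_sndX_assoc, Limits.zero_comp, Limits.comp_zero,
          add_zero, zero_add]
        exact s.total_succ i }

theorem inrX_isoX_hom (i : ℕ) : inrX φ i ≫ (s.isoX i).hom = s.inG i := by
  cases i with
  | zero => simp [isoX]
  | succ i => simp [isoX]

theorem inlX_isoX_hom (i : ℕ) : inlX φ i (i + 1) (down_rel i) ≫ (s.isoX (i + 1)).hom = s.inK i := by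
  simp [isoX]

/-- A complex with a cone splitting is isomorphic to the mapping cone. -/
def iso : homotopyCofiber φ ≅ D :=
  HomologicalComplex.Hom.isoOfComponents s.isoX (by
    rintro i j rfl
    change (s.isoX (j + 1)).hom ≫ D.d (j + 1) j = d φ (j + 1) j ≫ (s.isoX j).hom
    refine ext_from_X φ j (j + 1) (down_rel j) ?_ ?_
    · rw [← Category.assoc, inlX_isoX_hom]
      cases j with
      | zero =>
        rw [inlX_d'_assoc φ 1 0 (down_rel 0) not_down_rel_zero, inrX_isoX_hom, s.inK_d_zero]
      | succ j =>
        rw [inlX_d_assoc φ (j + 2) (j + 1) j (down_rel _) (down_rel _), s.inK_d_succ, Preadditive.add_comp,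
          Category.assoc, inrX_isoX_hom, Preadditive.neg_comp, Category.assoc, inlX_isoX_hom]
    · rw [← Category.assoc, inrX_isoX_hom, inrX_d_assoc, inrX_isoX_hom, s.inG_d])

theorem inr_iso_hom_f (i : ℕ) : (inr φ).f i ≫ s.iso.hom.f i = s.inG i :=
  s.inrX_isoX_hom i

/-- Replacing the target of `φ` by an isomorphic complex. -/
def transport {G' : ChainComplex 𝒞 ℕ} (j : G ≅ G') : ConeSplitting (φ ≫ j.hom) D where
  inG i := j.inv.f i ≫ s.inG i
  outG i := s.outG i ≫ j.hom.f i
  inK := s.inK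
  outK := s.outK
  inG_outG i := by
    rw [Category.assoc, ← Category.assoc (s.inG i), s.inG_outG, Category.id_comp, ← comp_f,
      j.inv_hom_id, id_f]
  inK_outK := s.inK_outK
  inG_outK i := by rw [Category.assoc, s.inG_outK, Limits.comp_zero]
  inK_outG i := by rw [← Category.assoc, s.inK_outG, Limits.zero_comp]
  total_zero := by
    rw [Category.assoc, ← Category.assoc (j.hom.f 0), ← comp_f, j.hom_inv_id, id_f,
      Category.id_comp, s.total_zero]
  total_succ i := by
    rw [Category.assoc, ← Category.assoc (j.hom.f _), ← comp_f, j.hom_inv_id, id_f,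
      Category.id_comp, s.total_succ]
  inG_d i := by
    rw [Category.assoc, s.inG_d, ← Category.assoc, j.inv.comm, Category.assoc]
  inK_d_zero := by
    rw [comp_f, Category.assoc, ← Category.assoc (j.hom.f 0), ← comp_f, j.hom_inv_id, id_f,
      Category.id_comp, s.inK_d_zero]
  inK_d_succ i := by
    rw [comp_f, Category.assoc, ← Category.assoc (j.hom.f _), ← comp_f, j.hom_inv_id, id_f,
      Category.id_comp, s.inK_d_succ]

end ConeSplitting

end ConeOfSplitting

/-! ### Subcomplexes spanned by basis elements, and mapping cones between them -/

namespace ScalarComplex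

variable {k : Type u} [Field k] {σ : Type v} (Q : ScalarComplex k σ)

/-- The free module on a set of basis elements in homological degree `i`. -/
def part (i : ℕ) (S : Set (Q.gen i)) : MultiFree k σ :=
  { gen := S, finite_gen := inferInstance, deg := fun b => Q.deg i b }

open Classical in
/-- The map between two spans of basis elements that is the identity on common basis elements and
zero on the others. -/
def partMap {i : ℕ} (S T : Set (Q.gen i)) : Q.part i S ⟶ Q.part i T :=
  ofScalars (M := Q.part i S) (N := Q.part i T)
    (fun (b : S) (c : T) => if b.1 = c.1 then 1 else 0) (by
      rintro ⟨b, hb⟩ ⟨c, hc⟩ h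
      dsimp only at h
      split_ifs at h with e
      · subst e
        exact le_rfl
      · exact absurd rfl h)

/-- The component of the differential between two spans of basis elements. -/
def partDiff {i : ℕ} (S : Set (Q.gen (i + 1))) (T : Set (Q.gen i)) :
    Q.part (i + 1) S ⟶ Q.part i T :=
  ofScalars (M := Q.part (i + 1) S) (N := Q.part i T)
    (fun (b : S) (c : T) => Q.coeff i b c) (fun _ _ h => Q.deg_le i _ _ h)

variable {Q}

theorem partMap_self {i : ℕ} (S : Set (Q.gen i)) : Q.partMap S S = 𝟙 _ :=
  ofScalars_one _ _ (fun _ => if_pos rfl) fun _ _ h => if_neg fun e => h (Subtype.ext e)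

theorem partMap_eq_zero {i : ℕ} {S T : Set (Q.gen i)} (h : Disjoint S T) :
    Q.partMap S T = 0 :=
  ofScalars_zero _ _ fun b c => if_neg fun e =>
    Set.disjoint_left.1 h b.2 (by rw [e]; exact c.2)

theorem partMap_comp {i : ℕ} {S T U : Set (Q.gen i)} (h : ∀ b ∈ S, b ∈ U → b ∈ T) :
    Q.partMap S T ≫ Q.partMap T U = Q.partMap S U := by
  classical
  refine (ofScalars_comp _ _ _ _).trans (ofScalars_congr ?_)
  rintro ⟨b, hb⟩ ⟨d, hd⟩
  refine (finsum_coe_eq_finsum T (fun c => (if b = c then (1 : k) else 0) * if c = d then 1 else 0)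
    ?_).trans ?_
  · intro c hc
    by_cases e : b = c
    · subst e
      rw [if_neg (fun e : b = d => hc (h b hb (e ▸ hd))), mul_zero]
    · rw [if_neg e, zero_mul]
  · rw [finsum_eq_single _ b fun c hc => by rw [if_neg hc.symm, zero_mul], if_pos rfl, one_mul]

theorem partMap_comp_partDiff {i : ℕ} {S T : Set (Q.gen (i + 1))} {U : Set (Q.gen i)}
    (h : ∀ b ∈ S, ∀ c ∈ U, Q.coeff i b c ≠ 0 → b ∈ T) :
    Q.partMap S T ≫ Q.partDiff T U = Q.partDiff S U := by
  classical
  refine (ofScalars_comp _ _ _ _).trans (ofScalars_congr ?_)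
  rintro ⟨b, hb⟩ ⟨d, hd⟩
  refine (finsum_coe_eq_finsum T (fun c => (if b = c then (1 : k) else 0) * Q.coeff i c d)
    ?_).trans ?_
  · intro c hc
    by_cases e : b = c
    · subst e
      rw [not_imp_comm.1 (h b hb d hd) hc, mul_zero]
    · rw [if_neg e, zero_mul]
  · rw [finsum_eq_single _ b fun c hc => by rw [if_neg hc.symm, zero_mul], if_pos rfl, one_mul]

/-- The condition on `T` concerns only the targets of nonzero entries, so that it follows from
closure under the differential. -/
theorem partDiff_comp_partMap {i : ℕ} {S : Set (Q.gen (i + 1))} {T U : Set (Q.gen i)}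
    (h : ∀ b ∈ S, ∀ c ∈ U, Q.coeff i b c ≠ 0 → c ∈ T) :
    Q.partDiff S T ≫ Q.partMap T U = Q.partDiff S U := by
  classical
  refine (ofScalars_comp _ _ _ _).trans (ofScalars_congr ?_)
  rintro ⟨b, hb⟩ ⟨d, hd⟩
  refine (finsum_coe_eq_finsum T (fun c => Q.coeff i b c * (if c = d then (1 : k) else 0))
    ?_).trans ?_
  · intro c hc
    by_cases e : c = d
    · subst e
      rw [not_imp_comm.1 (h b hb c hd) hc, zero_mul]
    · rw [if_neg e, mul_zero]
  · rw [finsum_eq_single _ d fun c hc => by rw [if_neg hc, mul_zero], if_pos rfl, mul_one]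

theorem partMap_add {i : ℕ} {S T₁ T₂ : Set (Q.gen i)} (h : ∀ b ∈ S, b ∈ T₁ ∨ b ∈ T₂)
    (hd : Disjoint T₁ T₂) :
    Q.partMap S T₁ ≫ Q.partMap T₁ S + Q.partMap S T₂ ≫ Q.partMap T₂ S = 𝟙 _ := by
  classical
  have key : ∀ (T : Set (Q.gen i)) (b d : S),
      (∑ᶠ c : T, (if b.1 = c.1 then (1 : k) else 0) * if c.1 = d.1 then 1 else 0) =
        if b.1 ∈ T ∧ b = d then 1 else 0 := by
    rintro T ⟨b, hb⟩ ⟨d, hd⟩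
    by_cases hbT : b ∈ T
    · rw [finsum_eq_single _ ⟨b, hbT⟩ fun c hc => by
        rw [if_neg fun e : b = c.1 => hc (Subtype.ext e.symm), zero_mul]]
      simp [hbT]
    · rw [if_neg fun h => hbT h.1]
      refine (finsum_congr fun c => ?_).trans finsum_zero
      rw [if_neg, zero_mul]
      rintro rfl
      exact hbT c.2
  refine (congrArg₂ (· + ·) (ofScalars_comp _ _ _ _) (ofScalars_comp _ _ _ _)).trans
    ((ofScalars_add _ _ _ _).trans (ofScalars_one _ _ ?_ ?_))
  · intro b
    refine (congrArg₂ (· + ·) (key T₁ b b) (key T₂ b b)).trans ?_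
    rcases h b.1 b.2 with h1 | h2
    · rw [if_pos ⟨h1, rfl⟩, if_neg fun h => Set.disjoint_left.1 hd h1 h.1, add_zero]
    · rw [if_neg fun h => Set.disjoint_right.1 hd h2 h.1, if_pos ⟨h2, rfl⟩, zero_add]
  · intro b c hbc
    refine (congrArg₂ (· + ·) (key T₁ b c) (key T₂ b c)).trans ?_
    rw [if_neg fun e => hbc e.2, if_neg fun e => hbc e.2, add_zero]

/-- This is the vanishing of the square of the differential, with the intermediate basis elements
sorted into two blocks. It makes the connecting map a chain map. -/
theorem partDiff_comp_add {i : ℕ} {S : Set (Q.gen (i + 2))} {T₁ T₂ : Set (Q.gen (i + 1))}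
    {U : Set (Q.gen i)} (hd : Disjoint T₁ T₂)
    (h : ∀ b ∈ S, ∀ c, ∀ d ∈ U, Q.coeff (i + 1) b c ≠ 0 → Q.coeff i c d ≠ 0 → c ∈ T₁ ∨ c ∈ T₂) :
    Q.partDiff S T₁ ≫ Q.partDiff T₁ U + Q.partDiff S T₂ ≫ Q.partDiff T₂ U = 0 := by
  classical
  refine (congrArg₂ (· + ·) (ofScalars_comp _ _ _ _) (ofScalars_comp _ _ _ _)).trans
    ((ofScalars_add _ _ _ _).trans (ofScalars_zero _ _ ?_))
  rintro ⟨b, hb⟩ ⟨d, hdU⟩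
  change (∑ᶠ c : T₁, Q.coeff (i + 1) b c * Q.coeff i c d) +
    (∑ᶠ c : T₂, Q.coeff (i + 1) b c * Q.coeff i c d) = 0
  rw [finsum_set_coe_eq_finsum_mem (f := fun c => Q.coeff (i + 1) b c * Q.coeff i c d),
    finsum_set_coe_eq_finsum_mem (f := fun c => Q.coeff (i + 1) b c * Q.coeff i c d),
    ← finsum_mem_union hd (Set.toFinite _) (Set.toFinite _),
    ← finsum_set_coe_eq_finsum_mem]
  refine (finsum_coe_eq_finsum _ (fun c => Q.coeff (i + 1) b c * Q.coeff i c d)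
    fun c hc => ?_).trans (Q.coeff_comp i b d)
  by_contra hne
  exact hc (h b hb c d hdU (left_ne_zero_of_mul hne) (right_ne_zero_of_mul hne))

theorem partDiff_eq_add {i : ℕ} {S : Set (Q.gen (i + 1))} {T₁ T₂ U : Set (Q.gen i)}
    (h₁ : T₁ ⊆ U) (h₂ : T₂ ⊆ U) (h : ∀ c ∈ U, c ∈ T₁ ∨ c ∈ T₂) (hd : Disjoint T₁ T₂) :
    Q.partDiff S U = Q.partDiff S T₁ ≫ Q.partMap T₁ U + Q.partDiff S T₂ ≫ Q.partMap T₂ U := by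
  conv_lhs => rw [← Category.comp_id (Q.partDiff S U), ← partMap_add h hd, Preadditive.comp_add,
    ← Category.assoc, ← Category.assoc, partDiff_comp_partMap fun _ _ _ hc _ => h₁ hc,
    partDiff_comp_partMap fun _ _ _ hc _ => h₂ hc]

/-- A family of sets of basis elements that spans a subcomplex. -/
def IsSub (Q : ScalarComplex k σ) (P : ∀ i, Set (Q.gen i)) : Prop :=
  ∀ i b c, Q.coeff i b c ≠ 0 → b ∈ P (i + 1) → c ∈ P i

/-- The subcomplex spanned by a family of basis elements. -/
def sub (P : ∀ i, Set (Q.gen i)) (hP : Q.IsSub P) : ScalarComplex k σ where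
  gen i := P i
  finite_gen := inferInstance
  deg i b := Q.deg i b
  coeff i b c := Q.coeff i b c
  deg_le i _ _ h := Q.deg_le i _ _ h
  coeff_comp i b d := by
    refine (finsum_coe_eq_finsum (P (i + 1)) (fun c => Q.coeff (i + 1) b c * Q.coeff i c d)
      fun c hc => ?_).trans (Q.coeff_comp i b d)
    by_contra hne
    exact hc (hP _ _ _ (left_ne_zero_of_mul hne) b.2)

/-- The quotient of two subcomplexes, shifted by one homological degree, with the sign of the
differential changed. -/
def quo (P P' : ∀ i, Set (Q.gen i)) (hP : Q.IsSub P) (hP' : Q.IsSub P') : ScalarComplex k σ where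
  gen i := (P' (i + 1) \ P (i + 1) : Set (Q.gen (i + 1)))
  finite_gen := inferInstance
  deg i b := Q.deg (i + 1) b
  -- The differential of a mapping cone contains `-d_K`; the sign here cancels that one, so that the
  -- cone recovers the original differential.
  coeff i b c := -Q.coeff (i + 1) b c
  deg_le i _ _ h := Q.deg_le (i + 1) _ _ (neg_ne_zero.1 h)
  coeff_comp i b d := by
    simp only [neg_mul_neg]
    refine (finsum_coe_eq_finsum (P' (i + 2) \ P (i + 2))
      (fun c => Q.coeff (i + 2) b c * Q.coeff (i + 1) c d)
      fun c hc => ?_).trans (Q.coeff_comp (i + 1) b d)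
    by_contra hne
    exact hc ⟨hP' _ _ _ (left_ne_zero_of_mul hne) b.2.1,
      fun h => d.2.2 (hP _ _ _ (right_ne_zero_of_mul hne) h)⟩

section Cone

variable {P P' : ∀ i, Set (Q.gen i)} (hP : Q.IsSub P) (hP' : Q.IsSub P')

theorem sub_d (i : ℕ) : (sub P hP).toComplex.d (i + 1) i = Q.partDiff (P (i + 1)) (P i) :=
  toComplex_d _ _

theorem quo_d (i : ℕ) : (quo P P' hP hP').toComplex.d (i + 1) i =
    -Q.partDiff (P' (i + 2) \ P (i + 2)) (P' (i + 1) \ P (i + 1)) :=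
  (toComplex_d _ _).trans (ofScalars_neg (M := Q.part (i + 2) (P' (i + 2) \ P (i + 2)))
    (N := Q.part (i + 1) (P' (i + 1) \ P (i + 1))) _ _)

/-- The connecting map whose mapping cone is the larger of two subcomplexes. -/
def connecting : (quo P P' hP hP').toComplex ⟶ (sub P hP).toComplex where
  f i := Q.partDiff (P' (i + 1) \ P (i + 1)) (P i)
  comm' := by
    rintro i j rfl
    rw [sub_d, quo_d]
    change Q.partDiff (P' (j + 2) \ P (j + 2)) (P (j + 1)) ≫ Q.partDiff (P (j + 1)) (P j) =
      (-Q.partDiff (P' (j + 2) \ P (j + 2)) (P' (j + 1) \ P (j + 1))) ≫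
        Q.partDiff (P' (j + 1) \ P (j + 1)) (P j)
    rw [Preadditive.neg_comp, ← add_eq_zero_iff_eq_neg]
    refine partDiff_comp_add Set.disjoint_sdiff_right fun b hb c d hd hbc hcd => ?_
    by_cases hc : c ∈ P (j + 1)
    · exact Or.inl hc
    · exact Or.inr ⟨hP' _ _ _ hbc hb.1, hc⟩


/-- The larger of two subcomplexes is the mapping cone of the connecting map. -/
def coneSplitting (hPP : ∀ i, P i ⊆ P' i) (h0 : P' 0 ⊆ P 0) :
    ConeSplitting (connecting hP hP') (sub P' hP').toComplex where
  inG i := Q.partMap (P i) (P' i)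
  outG i := Q.partMap (P' i) (P i)
  inK i := Q.partMap (P' (i + 1) \ P (i + 1)) (P' (i + 1))
  outK i := Q.partMap (P' (i + 1)) (P' (i + 1) \ P (i + 1))
  inG_outG i := (partMap_comp fun _ hb _ => hPP i hb).trans (partMap_self _)
  inK_outK i := (partMap_comp fun _ hb _ => hb.1).trans (partMap_self _)
  inG_outK i := (partMap_comp fun _ _ hb => hb.1).trans
    (partMap_eq_zero Set.disjoint_sdiff_right)
  inK_outG i := (partMap_comp fun _ hb _ => hb.1).trans
    (partMap_eq_zero Set.disjoint_sdiff_left)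
  total_zero := (partMap_comp fun _ hb _ => h0 hb).trans (partMap_self _)
  total_succ i := partMap_add (fun b hb => (em (b ∈ P (i + 1))).symm.imp_left fun h => ⟨hb, h⟩)
    Set.disjoint_sdiff_left
  inG_d i := by
    rw [sub_d, sub_d]
    exact (partMap_comp_partDiff fun _ hb _ _ _ => hPP _ hb).trans
      (partDiff_comp_partMap fun _ hb _ _ hbc => hP _ _ _ hbc hb).symm
  inK_d_zero := by
    rw [sub_d]
    exact (partMap_comp_partDiff fun _ hb _ _ _ => hb.1).trans
      (partDiff_comp_partMap fun _ _ _ hc _ => h0 hc).symm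
  inK_d_succ i := by
    rw [sub_d, quo_d]
    change Q.partMap (P' (i + 2) \ P (i + 2)) (P' (i + 2)) ≫ Q.partDiff (P' (i + 2)) (P' (i + 1)) =
      -((-Q.partDiff (P' (i + 2) \ P (i + 2)) (P' (i + 1) \ P (i + 1))) ≫
        Q.partMap (P' (i + 1) \ P (i + 1)) (P' (i + 1))) +
      Q.partDiff (P' (i + 2) \ P (i + 2)) (P (i + 1)) ≫ Q.partMap (P (i + 1)) (P' (i + 1))
    rw [Preadditive.neg_comp, neg_neg, partMap_comp_partDiff fun _ hb _ _ _ => hb.1]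
    exact partDiff_eq_add Set.sdiff_subset (hPP _)
      (fun c hc => (em (c ∈ P (i + 1))).symm.imp_left fun h => ⟨hc, h⟩) Set.disjoint_sdiff_left

end Cone

variable (Q) in
/-- The map to `S(-a)` that sends every basis element of degree `0` to a monomial. -/
def aug (a : σ →₀ ℕ) (h : ∀ b, a ≤ Q.deg 0 b) : Q.toComplex.X 0 ⟶ twist k a :=
  ofScalars (M := Q.obj 0) (N := twist k a) (fun _ _ => 1) (fun b _ _ => h b)

variable {ι : Type*} (rank : ∀ i, Q.gen (i + 1) → ι)

/-- The basis elements whose rank lies in a given set, and all those of degree `0`. -/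
def rankSet (D : Set ι) : ∀ i, Set (Q.gen i)
  | 0 => Set.univ
  | i + 1 => {b | rank i b ∈ D}

theorem rankSet_mono {D D' : Set ι} (h : D ⊆ D') (i : ℕ) : rankSet rank D i ⊆ rankSet rank D' i := by
  cases i with
  | zero => exact subset_rfl
  | succ i => exact fun b hb => h hb

theorem isSub_rankSet {D : Set ι}
    (h : ∀ i b c, Q.coeff (i + 1) b c ≠ 0 → rank (i + 1) b ∈ D → rank i c ∈ D) :
    Q.IsSub (rankSet rank D) := by
  rintro (_ | i) b c hbc hb
  · exact Set.mem_univ _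
  · exact h i b c hbc hb

open Classical in
/-- The inclusion of all basis elements into a part that contains them. -/
def toPart {i : ℕ} (S : Set (Q.gen i)) : Q.obj i ⟶ Q.part i S :=
  ofScalars (M := Q.obj i) (N := Q.part i S) (fun (b : Q.gen i) (c : S) => if b = c.1 then 1 else 0)
    (by
      intro b c h
      obtain rfl : b = c.1 := by
        by_contra hcon
        exact h (if_neg hcon)
      exact le_rfl)

open Classical in
/-- The inclusion of a part into the module of all basis elements. -/
def ofPart {i : ℕ} (S : Set (Q.gen i)) : Q.part i S ⟶ Q.obj i :=
  ofScalars (M := Q.part i S) (N := Q.obj i) (fun (b : S) (c : Q.gen i) => if b.1 = c then 1 else 0)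
    (by
      intro b c h
      obtain rfl : b.1 = c := by
        by_contra hcon
        exact h (if_neg hcon)
      exact le_rfl)

theorem toPart_comp_ofPart {i : ℕ} {S : Set (Q.gen i)} (h : ∀ b, b ∈ S) :
    Q.toPart S ≫ Q.ofPart S = 𝟙 _ := by
  classical
  refine (ofScalars_comp _ _ _ _).trans (ofScalars_one _ _ (fun b => ?_) fun b d hbd => ?_)
  · exact (finsum_ite_mul S b (h b) fun c => if c = b then 1 else 0).trans (if_pos rfl)
  · exact (finsum_ite_mul S b (h b) fun c => if c = d then 1 else 0).trans (if_neg hbd)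

theorem ofPart_comp_toPart {i : ℕ} {S : Set (Q.gen i)} :
    Q.ofPart S ≫ Q.toPart S = 𝟙 _ := by
  classical
  refine (ofScalars_comp _ _ _ _).trans (ofScalars_one _ _ (fun b => ?_) fun b d hbd => ?_)
  · exact (finsum_mul_ite b.1 fun c => if b.1 = c then (1 : k) else 0).trans (if_pos rfl)
  · exact (finsum_mul_ite d.1 fun c => if b.1 = c then (1 : k) else 0).trans
      (if_neg fun e => hbd (Subtype.ext e))

theorem toPart_comp_partDiff {i : ℕ} {S : Set (Q.gen (i + 1))} {T : Set (Q.gen i)}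
    (h : ∀ b, b ∈ S) : Q.toPart S ≫ Q.partDiff S T = Q.diff i ≫ Q.toPart T := by
  classical
  refine (ofScalars_comp _ _ _ _).trans (Eq.trans (ofScalars_congr fun b d => ?_)
    (ofScalars_comp (M := Q.obj (i + 1)) (N := Q.obj i) (P := Q.part i T) _ (Q.deg_le i) _ _).symm)
  exact (finsum_ite_mul S b (h b) fun c => Q.coeff i c d.1).trans
    (finsum_mul_ite d.1 fun c => Q.coeff i b c).symm

variable (Q) in
/-- Subcomplexes that contain all basis elements are isomorphic to the whole complex. -/
def subIso (P : ∀ i, Set (Q.gen i)) (hP : Q.IsSub P) (h : ∀ i b, b ∈ P i) :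
    Q.toComplex ≅ (sub P hP).toComplex :=
  HomologicalComplex.Hom.isoOfComponents
    (fun i =>
      { hom := Q.toPart (P i)
        inv := Q.ofPart (P i)
        hom_inv_id := toPart_comp_ofPart (h i)
        inv_hom_id := ofPart_comp_toPart }) (by
    rintro i j rfl
    rw [sub_d, toComplex_d]
    exact toPart_comp_partDiff (h _))

section Augmentation

variable {P P' : ∀ i, Set (Q.gen i)} {hP : Q.IsSub P} {hP' : Q.IsSub P'}

theorem partMap_comp_aug (h : P 0 ⊆ P' 0) (a : σ →₀ ℕ) (ha : ∀ b, a ≤ (sub P hP).deg 0 b)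
    (ha' : ∀ b, a ≤ (sub P' hP').deg 0 b) :
    Q.partMap (P 0) (P' 0) ≫ aug (sub P' hP') a ha' = aug (sub P hP) a ha := by
  refine (ofScalars_comp _ _ _ _).trans (ofScalars_congr fun b _ => ?_)
  exact finsum_ite_mul (P' 0) b.1 (h b.2) fun _ => 1

/-- Because all entries from degree `1` to the unique generator in degree `0` are `1`, the
connecting map lifts multiplication by `x^a` exactly, not merely modulo the ideal. -/
theorem connecting_f_zero_comp_aug [Unique (Q.gen 0)] (h0 : ∀ b, b ∈ P 0)
    (hone : ∀ b c, Q.coeff 0 b c = 1) (a : σ →₀ ℕ) (ha : ∀ b, a ≤ (quo P P' hP hP').deg 0 b)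
    (ha' : ∀ b, 0 ≤ (sub P hP).deg 0 b) :
    (connecting hP hP').f 0 ≫ aug (sub P hP) 0 ha' =
      aug (quo P P' hP hP') a ha ≫ mulMonomial k a := by
  refine (ofScalars_comp (M := (quo P P' hP hP').obj 0) (N := (sub P hP).obj 0)
    (P := twist k 0) _ (fun b c h => Q.deg_le 0 _ _ h) _ _).trans
    (Eq.trans (ofScalars_congr fun b d => ?_)
    (ofScalars_comp (M := (quo P P' hP hP').obj 0) (N := twist k a) _ _ _ _).symm)
  refine (finsum_eq_single _ (⟨default, h0 _⟩ : P 0) fun c hc => ?_).trans ?_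
  · exact absurd (Subtype.ext (Subsingleton.elim _ _)) hc
  · rw [hone]
    exact (finsum_unique (α := Unit) fun _ => (1 : k) * 1).symm

theorem isIso_aug [Unique (Q.gen 0)] (hdeg : ∀ b, Q.deg 0 b = 0) (h0 : ∀ b, b ∈ P 0)
    (ha : ∀ b, 0 ≤ (sub P hP).deg 0 b) : IsIso (aug (sub P hP) 0 ha) := by
  refine ⟨ofScalars (M := twist k 0) (N := (sub P hP).obj 0) (fun _ _ => 1)
    (fun _ b _ => (hdeg b.1).le), ?_, ?_⟩
  · refine (ofScalars_comp _ _ _ _).trans (ofScalars_one _ _ (fun b => ?_) fun b d hbd => ?_)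
    · exact (finsum_unique (α := Unit) fun _ => (1 : k) * 1).trans (mul_one 1)
    · exact absurd (Subtype.ext (Subsingleton.elim (α := Q.gen 0) _ _)) hbd
  · refine (ofScalars_comp _ _ _ _).trans (ofScalars_one _ _ (fun b => ?_) fun b d hbd => ?_)
    · refine (finsum_eq_single _ (⟨default, h0 _⟩ : P 0) fun c hc => ?_).trans (mul_one 1)
      exact absurd (Subtype.ext (Subsingleton.elim (α := Q.gen 0) _ _)) hc
    · exact absurd rfl hbd

end Augmentation

/-- A complex whose basis elements are ranked compatibly with the differential is an iterated
mapping cone as soon as the pieces of constant rank are resolutions of the colon ideals. -/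
theorem exists_isIteratedMappingCone (l : List ι) (e : ι → (σ →₀ ℕ))
    [Unique (Q.gen 0)] (hdeg : ∀ b, Q.deg 0 b = 0) (hone : ∀ b c, Q.coeff 0 b c = 1)
    (hclosed : ∀ l₁ l₂, l = l₁ ++ l₂ → Q.IsSub (rankSet rank {b | b ∈ l₁}))
    (hle : ∀ (l₁ l₂ : List ι) (a : ι) (h : l = l₁ ++ [a] ++ l₂) b,
      e a ≤ (quo (rankSet rank {b | b ∈ l₁}) (rankSet rank {b | b ∈ l₁ ++ [a]})
        (hclosed l₁ ([a] ++ l₂) (by rw [h, List.append_assoc])) (hclosed _ l₂ h)).deg 0 b)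
    (hres : ∀ (l₁ l₂ : List ι) (a : ι) (h : l = l₁ ++ [a] ++ l₂),
      IsFreeResolution (quo (rankSet rank {b | b ∈ l₁}) (rankSet rank {b | b ∈ l₁ ++ [a]})
        (hclosed l₁ ([a] ++ l₂) (by rw [h, List.append_assoc])) (hclosed _ l₂ h)).toComplex (e a)
        (aug _ (e a) (hle l₁ l₂ a h)) (colonIdeal k (l₁.map e) (e a)))
    (hmin : ∀ (l₁ l₂ : List ι) (a : ι) (h : l = l₁ ++ [a] ++ l₂),
      IsMinimalComplex (quo (rankSet rank {b | b ∈ l₁}) (rankSet rank {b | b ∈ l₁ ++ [a]})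
        (hclosed l₁ ([a] ++ l₂) (by rw [h, List.append_assoc])) (hclosed _ l₂ h)).toComplex) :
    ∀ (l₁ l₂ : List ι) (h : l = l₁ ++ l₂), ∃ (C : ChainComplex (MultiFree k σ) ℕ)
      (ε : C.X 0 ⟶ twist k 0), IsIteratedMappingCone (l₁.map e) C ε ∧
      ∃ i : (sub _ (hclosed l₁ l₂ h)).toComplex ≅ C,
        i.hom.f 0 ≫ ε = aug _ 0 (fun _ => zero_le) := by
  intro l₁
  induction l₁ using List.reverseRecOn with
  | nil =>
    intro l₂ h
    refine ⟨(sub _ (hclosed [] l₂ h)).toComplex, aug _ 0 (fun _ => zero_le), ?_, Iso.refl _,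
      Category.id_comp _⟩
    refine IsIteratedMappingCone.nil _ _ ?_ ?_
    · exact isIso_aug hdeg (fun _ => Set.mem_univ _) _
    · intro i
      -- No rank lies in the empty list, so only homological degree `0` survives.
      have : IsEmpty ((sub _ (hclosed [] l₂ h)).obj (i + 1)).gen :=
        ⟨fun b => List.not_mem_nil (b.2 : _ ∈ ([] : List ι))⟩
      exact isZero_of_isEmpty ((sub _ (hclosed [] l₂ h)).obj (i + 1))
  | append_singleton l₁ a ih =>
    intro l₂ h
    have h' : l = l₁ ++ ([a] ++ l₂) := by rw [h, List.append_assoc]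
    obtain ⟨C, ε, hC, i, hi⟩ := ih ([a] ++ l₂) h'
    have hsub := rankSet_mono (Q := Q) rank (D := {b | b ∈ l₁}) (D' := {b | b ∈ l₁ ++ [a]})
      fun b hb => List.mem_append_left _ hb
    -- The induction provides the previous stage only up to the isomorphism `i`, so the connecting
    -- map is composed with `i` before its cone is formed.
    let s := (coneSplitting (hclosed l₁ _ h') (hclosed _ l₂ h) hsub subset_rfl).transport i
    have hε : (HomologicalComplex.homotopyCofiber.inr _).f 0 ≫ s.iso.hom.f 0 ≫
        aug (sub _ (hclosed _ l₂ h)) 0 (fun _ => zero_le) = ε := by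
      rw [← Category.assoc, s.inr_iso_hom_f]
      refine (Category.assoc _ _ _).trans ?_
      refine (congrArg (i.inv.f 0 ≫ ·) (partMap_comp_aug (hP := hclosed l₁ _ h')
        (hP' := hclosed _ l₂ h) subset_rfl 0 (fun _ => zero_le) (fun _ => zero_le))).trans ?_
      rw [← hi, ← Category.assoc, ← HomologicalComplex.comp_f, i.inv_hom_id,
        HomologicalComplex.id_f, Category.id_comp]
    refine ⟨_, s.iso.hom.f 0 ≫ aug _ 0 (fun _ => zero_le), ?_, s.iso.symm, ?_⟩
    · rw [List.map_append, List.map_singleton]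
      refine IsIteratedMappingCone.cone _ C ε hC (e a) _ _ (hres l₁ l₂ a h) (hmin l₁ l₂ a h) _ ?_
        _ hε
      intro x
      rw [HomologicalComplex.comp_f, Category.assoc, hi,
        connecting_f_zero_comp_aug (fun _ => Set.mem_univ _) hone (e a) (hle l₁ l₂ a h), sub_self]
      exact Ideal.zero_mem _
    · rw [← Category.assoc, Iso.symm_hom, ← HomologicalComplex.comp_f, s.iso.inv_hom_id,
        HomologicalComplex.id_f, Category.id_comp]

end ScalarComplex

open MultiFree

/-! ### Mapping cones of resolutions are resolutions -/

section Resolutions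

variable {k : Type u} [Field k] {σ : Type v}

theorem MultiFree.lin_comp_apply {M N P : MultiFree k σ} (f : M ⟶ N) (g : N ⟶ P) (x : M.Elt) :
    lin (f ≫ g) x = lin g (lin f x) := rfl

theorem MultiFree.eq_zero_of_isZero {M : MultiFree k σ} (h : Limits.IsZero M) (x : M.Elt) :
    x = 0 := by
  have := congrArg (fun f => lin f x) ((Limits.IsZero.iff_id_eq_zero M).1 h)
  simpa using this

theorem MultiFree.lin_mulMonomial_apply (a : σ →₀ ℕ) (x : (twist k a).Elt) :
    lin (mulMonomial k a) x () = x () * MvPolynomial.monomial a 1 := by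
  refine (lin_ofScalars_apply (M := twist k a) (N := twist k 0) _ _ x ()).trans ?_
  refine (finsum_unique (α := Unit) _).trans ?_
  change x () * MvPolynomial.monomial (a - 0) 1 = _
  rw [tsub_zero]

theorem MultiFree.lin_add_unit {M : MultiFree k σ} {a : σ →₀ ℕ} (f : M ⟶ twist k a)
    (x y : M.Elt) : lin f (x + y) () = lin f x () + lin f y () := by
  rw [map_add]
  rfl

theorem MultiFree.lin_neg_unit {M : MultiFree k σ} {a : σ →₀ ℕ} (f : M ⟶ twist k a)
    (x : M.Elt) : lin f (-x) () = -lin f x () := by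
  rw [map_neg]
  rfl

theorem MultiFree.lin_sub_unit {M : MultiFree k σ} {a : σ →₀ ℕ} (f : M ⟶ twist k a)
    (x y : M.Elt) : lin f (x - y) () = lin f x () - lin f y () := by
  rw [map_sub]
  rfl

theorem MultiFree.lin_d_d (C : ChainComplex (MultiFree k σ) ℕ) (i j l : ℕ) (x : (C.X i).Elt) :
    lin (C.d j l) (lin (C.d i j) x) = 0 := by
  rw [← lin_comp_apply, C.d_comp_d, lin_zero, LinearMap.zero_apply]

theorem IsAcyclicComplex.of_iso {C D : ChainComplex (MultiFree k σ) ℕ} (e : C ≅ D)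
    (h : IsAcyclicComplex C) : IsAcyclicComplex D := by
  intro i x
  refine ⟨fun hx => ?_, ?_⟩
  · have h1 : lin (C.d (i + 1) i) (lin (e.inv.f (i + 1)) x) = 0 := by
      rw [← lin_comp_apply, e.inv.comm, lin_comp_apply, hx, map_zero]
    obtain ⟨y, hy⟩ := (h i _).1 h1
    refine ⟨lin (e.hom.f (i + 2)) y, ?_⟩
    rw [← lin_comp_apply, e.hom.comm, lin_comp_apply, hy, ← lin_comp_apply,
      ← HomologicalComplex.comp_f, e.inv_hom_id, HomologicalComplex.id_f, lin_id,
      LinearMap.id_apply]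
  · rintro ⟨y, rfl⟩
    exact lin_d_d _ _ _ _ _

theorem mem_colonIdeal {L : List (σ →₀ ℕ)} {a : σ →₀ ℕ} {p : MvPolynomial σ k} :
    p ∈ colonIdeal k L a ↔ p * MvPolynomial.monomial a 1 ∈ monomialIdeal k {b | b ∈ L} := by
  rw [colonIdeal, Submodule.mem_colon_singleton, smul_eq_mul]

theorem mem_monomialIdeal_append {L : List (σ →₀ ℕ)} {a : σ →₀ ℕ} {p : MvPolynomial σ k} :
    p ∈ monomialIdeal k {b | b ∈ L ++ [a]} ↔
      ∃ q, p - q * MvPolynomial.monomial a 1 ∈ monomialIdeal k {b | b ∈ L} := by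
  have : {b | b ∈ L ++ [a]} = insert a {b | b ∈ L} := by
    ext b
    simp [or_comm]
  rw [this, monomialIdeal, Set.image_insert_eq, Ideal.mem_span_insert]
  constructor
  · rintro ⟨q, z, hz, rfl⟩
    exact ⟨q, by rwa [add_sub_cancel_left]⟩
  · rintro ⟨q, hq⟩
    exact ⟨q, _, hq, by rw [add_sub_cancel]⟩

section Cone

open HomologicalComplex.homotopyCofiber

variable {K C : ChainComplex (MultiFree k σ) ℕ} (φ : K ⟶ C)

/-- Elements of the cone are pairs. Together with the next lemmas this allows an elementwise diagram
chase. -/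
theorem cone_lin_ext {i : ℕ} {x y : ((HomologicalComplex.homotopyCofiber φ).X (i + 1)).Elt}
    (h₁ : lin (fstX φ (i + 1) i (down_rel i)) x = lin (fstX φ (i + 1) i (down_rel i)) y)
    (h₂ : lin (sndX φ (i + 1)) x = lin (sndX φ (i + 1)) y) : x = y := by
  have key : fstX φ (i + 1) i (down_rel i) ≫ inlX φ i (i + 1) (down_rel i) +
      sndX φ (i + 1) ≫ inrX φ (i + 1) = 𝟙 _ := by
    refine ext_from_X φ i (i + 1) (down_rel i) ?_ ?_
    · simp [Preadditive.comp_add]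
    · simp [Preadditive.comp_add]
  have hz : ∀ z : ((HomologicalComplex.homotopyCofiber φ).X (i + 1)).Elt,
      z = lin (inlX φ i (i + 1) (down_rel i)) (lin (fstX φ (i + 1) i (down_rel i)) z) +
        lin (inrX φ (i + 1)) (lin (sndX φ (i + 1)) z) := by
    intro z
    have := congrArg (fun f => lin f z) key
    exact this.symm
  rw [hz x, hz y, h₁, h₂]

theorem cone_lin_ext_zero {x y : ((HomologicalComplex.homotopyCofiber φ).X 0).Elt}
    (h : lin (sndX φ 0) x = lin (sndX φ 0) y) : x = y := by
  have hz : ∀ z : ((HomologicalComplex.homotopyCofiber φ).X 0).Elt,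
      z = lin (inrX φ 0) (lin (sndX φ 0) z) := by
    intro z
    exact (congrArg (fun f => lin f z) (sndX_inrX φ 0 not_down_rel_zero)).symm
  rw [hz x, hz y, h]

theorem cone_exists (i : ℕ) (a : (K.X i).Elt) (b : (C.X (i + 1)).Elt) :
    ∃ y : ((HomologicalComplex.homotopyCofiber φ).X (i + 1)).Elt,
      lin (fstX φ (i + 1) i (down_rel i)) y = a ∧ lin (sndX φ (i + 1)) y = b := by
  refine ⟨lin (inlX φ i (i + 1) (down_rel i)) a + lin (inrX φ (i + 1)) b, ?_, ?_⟩
  · rw [map_add, ← lin_comp_apply, ← lin_comp_apply, inlX_fstX, inrX_fstX, lin_id, lin_zero,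
      LinearMap.id_apply, LinearMap.zero_apply, add_zero]
  · rw [map_add, ← lin_comp_apply, ← lin_comp_apply, inlX_sndX, inrX_sndX, lin_id, lin_zero,
      LinearMap.id_apply, LinearMap.zero_apply, zero_add]

theorem cone_snd_d (i : ℕ) (x : ((HomologicalComplex.homotopyCofiber φ).X (i + 1)).Elt) :
    lin (sndX φ i) (lin ((HomologicalComplex.homotopyCofiber φ).d (i + 1) i) x) =
      lin (φ.f i) (lin (fstX φ (i + 1) i (down_rel i)) x) +
        lin (C.d (i + 1) i) (lin (sndX φ (i + 1)) x) :=
  congrArg (fun f => lin f x) (d_sndX φ (i + 1) i (down_rel i))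

theorem cone_fst_d (i : ℕ) (x : ((HomologicalComplex.homotopyCofiber φ).X (i + 2)).Elt) :
    lin (fstX φ (i + 1) i (down_rel i))
      (lin ((HomologicalComplex.homotopyCofiber φ).d (i + 2) (i + 1)) x) =
      -lin (K.d (i + 1) i) (lin (fstX φ (i + 2) (i + 1) (down_rel (i + 1))) x) :=
  congrArg (fun f => lin f x) (d_fstX φ (i + 2) (i + 1) i (down_rel _) (down_rel _))

variable {φ}

/-- The long exact sequence of the cone for `0 → (S/(I : m))(-deg m) → S/I → S/(I + (m)) → 0`, done
by hand. Injectivity of the first map, which is the definition of the colon ideal, kills the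
homology in degree `1`. -/
theorem cone_isFreeResolution {L : List (σ →₀ ℕ)} {ε : C.X 0 ⟶ twist k 0}
    (hC : IsFreeResolution C 0 ε (monomialIdeal k {b | b ∈ L})) {a : σ →₀ ℕ}
    {η : K.X 0 ⟶ twist k a} (hK : IsFreeResolution K a η (colonIdeal k L a))
    (hφ : ∀ x, lin (φ.f 0 ≫ ε) x () - lin (η ≫ mulMonomial k a) x () ∈
        monomialIdeal k {b | b ∈ L})
    {ε' : (HomologicalComplex.homotopyCofiber φ).X 0 ⟶ twist k 0}
    (hε' : (HomologicalComplex.homotopyCofiber.inr φ).f 0 ≫ ε' = ε) :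
    IsFreeResolution (HomologicalComplex.homotopyCofiber φ) 0 ε'
      (monomialIdeal k {b | b ∈ L ++ [a]}) := by
  have hφ' : ∀ x, lin ε (lin (φ.f 0) x) () - lin η x () * MvPolynomial.monomial a 1 ∈
      monomialIdeal k {b | b ∈ L} := by
    intro x
    rw [← lin_mulMonomial_apply]
    exact hφ x
  have hε : ∀ x, lin ε' x () = lin ε (lin (sndX φ 0) x) () := by
    intro x
    rw [← hε']
    have := congrArg (fun f => lin ε' (lin f x) ()) (sndX_inrX φ 0 not_down_rel_zero)
    exact this.symm
  have hεd : ∀ y, lin ε (lin (C.d 1 0) y) () ∈ monomialIdeal k {b | b ∈ L} :=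
    fun y => (hC.exact_zero _).2 ⟨y, rfl⟩
  refine ⟨fun i x => ⟨fun hx => ?_, ?_⟩, fun x => ⟨fun hx => ?_, ?_⟩, fun s => ?_⟩
  · have h2 := cone_snd_d φ i x
    rw [hx, map_zero] at h2
    have hrange : lin (fstX φ (i + 1) i (down_rel i)) x ∈ LinearMap.range (lin (K.d (i + 1) i)) := by
      cases i with
      | zero =>
        -- For a cycle in the lowest positive degree, `φ (fst x) = -d (snd x)` has augmentation in
        -- `I`. Hence `η (fst x) * x^a` lies in `I`, that is, `η (fst x)` lies in the colon ideal.
        rw [← hK.exact_zero, mem_colonIdeal]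
        have h3 := hφ' (lin (fstX φ 1 0 (down_rel 0)) x)
        rw [eq_neg_of_add_eq_zero_left h2.symm, lin_neg_unit] at h3
        have h4 := Ideal.add_mem _ h3 (hεd (lin (sndX φ 1) x))
        rw [← neg_mem_iff]
        convert h4 using 1
        ring
      | succ j =>
        have h1 := cone_fst_d φ j x
        rw [hx, map_zero] at h1
        exact (hK.acyclic j _).1 (neg_eq_zero.1 h1.symm)
    obtain ⟨a', ha'⟩ := hrange
    -- Correcting `snd x` by `φ a'` yields a cycle of `C`; the preimage of `x` is then the pair
    -- `(-a', c)`, with the sign forced by `-d_K` in the cone.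
    obtain ⟨c, hc⟩ := (hC.acyclic i (lin (φ.f (i + 1)) a' + lin (sndX φ (i + 1)) x)).1 (by
      rw [map_add, ← lin_comp_apply, φ.comm, lin_comp_apply, ha', ← h2])
    obtain ⟨y, hy1, hy2⟩ := cone_exists φ (i + 1) (-a') c
    refine ⟨y, cone_lin_ext φ ?_ ?_⟩
    · rw [cone_fst_d, hy1, map_neg, neg_neg, ha']
    · rw [cone_snd_d, hy1, hy2, hc, map_neg, neg_add_cancel_left]
  · rintro ⟨y, rfl⟩
    exact lin_d_d _ _ _ _ _
  · rw [hε, mem_monomialIdeal_append] at hx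
    obtain ⟨q, hq⟩ := hx
    obtain ⟨z, hz⟩ := hK.surjective q
    rw [mem_colonIdeal] at hz
    -- Modulo `I` the augmentation of `x` is `q * x^a`, and `φ z` accounts for this multiple since
    -- `η z` is `q` up to the colon ideal.
    obtain ⟨b, hb⟩ := (hC.exact_zero (lin (sndX φ 0) x - lin (φ.f 0) z)).1 (by
      rw [lin_sub_unit]
      convert Ideal.sub_mem _ hq (Ideal.add_mem _ (hφ' z) hz) using 1
      ring)
    obtain ⟨y, hy1, hy2⟩ := cone_exists φ 0 z b
    refine ⟨y, cone_lin_ext_zero φ ?_⟩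
    rw [cone_snd_d, hy1, hy2, hb, add_sub_cancel]
  · rintro ⟨y, rfl⟩
    rw [hε, cone_snd_d, lin_add_unit, mem_monomialIdeal_append]
    refine ⟨lin η (lin (fstX φ 1 0 (down_rel 0)) y) (), ?_⟩
    have := Ideal.add_mem _ (hφ' (lin (fstX φ 1 0 (down_rel 0)) y)) (hεd (lin (sndX φ 1) y))
    convert this using 1
    ring
  · obtain ⟨x, hx⟩ := hC.surjective s
    refine ⟨lin (inrX φ 0) x, ?_⟩
    have hx' : lin (sndX φ 0) (lin (inrX φ 0) x) = x :=
      congrArg (fun f => lin f x) (inrX_sndX φ 0)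
    rw [hε, hx', mem_monomialIdeal_append]
    exact ⟨0, by rwa [zero_mul, sub_zero]⟩

/-- An iterated mapping cone is a free resolution. -/
theorem IsIteratedMappingCone.isFreeResolution {L : List (σ →₀ ℕ)}
    {C : ChainComplex (MultiFree k σ) ℕ} {ε : C.X 0 ⟶ twist k 0}
    (h : IsIteratedMappingCone L C ε) :
    IsFreeResolution C 0 ε (monomialIdeal k {b | b ∈ L}) := by
  induction h with
  | nil C ε hε hC =>
    have hbot : monomialIdeal k {b : σ →₀ ℕ | b ∈ []} = ⊥ := by
      simp [monomialIdeal]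
    have hinv : ∀ x, lin (inv ε) (lin ε x) = x := fun x =>
      congrArg (fun f => lin f x) (IsIso.hom_inv_id ε)
    have hinv' : ∀ x, lin ε (lin (inv ε) x) = x := fun x =>
      congrArg (fun f => lin f x) (IsIso.inv_hom_id ε)
    rw [hbot]
    refine ⟨fun i x => ⟨fun _ => ⟨0, ?_⟩, fun _ => ?_⟩, fun x => ⟨fun hx => ⟨0, ?_⟩, ?_⟩,
      fun s => ⟨lin (inv ε) (Finsupp.single () s), ?_⟩⟩
    · rw [map_zero, eq_zero_of_isZero (hC i) x]
    · rw [eq_zero_of_isZero (hC i) x, map_zero]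
    · have h0 : lin ε x = 0 := Finsupp.ext fun _ => (Submodule.mem_bot _).1 hx
      rw [map_zero, ← hinv x, h0, map_zero]
    · rintro ⟨y, rfl⟩
      rw [eq_zero_of_isZero (hC 0) y, map_zero, map_zero]
      exact Submodule.zero_mem _
    · rw [hinv']
      have : (Finsupp.single () s : Unit →₀ MvPolynomial σ k) () - s = 0 := by simp
      exact (Submodule.mem_bot _).2 this
  | cone L C ε _ a K η hK _ φ hφ ε' hε' ih => exact cone_isFreeResolution ih hK hφ hε'

end Cone


/-- In degree `0` the only generator is the empty set, and the singleton `{t}` is sent to a nonzero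
scalar times `x_t`; the image of the differential is thus the ideal of the variables in `T`. -/
theorem ScalarComplex.IsKoszul.isFreeResolution {Q : ScalarComplex k σ} {τ : Type*} {ν : τ → σ}
    {m : σ →₀ ℕ} {T : Finset τ} {W : ∀ i, Q.gen i → Finset τ} (h : Q.IsKoszul ν m T W)
    (hν : Function.Injective ν) (hm : ∀ b, m ≤ Q.deg 0 b) :
    IsFreeResolution Q.toComplex m (Q.aug m hm)
      (Ideal.span (MvPolynomial.X '' (ν '' (T : Set τ)))) := by
  classical
  obtain ⟨b₀, hb₀⟩ := h.surjective 0 ∅ (Finset.empty_subset _) rfl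
  have hall : ∀ b : Q.gen 0, b = b₀ := fun b => h.injective 0 (by
    rw [hb₀, ← Finset.card_eq_zero, h.card])
  have hdeg : Q.deg 0 b₀ = m := by rw [h.deg, hb₀, Finset.sum_empty, add_zero]
  have haug : ∀ x : (Q.obj 0).Elt, lin (Q.aug m hm) x () = x b₀ := by
    intro x
    refine (lin_ofScalars_apply (M := Q.obj 0) (N := twist k m) _ _ x ()).trans ?_
    refine (finsum_eq_single _ b₀ fun b hb => absurd (hall b) hb).trans ?_
    change x b₀ * MvPolynomial.monomial (Q.deg 0 b₀ - m) 1 = _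
    rw [hdeg, tsub_self]
    exact mul_one _
  have hd : ∀ y : (Q.obj 1).Elt, lin (Q.diff 0) y b₀ = ∑ᶠ b : Q.gen 1,
      y b * MvPolynomial.monomial (Q.deg 1 b - Q.deg 0 b₀) (Q.coeff 0 b b₀) := fun y =>
    lin_ofScalars_apply (M := Q.obj 1) (N := Q.obj 0) _ _ y b₀
  have hd1 : ∀ (b : Q.gen 1) (q : MvPolynomial σ k),
      lin (Q.diff 0) (Finsupp.single b q : (Q.obj 1).Elt) b₀ =
        q * MvPolynomial.monomial (Q.deg 1 b - Q.deg 0 b₀) (Q.coeff 0 b b₀) := by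
    intro b q
    rw [hd]
    refine (finsum_eq_single _ b fun c hc => ?_).trans ?_
    · exact (congrArg (· * _) (Finsupp.single_eq_of_ne hc)).trans (zero_mul _)
    · exact congrArg (· * _) Finsupp.single_eq_same
  have hdeg1 : ∀ (b : Q.gen 1) (t : τ), W 1 b = {t} →
      Q.deg 1 b - Q.deg 0 b₀ = Finsupp.single (ν t) 1 := by
    intro b t hbt
    rw [hdeg, h.deg, hbt, Finset.sum_singleton, add_tsub_cancel_left]
  have hmono : ∀ (s : σ) (c : k), MvPolynomial.monomial (Finsupp.single s 1) c =
      MvPolynomial.C c * MvPolynomial.X s := by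
    intro s c
    rw [MvPolynomial.X, MvPolynomial.C_mul_monomial, mul_one]
  refine ⟨h.isAcyclicComplex hν, fun x => ?_, fun s => ⟨Finsupp.single b₀ s, ?_⟩⟩
  · change (Q.obj 0).Elt at x
    refine (iff_of_eq (congrArg (· ∈ _) (haug x))).trans ?_
    rw [toComplex_d]
    change x b₀ ∈ _ ↔ x ∈ LinearMap.range (lin (Q.diff 0))
    constructor
    · intro hx
      have hle : Ideal.span (MvPolynomial.X '' (ν '' (T : Set τ))) ≤
          (LinearMap.range (lin (Q.diff 0))).comap
            (Finsupp.lsingle b₀ : MvPolynomial σ k →ₗ[MvPolynomial σ k] (Q.obj 0).Elt) := by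
        rw [Ideal.span_le]
        rintro _ ⟨_, ⟨t, ht, rfl⟩, rfl⟩
        obtain ⟨b, hb⟩ := h.surjective 1 {t} (Finset.singleton_subset_iff.2 ht) rfl
        have hne : Q.coeff 0 b b₀ ≠ 0 := (h.coeff 0 b b₀).2 (by rw [hb₀]; exact Finset.empty_subset _)
        -- The inverse of the entry normalizes the image to exactly `x_t` times the generator.
        refine ⟨Finsupp.single b (MvPolynomial.C (Q.coeff 0 b b₀)⁻¹), ?_⟩
        refine Finsupp.ext fun b' => ?_
        obtain rfl : b₀ = b' := (hall b').symm
        rw [hd1, hdeg1 b t hb, hmono, ← mul_assoc, ← MvPolynomial.C_mul, inv_mul_cancel₀ hne,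
          MvPolynomial.C_1, one_mul]
        exact Finsupp.single_eq_same.symm
      have := hle hx
      rw [Submodule.mem_comap] at this
      convert this using 1
      refine Finsupp.ext fun b' => ?_
      obtain rfl : b₀ = b' := (hall b').symm
      exact Finsupp.single_eq_same.symm
    · rintro ⟨y, rfl⟩
      have : Fintype (Q.gen 1) := Fintype.ofFinite _
      rw [hd, finsum_eq_sum_of_fintype]
      refine Ideal.sum_mem _ fun b _ => Ideal.mul_mem_left _ _ ?_
      obtain ⟨t, ht⟩ := Finset.card_eq_one.1 (h.card 1 b)
      rw [hdeg1 b t ht, hmono]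
      refine Ideal.mul_mem_left _ _ (Ideal.subset_span ⟨_, ⟨t, ?_, rfl⟩, rfl⟩)
      exact h.subset 1 b (by rw [ht]; exact Finset.mem_singleton_self t)
  · have : lin (Q.aug m hm) (Finsupp.single b₀ s) () - s = 0 := by
      rw [sub_eq_zero]
      exact (haug _).trans Finsupp.single_eq_same
    rw [this]
    exact Ideal.zero_mem _

end Resolutions

/-- The cells of the complex attached to a split graph on `Fin p` whose clique is `{x | x < n}`, the
other vertices being independent, with adjacency `I` between the two parts. A cell is a pair of sets
`left ≤ right` of vertices. If it meets the independent part, then the two sets share exactly one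
vertex, the apex, and the cell is a cone; otherwise they are disjoint and the cell is a product of
two simplices. -/
@[ext]
structure SplitCell {p : ℕ} (n : ℕ) (I : Fin p → Fin p → Prop) where
  left : Finset (Fin p)
  right : Finset (Fin p)
  left_nonempty : left.Nonempty
  right_nonempty : right.Nonempty
  le : ∀ a ∈ left, ∀ b ∈ right, a ≤ b
  lt_of_mem_left : ∀ a ∈ left, (a : ℕ) < n
  exists_apex : ∀ e ∈ right, n ≤ (e : ℕ) → ∃ u ∈ left, u ∈ right ∧ I u e
  exists_edge : ∀ u ∈ left, u ∈ right → ∃ e ∈ right, n ≤ (e : ℕ)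

/-- The number of elements of a finite set below a given one. -/
def Finset.position {α : Type*} [LinearOrder α] (W : Finset α) (x : α) : ℕ :=
  (W.filter (· < x)).card

theorem Finset.position_erase_of_le {α : Type*} [LinearOrder α] (W : Finset α) {x y : α}
    (h : x ≤ y) : (W.erase y).position x = W.position x := by
  unfold position
  congr 1
  ext z
  simp only [Finset.mem_filter, Finset.mem_erase]
  grind

theorem Finset.position_erase_of_lt {α : Type*} [LinearOrder α] {W : Finset α} {x y : α}
    (hx : x ∈ W) (h : x < y) : (W.erase x).position y + 1 = W.position y := by
  unfold position
  have : (W.filter (· < y)) = insert x ((W.erase x).filter (· < y)) := by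
    ext z
    simp only [Finset.mem_filter, Finset.mem_erase, Finset.mem_insert]
    grind
  rw [this, Finset.card_insert_of_notMem (by simp)]

/-! ### Faces of cells and cancellation of incidence numbers -/

namespace SplitCell

variable {p n : ℕ} {I : Fin p → Fin p → Prop}

instance : Finite (SplitCell n I) :=
  Finite.of_injective (fun c => (c.left, c.right)) fun c d h => by
    obtain ⟨h1, h2⟩ := Prod.ext_iff.1 h
    exact SplitCell.ext h1 h2

/-- The set of all vertices involved in a cell. -/
def supp (c : SplitCell n I) : Finset (Fin p) := c.left ∪ c.right

theorem mem_supp {c : SplitCell n I} {x : Fin p} : x ∈ c.supp ↔ x ∈ c.left ∨ x ∈ c.right :=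
  Finset.mem_union

instance : PartialOrder (SplitCell n I) where
  le c d := c.left ⊆ d.left ∧ c.right ⊆ d.right
  le_refl c := ⟨subset_rfl, subset_rfl⟩
  le_trans _ _ _ h h' := ⟨h.1.trans h'.1, h.2.trans h'.2⟩
  le_antisymm _ _ h h' := SplitCell.ext (h.1.antisymm h'.1) (h.2.antisymm h'.2)

theorem supp_mono {c d : SplitCell n I} (h : c ≤ d) : c.supp ⊆ d.supp :=
  Finset.union_subset_union h.1 h.2

/-- The sign with which the vertex `x` is removed from a cell. -/
def eps (c : SplitCell n I) (x : Fin p) : ℤ :=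
  (-1) ^ c.supp.position x * if x ∈ c.right then -1 else 1

open Classical in
/-- The incidence number of two cells whose dimensions differ by one. -/
def incidence (c d : SplitCell n I) : ℤ :=
  if d ≤ c then ∑ x ∈ c.supp \ d.supp, c.eps x else 0

theorem incidence_of_not_le {c d : SplitCell n I} (h : ¬ d ≤ c) : c.incidence d = 0 := if_neg h

/-- When one vertex is missing, the sum defining the incidence number has a single term. -/
theorem incidence_of_le {c d : SplitCell n I} (h : d ≤ c) {x : Fin p} (hx : x ∈ c.supp)
    (hd : d.supp = c.supp.erase x) : c.incidence d = c.eps x := by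
  have : c.supp \ c.supp.erase x = {x} := by
    ext z
    simp only [Finset.mem_sdiff, Finset.mem_erase, Finset.mem_singleton]
    grind
  rw [incidence, if_pos h, hd, this, Finset.sum_singleton]

theorem eps_eq_or (c : SplitCell n I) (x : Fin p) : c.eps x = 1 ∨ c.eps x = -1 := by
  unfold eps
  rcases neg_one_pow_eq_or ℤ (c.supp.position x) with h | h <;> rw [h] <;> split_ifs <;> simp

theorem exists_supp_eq_erase {c d : SplitCell n I} (h : d ≤ c)
    (hcard : c.supp.card = d.supp.card + 1) : ∃ x ∈ c.supp, d.supp = c.supp.erase x := by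
  have h1 : (c.supp \ d.supp).card = 1 := by
    rw [Finset.card_sdiff_of_subset (supp_mono h)]
    omega
  obtain ⟨x, hx⟩ := Finset.card_eq_one.1 h1
  have hx' : x ∈ c.supp \ d.supp := hx ▸ Finset.mem_singleton_self x
  rw [Finset.mem_sdiff] at hx'
  refine ⟨x, hx'.1, ?_⟩
  rw [← Finset.sdiff_singleton_eq_erase, ← hx, Finset.sdiff_sdiff_eq_self (supp_mono h)]

/-- As in a simplex: deleting the smaller `x` lowers the position of `y` by one, while deleting `y`
leaves the position of `x` unchanged. The side signs agree in both orders by hypothesis. -/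
theorem eps_cancel {c g₁ g₂ : SplitCell n I} {x y : Fin p} (hx : x ∈ c.supp) (hxy : x < y)
    (h₁ : g₁.supp = c.supp.erase x) (h₂ : g₂.supp = c.supp.erase y)
    (hy' : y ∈ g₁.right ↔ y ∈ c.right) (hx' : x ∈ g₂.right ↔ x ∈ c.right) :
    c.eps x * g₁.eps y + c.eps y * g₂.eps x = 0 := by
  have e1 := Finset.position_erase_of_le c.supp hxy.le
  have e2 := Finset.position_erase_of_lt hx hxy
  simp only [eps, h₁, h₂, e1, ← e2, hy', hx']
  ring

theorem eps_cancel' {c g₁ g₂ : SplitCell n I} {x y : Fin p} (hx : x ∈ c.supp) (hy : y ∈ c.supp)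
    (hxy : x ≠ y) (h₁ : g₁.supp = c.supp.erase x) (h₂ : g₂.supp = c.supp.erase y)
    (hy' : y ∈ g₁.right ↔ y ∈ c.right) (hx' : x ∈ g₂.right ↔ x ∈ c.right) :
    c.eps x * g₁.eps y + c.eps y * g₂.eps x = 0 := by
  rcases hxy.lt_or_gt with h | h
  · exact eps_cancel hx h h₁ h₂ hy' hx'
  · rw [add_comm]
    exact eps_cancel hy h h₂ h₁ hx' hy'

theorem apex_unique (c : SplitCell n I) {u v : Fin p} (hu : u ∈ c.left) (hu' : u ∈ c.right)
    (hv : v ∈ c.left) (hv' : v ∈ c.right) : u = v :=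
  le_antisymm (c.le u hu v hv') (c.le v hv u hu')

/-- A face that keeps the apex is determined by its support. -/
theorem eq_erase_of_apex {c d : SplitCell n I} (h : d ≤ c) {x : Fin p}
    (hd : d.supp = c.supp.erase x)
    (hapex : ∀ u ∈ c.left, u ∈ c.right → u ∈ d.left ∧ u ∈ d.right) :
    d.left = c.left.erase x ∧ d.right = c.right.erase x := by
  have hmem : ∀ z, (z ∈ d.left ∨ z ∈ d.right) ↔ z ≠ x ∧ (z ∈ c.left ∨ z ∈ c.right) := by
    intro z
    rw [← mem_supp, hd, Finset.mem_erase, mem_supp]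
  have h1 := h.1
  have h2 := h.2
  constructor <;> ext z <;> rw [Finset.mem_erase] <;> have := hmem z <;> have := @h1 z <;>
    have := @h2 z <;> have := hapex z <;> tauto

/-- A face that loses the apex. -/
theorem eq_of_not_apex {c d : SplitCell n I} (h : d ≤ c) {x u : Fin p}
    (hd : d.supp = c.supp.erase x) (hu : u ∈ c.left) (hu' : u ∈ c.right)
    (hnot : ∀ v ∈ d.left, v ∉ d.right) :
    (u ∈ d.left → d.left = c.left.erase x ∧ d.right = (c.right.erase x).erase u) ∧
    (u ∈ d.right → d.left = (c.left.erase x).erase u ∧ d.right = c.right.erase x) := by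
  have hmem : ∀ z, (z ∈ d.left ∨ z ∈ d.right) ↔ z ≠ x ∧ (z ∈ c.left ∨ z ∈ c.right) := by
    intro z
    rw [← mem_supp, hd, Finset.mem_erase, mem_supp]
  have h1 : ∀ z, z ∈ d.left → z ∈ c.left := fun z hz => h.1 hz
  have h2 : ∀ z, z ∈ d.right → z ∈ c.right := fun z hz => h.2 hz
  have huniq : ∀ z, z ∈ c.left → z ∈ c.right → z = u := fun z hz hz' => c.apex_unique hz hz' hu hu'
  clear hd h
  constructor <;> intro hud <;> constructor <;> ext z <;> simp only [Finset.mem_erase] <;>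
    have e1 := hmem z <;> have e2 := h1 z <;> have e3 := h2 z <;> have e4 := huniq z <;>
    have e5 := hnot z <;> have e6 := hnot u <;> clear hmem h1 h2 huniq hnot <;> grind

theorem notMem_left {c : SplitCell n I} {e : Fin p} (he : n ≤ (e : ℕ)) : e ∉ c.left :=
  fun h => absurd (c.lt_of_mem_left e h) (by omega)

/-- Removing a vertex which is neither the apex nor the only element of the independent part. -/
def erase (c : SplitCell n I) (x : Fin p) (hl : (c.left.erase x).Nonempty)
    (hr : (c.right.erase x).Nonempty) (hx : x ∈ c.left → x ∉ c.right)
    (hx' : ∀ u ∈ c.left, u ∈ c.right → ∃ e ∈ c.right, n ≤ (e : ℕ) ∧ e ≠ x) :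
    SplitCell n I where
  left := c.left.erase x
  right := c.right.erase x
  left_nonempty := hl
  right_nonempty := hr
  le a ha b hb := c.le a (Finset.mem_of_mem_erase ha) b (Finset.mem_of_mem_erase hb)
  lt_of_mem_left a ha := c.lt_of_mem_left a (Finset.mem_of_mem_erase ha)
  exists_apex e he hn := by
    obtain ⟨u, hu, hu', hI⟩ := c.exists_apex e (Finset.mem_of_mem_erase he) hn
    have : u ≠ x := by
      rintro rfl
      exact hx hu hu'
    exact ⟨u, Finset.mem_erase.2 ⟨this, hu⟩, Finset.mem_erase.2 ⟨this, hu'⟩, hI⟩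
  exists_edge u hu hu' := by
    obtain ⟨e, he, hn, hne⟩ := hx' u (Finset.mem_of_mem_erase hu) (Finset.mem_of_mem_erase hu')
    exact ⟨e, Finset.mem_erase.2 ⟨hne, he⟩, hn⟩

theorem erase_supp (c : SplitCell n I) (x : Fin p) (hl hr hx hx') :
    (c.erase x hl hr hx hx').supp = c.supp.erase x := by
  ext z
  simp only [mem_supp, erase, Finset.mem_erase]
  tauto

theorem erase_le (c : SplitCell n I) (x : Fin p) (hl hr hx hx') :
    c.erase x hl hr hx hx' ≤ c :=
  ⟨Finset.erase_subset _ _, Finset.erase_subset _ _⟩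

/-- A cell that does not meet the independent part. -/
def box (A B : Finset (Fin p)) (hA : A.Nonempty) (hB : B.Nonempty) (hAB : ∀ a ∈ A, ∀ b ∈ B, a < b)
    (hn : ∀ b ∈ B, (b : ℕ) < n) : SplitCell n I where
  left := A
  right := B
  left_nonempty := hA
  right_nonempty := hB
  le a ha b hb := (hAB a ha b hb).le
  lt_of_mem_left a ha := by
    obtain ⟨b, hb⟩ := hB
    exact lt_trans (hAB a ha b hb) (hn b hb)
  exists_apex e he h := absurd (hn e he) (by omega)
  exists_edge u hu hu' := absurd (hAB u hu u hu') (lt_irrefl _)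

/-- `c.IsRemoval x g` means that `g` is a face of `c` missing only `x`. -/
structure IsRemoval (c : SplitCell n I) (x : Fin p) (g : SplitCell n I) : Prop where
  le : g ≤ c
  supp : g.supp = c.supp.erase x

/-- The two cells strictly between a cell and a face of codimension two cancel. -/
def Diamond (c h : SplitCell n I) : Prop :=
  ∃ g₁ g₂ : SplitCell n I, g₁ ≠ g₂ ∧
    g₁.supp.card + 1 = c.supp.card ∧ g₂.supp.card + 1 = c.supp.card ∧
    (∀ g, h ≤ g → g ≤ c → g.supp.card + 1 = c.supp.card → g = g₁ ∨ g = g₂) ∧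
    c.incidence g₁ * g₁.incidence h + c.incidence g₂ * g₂.incidence h = 0

theorem IsRemoval.card {c g : SplitCell n I} {x : Fin p} (h : c.IsRemoval x g) (hx : x ∈ c.supp) :
    g.supp.card + 1 = c.supp.card := by
  rw [h.supp, Finset.card_erase_add_one hx]

/-- The simplicial case: the two intermediate cells come from the two orders of deletion. The
uniqueness hypotheses are needed because a support does not determine a cell. -/
theorem diamond_of_removal {c h g₁ g₂ : SplitCell n I} {x y : Fin p} (hxy : x ≠ y)
    (hx : x ∈ c.supp) (hy : y ∈ c.supp) (h₁ : c.IsRemoval x g₁) (h₂ : c.IsRemoval y g₂)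
    (hg₁ : h ≤ g₁) (hg₂ : h ≤ g₂) (hh : h.supp = (c.supp.erase x).erase y)
    (u₁ : ∀ g, h ≤ g → c.IsRemoval x g → g = g₁) (u₂ : ∀ g, h ≤ g → c.IsRemoval y g → g = g₂)
    (hy' : y ∈ g₁.right ↔ y ∈ c.right) (hx' : x ∈ g₂.right ↔ x ∈ c.right) : c.Diamond h := by
  have hh' : h.supp = (c.supp.erase y).erase x := by rw [hh, Finset.erase_right_comm]
  refine ⟨g₁, g₂, ?_, h₁.card hx, h₂.card hy, ?_, ?_⟩
  · rintro rfl
    have := h₁.supp.symm.trans h₂.supp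
    have h3 : y ∈ c.supp.erase x := Finset.mem_erase.2 ⟨hxy.symm, hy⟩
    rw [this] at h3
    exact Finset.notMem_erase _ _ h3
  · intro g hg hgc hcard
    obtain ⟨z, hz, hgz⟩ := exists_supp_eq_erase hgc hcard.symm
    have hzh : z ∉ h.supp := fun hm => by
      have := supp_mono hg hm
      rw [hgz] at this
      exact Finset.notMem_erase _ _ this
    have : z = x ∨ z = y := by
      rw [hh] at hzh
      simp only [Finset.mem_erase] at hzh
      tauto
    rcases this with rfl | rfl
    · exact Or.inl (u₁ g hg ⟨hgc, hgz⟩)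
    · exact Or.inr (u₂ g hg ⟨hgc, hgz⟩)
  · rw [incidence_of_le h₁.le hx h₁.supp, incidence_of_le h₂.le hy h₂.supp,
      incidence_of_le (x := y) hg₁ (by rw [h₁.supp]; exact Finset.mem_erase.2 ⟨hxy.symm, hy⟩)
        (by rw [h₁.supp, hh]),
      incidence_of_le (x := x) hg₂ (by rw [h₂.supp]; exact Finset.mem_erase.2 ⟨hxy, hx⟩)
        (by rw [h₂.supp, hh'])]
    exact eps_cancel' hx hy hxy h₁.supp h₂.supp hy' hx'

/-- A face that keeps an independent vertex is itself a cone; its apex lies on both sides of `c`,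
where there is only one such vertex. -/
theorem exists_apex_of_le {c g : SplitCell n I} (h : g ≤ c) {u e : Fin p} (hu : u ∈ c.left)
    (hu' : u ∈ c.right) (he : e ∈ g.supp) (hn : n ≤ (e : ℕ)) : u ∈ g.left ∧ u ∈ g.right := by
  have he' : e ∈ g.right := (mem_supp.1 he).resolve_left (notMem_left hn)
  obtain ⟨v, hv, hv', -⟩ := g.exists_apex e he' hn
  have := c.apex_unique (h.1 hv) (h.2 hv') hu hu'
  subst this
  exact ⟨hv, hv'⟩

/-- The generic situation: neither removal destroys the cone structure. -/
theorem IsRemoval.exists_unique_erase {c h : SplitCell n I} (hle : h ≤ c) {x : Fin p}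
    (hxh : x ∉ h.supp) (hx : x ∈ c.left → x ∉ c.right)
    (hx' : ∀ u ∈ c.left, u ∈ c.right → ∃ e ∈ c.right, n ≤ (e : ℕ) ∧ e ≠ x) :
    ∃ g, c.IsRemoval x g ∧ h ≤ g ∧ (∀ y, y ≠ x → (y ∈ g.right ↔ y ∈ c.right)) ∧
      ∀ g', h ≤ g' → c.IsRemoval x g' → g' = g := by
  have hl : h.left ⊆ c.left.erase x := fun z hz => Finset.mem_erase.2
    ⟨fun e => hxh (e ▸ mem_supp.2 (Or.inl hz)), hle.1 hz⟩
  have hr : h.right ⊆ c.right.erase x := fun z hz => Finset.mem_erase.2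
    ⟨fun e => hxh (e ▸ mem_supp.2 (Or.inr hz)), hle.2 hz⟩
  refine ⟨c.erase x (h.left_nonempty.mono hl) (h.right_nonempty.mono hr) hx hx',
    ⟨erase_le .., erase_supp ..⟩, ⟨hl, hr⟩, fun y hy => ?_, fun g' _ hg' => ?_⟩
  · simp [erase, hy]
  · obtain ⟨h1, h2⟩ := eq_erase_of_apex hg'.le hg'.supp fun u hu hu' => by
      obtain ⟨e, he, hn, hne⟩ := hx' u hu hu'
      refine exists_apex_of_le hg'.le hu hu' ?_ hn
      rw [hg'.supp]
      exact Finset.mem_erase.2 ⟨hne, mem_supp.2 (Or.inr he)⟩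
    exact SplitCell.ext h1 h2

/-- The only element `e` of the independent part is removed. -/
theorem diamond_of_unique {c h : SplitCell n I} (hle : h ≤ c) {e y u : Fin p} (hye : y ≠ e)
    (hy : y ∈ c.supp) (hh : h.supp = (c.supp.erase e).erase y) (he : e ∈ c.right)
    (hn : n ≤ (e : ℕ)) (hun : ∀ e' ∈ c.right, n ≤ (e' : ℕ) → e' = e) (hu : u ∈ c.left)
    (hu' : u ∈ c.right) : c.Diamond h := by
  have hec : e ∈ c.supp := mem_supp.2 (Or.inr he)
  have heh : e ∉ h.supp := by simp [hh]
  have hyh : y ∉ h.supp := by simp [hh]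
  have hue : u ≠ e := by
    rintro rfl
    exact notMem_left hn hu
  have hbox : ∀ g, c.IsRemoval e g → ∀ v ∈ g.left, v ∉ g.right := by
    intro g hg v hv hv'
    obtain ⟨e', he', hn'⟩ := g.exists_edge v hv hv'
    have := hun e' (hg.le.2 he') hn'
    subst this
    have := hg.supp ▸ mem_supp.2 (Or.inr he')
    exact Finset.notMem_erase _ _ this
  have hlt : ∀ b ∈ c.right.erase e, (b : ℕ) < n := by
    intro b hb
    by_contra hbn
    exact (Finset.mem_erase.1 hb).1 (hun b (Finset.mem_of_mem_erase hb) (by omega))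
  have hleft : h.left ⊆ c.left.erase e := fun z hz => Finset.mem_erase.2
    ⟨fun e => heh (e ▸ mem_supp.2 (Or.inl hz)), hle.1 hz⟩
  have hright : h.right ⊆ c.right.erase e := fun z hz => Finset.mem_erase.2
    ⟨fun e => heh (e ▸ mem_supp.2 (Or.inr hz)), hle.2 hz⟩
  -- the two boxes obtained by removing `e`
  have hL : u ∉ h.right → ∃ g : SplitCell n I, g.left = c.left.erase e ∧
      g.right = (c.right.erase e).erase u ∧ c.IsRemoval e g ∧ h ≤ g := by
    intro huh
    have hsub : h.right ⊆ (c.right.erase e).erase u := fun z hz =>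
      Finset.mem_erase.2 ⟨fun e => huh (e ▸ hz), hright hz⟩
    refine ⟨box (c.left.erase e) ((c.right.erase e).erase u) (h.left_nonempty.mono hleft)
      (h.right_nonempty.mono hsub) ?_ ?_, rfl, rfl, ⟨⟨?_, ?_⟩, ?_⟩, hleft, hsub⟩
    · intro a ha b hb
      have h1 := c.le a (Finset.mem_of_mem_erase ha) u hu'
      have h2 := c.le u hu b (Finset.mem_of_mem_erase (Finset.mem_of_mem_erase hb))
      exact lt_of_le_of_lt h1 (lt_of_le_of_ne h2 (Finset.mem_erase.1 hb).1.symm)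
    · exact fun b hb => hlt b (Finset.mem_of_mem_erase hb)
    · exact Finset.erase_subset _ _
    · exact (Finset.erase_subset _ _).trans (Finset.erase_subset _ _)
    · ext z
      simp only [mem_supp, box, Finset.mem_erase]
      by_cases hz : z = u
      · subst hz; tauto
      · tauto
  have hR : u ∉ h.left → ∃ g : SplitCell n I, g.left = (c.left.erase e).erase u ∧
      g.right = c.right.erase e ∧ c.IsRemoval e g ∧ h ≤ g := by
    intro huh
    have hsub : h.left ⊆ (c.left.erase e).erase u := fun z hz =>
      Finset.mem_erase.2 ⟨fun e => huh (e ▸ hz), hleft hz⟩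
    refine ⟨box ((c.left.erase e).erase u) (c.right.erase e) (h.left_nonempty.mono hsub)
      (h.right_nonempty.mono hright) ?_ hlt, rfl, rfl, ⟨⟨?_, ?_⟩, ?_⟩, hsub, hright⟩
    · intro a ha b hb
      have h1 := c.le a (Finset.mem_of_mem_erase (Finset.mem_of_mem_erase ha)) u hu'
      have h2 := c.le u hu b (Finset.mem_of_mem_erase hb)
      exact lt_of_lt_of_le (lt_of_le_of_ne h1 (Finset.mem_erase.1 ha).1) h2
    · exact (Finset.erase_subset _ _).trans (Finset.erase_subset _ _)
    · exact Finset.erase_subset _ _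
    · ext z
      simp only [mem_supp, box, Finset.mem_erase]
      by_cases hz : z = u
      · subst hz; tauto
      · tauto
  have hmem : ∀ g, c.IsRemoval e g → u ∈ g.left ∨ u ∈ g.right := fun g hg => by
    rw [← mem_supp, hg.supp]
    exact Finset.mem_erase.2 ⟨hue, mem_supp.2 (Or.inl hu)⟩
  by_cases hyu : y = u
  -- If the second deleted vertex is the apex, both intermediate cells are the boxes obtained by
  -- deleting `e`. The cells themselves differ only in the side of the apex, which gives the
  -- opposite signs.
  · subst hyu
    obtain ⟨g₁, l₁, r₁, hg₁, hhg₁⟩ := hL fun h' => hyh (mem_supp.2 (Or.inr h'))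
    obtain ⟨g₂, l₂, r₂, hg₂, hhg₂⟩ := hR fun h' => hyh (mem_supp.2 (Or.inl h'))
    have hy₁ : y ∉ g₁.right := by simp [r₁]
    have hy₂ : y ∈ g₂.right := by simp [r₂, hue, hu']
    refine ⟨g₁, g₂, fun h => hy₁ (h ▸ hy₂), hg₁.card hec, hg₂.card hec, ?_, ?_⟩
    · intro g hg hgc hcard
      obtain ⟨z, hz, hgz⟩ := exists_supp_eq_erase hgc hcard.symm
      have hzh : z ∉ h.supp := fun hm => by
        have := supp_mono hg hm
        rw [hgz] at this
        exact Finset.notMem_erase _ _ this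
      have : z = e ∨ z = y := by
        rw [hh] at hzh
        simp only [Finset.mem_erase] at hzh
        tauto
      rcases this with rfl | rfl
      · obtain ⟨k1, k2⟩ := eq_of_not_apex hgc hgz hu hu' (hbox g ⟨hgc, hgz⟩)
        rcases hmem g ⟨hgc, hgz⟩ with hm | hm
        · exact Or.inl (SplitCell.ext ((k1 hm).1.trans l₁.symm) ((k1 hm).2.trans r₁.symm))
        · exact Or.inr (SplitCell.ext ((k2 hm).1.trans l₂.symm) ((k2 hm).2.trans r₂.symm))
      -- The apex cannot be deleted first, since `e` would still be present and force it.
      · exfalso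
        have heg : e ∈ g.supp := by
          rw [hgz]
          exact Finset.mem_erase.2 ⟨hye.symm, hec⟩
        have := hgz ▸ mem_supp.2 (Or.inl (exists_apex_of_le hgc hu hu' heg hn).1)
        exact Finset.notMem_erase _ _ this
    · have hyc : ∀ g, c.IsRemoval e g → y ∈ g.supp := fun g hg => by
        rw [hg.supp]
        exact Finset.mem_erase.2 ⟨hye, hy⟩
      rw [incidence_of_le hg₁.le hec hg₁.supp, incidence_of_le hg₂.le hec hg₂.supp,
        incidence_of_le hhg₁ (hyc g₁ hg₁) (by rw [hh, hg₁.supp]),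
        incidence_of_le hhg₂ (hyc g₂ hg₂) (by rw [hh, hg₂.supp])]
      simp only [eps, hg₁.supp, hg₂.supp, hy₁, hy₂, if_true, if_false]
      ring
  · obtain ⟨g₁, hg₁, hhg₁, hr₁, hu₁⟩ := IsRemoval.exists_unique_erase hle (x := y) hyh
      (fun h1 h2 => hyu (c.apex_unique h1 h2 hu hu')) fun _ _ _ => ⟨e, he, hn, hye.symm⟩
    have huh : u ∈ h.supp := by
      rw [hh]
      exact Finset.mem_erase.2 ⟨fun h => hyu h.symm, Finset.mem_erase.2 ⟨hue, mem_supp.2 (Or.inl hu)⟩⟩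
    have hhbox : ∀ v ∈ h.left, v ∉ h.right := by
      intro v hv hv'
      obtain ⟨e', he', hn'⟩ := h.exists_edge v hv hv'
      have := hun e' (hle.2 he') hn'
      subst this
      exact heh (mem_supp.2 (Or.inr he'))
    have hsupp : h.supp = (c.supp.erase y).erase e := by rw [hh, Finset.erase_right_comm]
    -- The side on which `h` contains the apex selects which of the two boxes lies above `h`.
    rcases mem_supp.1 huh with hl | hr
    · obtain ⟨g₂, l₂, r₂, hg₂, hhg₂⟩ := hL (hhbox u hl)
      refine diamond_of_removal hye hy hec hg₁ hg₂ hhg₁ hhg₂ hsupp hu₁ ?_ (hr₁ e hye.symm) ?_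
      · intro g hg hgr
        have := (eq_of_not_apex hgr.le hgr.supp hu hu' (hbox g hgr)).1 (hg.1 hl)
        exact SplitCell.ext (this.1.trans l₂.symm) (this.2.trans r₂.symm)
      · simp [r₂, hyu, hye]
    · obtain ⟨g₂, l₂, r₂, hg₂, hhg₂⟩ := hR fun h' => hhbox u h' hr
      refine diamond_of_removal hye hy hec hg₁ hg₂ hhg₁ hhg₂ hsupp hu₁ ?_ (hr₁ e hye.symm) ?_
      · intro g hg hgr
        have := (eq_of_not_apex hgr.le hgr.supp hu hu' (hbox g hgr)).2 (hg.2 hr)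
        exact SplitCell.ext (this.1.trans l₂.symm) (this.2.trans r₂.symm)
      · simp [r₂, hye]

/-- The pattern is simplicial unless deleting one vertex removes all independent vertices of a cone,
the case of `diamond_of_unique`. Otherwise `c` is a box, or an independent vertex survives and keeps
the apex, or the two deleted vertices are exactly the independent ones and deleting either alone
keeps a cone. -/
theorem diamond {c h : SplitCell n I} (hle : h ≤ c) (hcard : c.supp.card = h.supp.card + 2) :
    c.Diamond h := by
  have h2 : (c.supp \ h.supp).card = 2 := by
    rw [Finset.card_sdiff_of_subset (supp_mono hle)]
    omega
  obtain ⟨x, y, hxy, hset⟩ := Finset.card_eq_two.1 h2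
  have hmem : ∀ z, (z ∈ c.supp ∧ z ∉ h.supp) ↔ (z = x ∨ z = y) := fun z => by
    rw [← Finset.mem_sdiff, hset, Finset.mem_insert, Finset.mem_singleton]
  have hx := (hmem x).2 (Or.inl rfl)
  have hy := (hmem y).2 (Or.inr rfl)
  have hh : h.supp = (c.supp.erase x).erase y := by
    ext z
    have := hmem z
    have := @supp_mono _ _ _ _ _ hle z
    simp only [Finset.mem_erase]
    tauto
  have hh' : h.supp = (c.supp.erase y).erase x := by rw [hh, Finset.erase_right_comm]
  by_cases hbox : ∀ u ∈ c.left, u ∉ c.right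
  · obtain ⟨g₁, hg₁, hhg₁, hr₁, hu₁⟩ := IsRemoval.exists_unique_erase hle hx.2
      (fun h1 => hbox x h1) fun u hu hu' => absurd hu' (hbox u hu)
    obtain ⟨g₂, hg₂, hhg₂, hr₂, hu₂⟩ := IsRemoval.exists_unique_erase hle hy.2
      (fun h1 => hbox y h1) fun u hu hu' => absurd hu' (hbox u hu)
    exact diamond_of_removal hxy hx.1 hy.1 hg₁ hg₂ hhg₁ hhg₂ hh hu₁ hu₂ (hr₁ y hxy.symm)
      (hr₂ x hxy)
  push Not at hbox
  obtain ⟨u, hu, hu'⟩ := hbox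
  by_cases hX : ∃ e ∈ c.right, n ≤ (e : ℕ) ∧ e ≠ x
  · by_cases hY : ∃ e ∈ c.right, n ≤ (e : ℕ) ∧ e ≠ y
    · by_cases hE : ∃ e ∈ c.right, n ≤ (e : ℕ) ∧ e ≠ x ∧ e ≠ y
      · have huh : u ∈ h.supp := by
          obtain ⟨e, he, hn, hex, hey⟩ := hE
          refine mem_supp.2 (Or.inl (exists_apex_of_le hle hu hu' ?_ hn).1)
          rw [hh]
          exact Finset.mem_erase.2 ⟨hey, Finset.mem_erase.2 ⟨hex, mem_supp.2 (Or.inr he)⟩⟩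
        have key : ∀ z, z ∉ h.supp → z ∈ c.left → z ∉ c.right := fun z hz h1 h2 =>
          hz (c.apex_unique h1 h2 hu hu' ▸ huh)
        obtain ⟨g₁, hg₁, hhg₁, hr₁, hu₁⟩ := IsRemoval.exists_unique_erase hle hx.2
          (key x hx.2) fun _ _ _ => hX
        obtain ⟨g₂, hg₂, hhg₂, hr₂, hu₂⟩ := IsRemoval.exists_unique_erase hle hy.2
          (key y hy.2) fun _ _ _ => hY
        exact diamond_of_removal hxy hx.1 hy.1 hg₁ hg₂ hhg₁ hhg₂ hh hu₁ hu₂ (hr₁ y hxy.symm)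
          (hr₂ x hxy)
      · -- both removed vertices are in the independent part
        push Not at hE
        obtain ⟨e, he, hn, hex⟩ := hX
        obtain ⟨e', he', hn', hey⟩ := hY
        have hxn : n ≤ (x : ℕ) := by
          by_cases h : e' = x
          · exact h ▸ hn'
          · exact absurd (hE e' he' hn' h) hey
        have hyn : n ≤ (y : ℕ) := (hE e he hn hex) ▸ hn
        have hxr : x ∈ c.right := (mem_supp.1 hx.1).resolve_left (notMem_left hxn)
        have hyr : y ∈ c.right := (mem_supp.1 hy.1).resolve_left (notMem_left hyn)
        obtain ⟨g₁, hg₁, hhg₁, hr₁, hu₁⟩ := IsRemoval.exists_unique_erase hle hx.2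
          (fun h1 => absurd h1 (notMem_left hxn)) fun _ _ _ => ⟨y, hyr, hyn, hxy.symm⟩
        obtain ⟨g₂, hg₂, hhg₂, hr₂, hu₂⟩ := IsRemoval.exists_unique_erase hle hy.2
          (fun h1 => absurd h1 (notMem_left hyn)) fun _ _ _ => ⟨x, hxr, hxn, hxy⟩
        exact diamond_of_removal hxy hx.1 hy.1 hg₁ hg₂ hhg₁ hhg₂ hh hu₁ hu₂ (hr₁ y hxy.symm)
          (hr₂ x hxy)
    · push Not at hY
      obtain ⟨e, he, hn⟩ := c.exists_edge u hu hu'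
      have := hY e he hn
      subst this
      exact diamond_of_unique hle hxy hx.1 hh' he hn hY hu hu'
  · push Not at hX
    obtain ⟨e, he, hn⟩ := c.exists_edge u hu hu'
    have := hX e he hn
    subst this
    exact diamond_of_unique hle hxy.symm hy.1 hh he hn hX hu hu'

theorem _root_.finsum_eq_zero_of_pair {α : Type*} (f : α → ℤ) (a b : α) (hab : a ≠ b)
    (h : ∀ x, x ≠ a → x ≠ b → f x = 0) (hf : f a + f b = 0) : ∑ᶠ x, f x = 0 := by
  classical
  rw [finsum_eq_sum_of_support_subset (s := {a, b}) f, Finset.sum_pair hab, hf]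
  intro x hx
  by_contra hx'
  simp only [Finset.coe_insert, Finset.coe_singleton, Set.mem_insert_iff,
    Set.mem_singleton_iff, not_or] at hx'
  exact hx (h x hx'.1 hx'.2)

theorem finsum_incidence_mul_incidence {d : ℕ} (c h : SplitCell n I) (hc : c.supp.card = d + 2)
    (hh : h.supp.card = d) :
    ∑ᶠ g : {g : SplitCell n I // g.supp.card = d + 1}, c.incidence g.1 * g.1.incidence h = 0 := by
  by_cases hle : h ≤ c
  · obtain ⟨g₁, g₂, hne, h₁, h₂, hun, hsum⟩ := diamond hle (by omega)
    refine finsum_eq_zero_of_pair _ ⟨g₁, by omega⟩ ⟨g₂, by omega⟩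
      (fun h => hne (congrArg Subtype.val h)) (fun g hg hg' => ?_) hsum
    by_cases hgc : g.1 ≤ c
    · by_cases hhg : h ≤ g.1
      · rcases hun g.1 hhg hgc (by have := g.2; omega) with h | h
        · exact absurd (Subtype.ext h) hg
        · exact absurd (Subtype.ext h) hg'
      · rw [incidence_of_not_le hhg, mul_zero]
    · rw [incidence_of_not_le hgc, zero_mul]
  · rw [← finsum_zero]
    refine finsum_congr fun g => ?_
    by_cases hgc : g.1 ≤ c
    · rw [incidence_of_not_le fun hhg => hle (hhg.trans hgc), mul_zero]
    · rw [incidence_of_not_le hgc, zero_mul]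

end SplitCell

/-! ### Cells as an edge together with a subset of its link -/

namespace SplitCell

variable {p n : ℕ} {I : Fin p → Fin p → Prop}

/-- The largest element of the left set. -/
def lo (c : SplitCell n I) : Fin p := c.left.max' c.left_nonempty

/-- The largest element of the right set. -/
def hi (c : SplitCell n I) : Fin p := c.right.max' c.right_nonempty

theorem lo_mem (c : SplitCell n I) : c.lo ∈ c.left := Finset.max'_mem _ _

theorem hi_mem (c : SplitCell n I) : c.hi ∈ c.right := Finset.max'_mem _ _

theorem le_lo (c : SplitCell n I) {x : Fin p} (hx : x ∈ c.left) : x ≤ c.lo := Finset.le_max' _ _ hx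

theorem le_hi (c : SplitCell n I) {x : Fin p} (hx : x ∈ c.right) : x ≤ c.hi := Finset.le_max' _ _ hx

theorem lo_le_of_mem_right (c : SplitCell n I) {x : Fin p} (hx : x ∈ c.right) : c.lo ≤ x :=
  c.le _ c.lo_mem _ hx

theorem lo_lt_n (c : SplitCell n I) : (c.lo : ℕ) < n := c.lt_of_mem_left _ c.lo_mem

theorem eq_lo (c : SplitCell n I) {u : Fin p} (hu : u ∈ c.left) (hu' : u ∈ c.right) : u = c.lo :=
  le_antisymm (c.le_lo hu) (c.lo_le_of_mem_right hu')

/-- Equality would put `lo` on both sides, and then the right set contains an independent vertex,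
which is larger than every clique vertex. -/
theorem lo_lt_hi (c : SplitCell n I) : c.lo < c.hi := by
  refine lt_of_le_of_ne (c.lo_le_of_mem_right c.hi_mem) fun h => ?_
  obtain ⟨e, he, hn⟩ := c.exists_edge c.lo c.lo_mem (h ▸ c.hi_mem)
  have h1 : (e : ℕ) ≤ c.hi := c.le_hi he
  have h2 := c.lo_lt_n
  rw [h] at h2
  omega

theorem lo_mem_right_iff (c : SplitCell n I) : c.lo ∈ c.right ↔ ∃ e ∈ c.supp, n ≤ (e : ℕ) := by
  constructor
  · intro h
    obtain ⟨e, he, hn⟩ := c.exists_edge _ c.lo_mem h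
    exact ⟨e, mem_supp.2 (Or.inr he), hn⟩
  · rintro ⟨e, he, hn⟩
    obtain ⟨u, hu, hu', -⟩ := c.exists_apex e ((mem_supp.1 he).resolve_left (notMem_left hn)) hn
    exact c.eq_lo hu hu' ▸ hu'

/-- With the analogous description of the right set, this recovers a cell from its support and the
cut point `lo`. -/
theorem mem_left_iff (c : SplitCell n I) {x : Fin p} : x ∈ c.left ↔ x ∈ c.supp ∧ x ≤ c.lo := by
  refine ⟨fun h => ⟨mem_supp.2 (Or.inl h), c.le_lo h⟩, fun h => ?_⟩
  rcases mem_supp.1 h.1 with h' | h'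
  · exact h'
  · rw [le_antisymm h.2 (c.lo_le_of_mem_right h')]
    exact c.lo_mem

theorem mem_right_iff (c : SplitCell n I) {x : Fin p} :
    x ∈ c.right ↔ x ∈ c.supp ∧ (c.lo < x ∨ x = c.lo ∧ ∃ e ∈ c.supp, n ≤ (e : ℕ)) := by
  rw [← lo_mem_right_iff]
  constructor
  · intro h
    refine ⟨mem_supp.2 (Or.inr h), ?_⟩
    rcases (c.lo_le_of_mem_right h).lt_or_eq with h' | h'
    · exact Or.inl h'
    · exact Or.inr ⟨h'.symm, h' ▸ h⟩
  · rintro ⟨h, h' | ⟨rfl, h'⟩⟩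
    · exact (mem_supp.1 h).resolve_left fun hl => absurd (c.le_lo hl) (not_le.2 h')
    · exact h'

theorem le_hi_of_mem_supp (c : SplitCell n I) {x : Fin p} (hx : x ∈ c.supp) : x ≤ c.hi := by
  rcases mem_supp.1 hx with h | h
  · exact (c.le_lo h).trans c.lo_lt_hi.le
  · exact c.le_hi h

theorem related_lo (c : SplitCell n I) {x : Fin p} (hx : x ∈ c.supp) (hn : n ≤ (x : ℕ)) :
    I c.lo x := by
  obtain ⟨u, hu, hu', hI⟩ := c.exists_apex x ((mem_supp.1 hx).resolve_left (notMem_left hn)) hn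
  exact c.eq_lo hu hu' ▸ hI

theorem lo_mem_supp (c : SplitCell n I) : c.lo ∈ c.supp := mem_supp.2 (Or.inl c.lo_mem)

theorem hi_mem_supp (c : SplitCell n I) : c.hi ∈ c.supp := mem_supp.2 (Or.inr c.hi_mem)

theorem lo_mono {c d : SplitCell n I} (h : c ≤ d) : c.lo ≤ d.lo := d.le_lo (h.1 c.lo_mem)

theorem hi_mono {c d : SplitCell n I} (h : c ≤ d) : c.hi ≤ d.hi := d.le_hi (h.2 c.hi_mem)

theorem le_iff_supp_subset {c d : SplitCell n I} (h : c.lo = d.lo) : c ≤ d ↔ c.supp ⊆ d.supp := by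
  refine ⟨supp_mono, fun hs => ⟨fun x hx => ?_, fun x hx => ?_⟩⟩
  · rw [mem_left_iff] at hx ⊢
    exact ⟨hs hx.1, h ▸ hx.2⟩
  · rw [mem_right_iff] at hx ⊢
    obtain ⟨h1, h2 | ⟨h2, e, he, hn⟩⟩ := hx
    · exact ⟨hs h1, Or.inl (h ▸ h2)⟩
    · exact ⟨hs h1, Or.inr ⟨h ▸ h2, e, hs he, hn⟩⟩

theorem eq_of_supp_eq {c d : SplitCell n I} (h : c.lo = d.lo) (hs : c.supp = d.supp) : c = d :=
  le_antisymm ((le_iff_supp_subset h).2 hs.le) ((le_iff_supp_subset h.symm).2 hs.ge)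

/-- The edges of the split graph. -/
def IsPair (n : ℕ) (I : Fin p → Fin p → Prop) (i j : Fin p) : Prop :=
  (i : ℕ) < n ∧ i < j ∧ (n ≤ (j : ℕ) → I i j)

theorem isPair (c : SplitCell n I) : IsPair n I c.lo c.hi :=
  ⟨c.lo_lt_n, c.lo_lt_hi, c.related_lo c.hi_mem_supp⟩

open Classical in
/-- The vertices which may be added to the pair `i < j`. -/
def linkSet (n : ℕ) (I : Fin p → Fin p → Prop) (i j : Fin p) : Finset (Fin p) :=
  Finset.univ.filter fun x => x < j ∧ x ≠ i ∧ ((x : ℕ) < n ∨ I i x)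

theorem mem_linkSet {i j x : Fin p} :
    x ∈ linkSet n I i j ↔ x < j ∧ x ≠ i ∧ ((x : ℕ) < n ∨ I i x) := by simp [linkSet]

/-- The support without the two largest elements of the left and the right set. -/
def rest (c : SplitCell n I) : Finset (Fin p) := (c.supp.erase c.lo).erase c.hi

theorem rest_subset (c : SplitCell n I) : c.rest ⊆ linkSet n I c.lo c.hi := by
  intro x hx
  simp only [rest, Finset.mem_erase] at hx
  refine mem_linkSet.2 ⟨lt_of_le_of_ne (c.le_hi_of_mem_supp hx.2.2) hx.1, hx.2.1, ?_⟩
  by_cases h : (x : ℕ) < n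
  · exact Or.inl h
  · exact Or.inr (c.related_lo hx.2.2 (by omega))

theorem hi_mem_erase (c : SplitCell n I) : c.hi ∈ c.supp.erase c.lo :=
  Finset.mem_erase.2 ⟨c.lo_lt_hi.ne', c.hi_mem_supp⟩

theorem insert_rest (c : SplitCell n I) : insert c.lo (insert c.hi c.rest) = c.supp := by
  rw [rest, Finset.insert_erase c.hi_mem_erase, Finset.insert_erase c.lo_mem_supp]

theorem card_rest (c : SplitCell n I) : c.rest.card + 2 = c.supp.card := by
  rw [rest, ← Finset.card_erase_add_one c.lo_mem_supp, ← Finset.card_erase_add_one c.hi_mem_erase]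

theorem two_le_card (c : SplitCell n I) : 2 ≤ c.supp.card := by
  rw [← c.card_rest]
  omega

open Classical in
/-- The cell with given largest elements `i`, `j` and given remaining elements. -/
def ofRest {i j : Fin p} (h : IsPair n I i j) (S : Finset (Fin p)) (hS : S ⊆ linkSet n I i j) :
    SplitCell n I where
  left := (insert i (insert j S)).filter (· ≤ i)
  right := (insert i (insert j S)).filter fun x =>
    i < x ∨ x = i ∧ ∃ e ∈ insert i (insert j S), n ≤ (e : ℕ)
  left_nonempty := ⟨i, by simp⟩
  right_nonempty := ⟨j, by simp [h.2.1]⟩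
  le a ha b hb := by
    simp only [Finset.mem_filter] at ha hb
    rcases hb.2 with hb | hb
    · exact ha.2.trans hb.le
    · exact hb.1 ▸ ha.2
  lt_of_mem_left a ha := lt_of_le_of_lt (Finset.mem_filter.1 ha).2 h.1
  exists_apex e he hn := by
    refine ⟨i, by simp, ?_, ?_⟩
    · exact Finset.mem_filter.2 ⟨Finset.mem_insert_self _ _,
        Or.inr ⟨rfl, e, (Finset.mem_filter.1 he).1, hn⟩⟩
    · have := (Finset.mem_filter.1 he).1
      simp only [Finset.mem_insert] at this
      rcases this with rfl | rfl | h'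
      · exact absurd h.1 (by omega)
      · exact h.2.2 hn
      · exact (mem_linkSet.1 (hS h')).2.2.resolve_left (by omega)
  exists_edge u hu hu' := by
    simp only [Finset.mem_filter] at hu hu'
    obtain ⟨e, he, hn⟩ := (hu'.2.resolve_left (not_lt.2 hu.2)).2
    refine ⟨e, Finset.mem_filter.2 ⟨he, Or.inl ?_⟩, hn⟩
    exact Fin.lt_def.2 (lt_of_lt_of_le h.1 hn)

variable {i j : Fin p} (h : IsPair n I i j) (S : Finset (Fin p)) (hS : S ⊆ linkSet n I i j)

theorem ofRest_supp : (ofRest h S hS).supp = insert i (insert j S) := by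
  ext x
  rw [mem_supp, ofRest, Finset.mem_filter, Finset.mem_filter]
  constructor
  · rintro (h | h) <;> exact h.1
  · intro hx
    rcases le_or_gt x i with h' | h'
    · exact Or.inl ⟨hx, h'⟩
    · exact Or.inr ⟨hx, Or.inl h'⟩

theorem ofRest_lo : (ofRest h S hS).lo = i := by
  refine le_antisymm ?_ ((ofRest h S hS).le_lo (by simp [ofRest]))
  exact (Finset.mem_filter.1 (ofRest h S hS).lo_mem).2

theorem ofRest_hi : (ofRest h S hS).hi = j := by
  refine le_antisymm ?_ ((ofRest h S hS).le_hi (by simp [ofRest, h.2.1]))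
  have := (ofRest h S hS).hi_mem_supp
  rw [ofRest_supp] at this
  simp only [Finset.mem_insert] at this
  rcases this with h' | h' | h'
  · rw [h']
    exact h.2.1.le
  · rw [h']
  · exact (mem_linkSet.1 (hS h')).1.le

theorem ofRest_rest : (ofRest h S hS).rest = S := by
  have h1 : i ∉ S := fun h' => (mem_linkSet.1 (hS h')).2.1 rfl
  have h2 : j ∉ S := fun h' => lt_irrefl _ (mem_linkSet.1 (hS h')).1
  rw [rest, ofRest_supp, ofRest_lo, ofRest_hi, Finset.erase_insert, Finset.erase_insert h2]
  simp [h1, h.2.1.ne]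

theorem eq_of_rest_eq {c d : SplitCell n I} (h₁ : c.lo = d.lo) (h₂ : c.hi = d.hi)
    (h₃ : c.rest = d.rest) : c = d := by
  refine eq_of_supp_eq h₁ ?_
  rw [← c.insert_rest, ← d.insert_rest, h₁, h₂, h₃]

theorem rest_subset_iff {c d : SplitCell n I} (h₁ : c.lo = d.lo) (h₂ : c.hi = d.hi) :
    c.rest ⊆ d.rest ↔ c ≤ d := by
  rw [le_iff_supp_subset h₁]
  constructor
  · intro h
    rw [← c.insert_rest, ← d.insert_rest, h₁, h₂]
    exact Finset.insert_subset_insert _ (Finset.insert_subset_insert _ h)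
  · intro h
    rw [rest, rest, h₁, h₂]
    exact Finset.erase_subset_erase _ (Finset.erase_subset_erase _ h)

theorem incidence_ne_zero_iff {c d : SplitCell n I} (hcard : c.supp.card = d.supp.card + 1) :
    d ≤ c ↔ c.incidence d = 1 ∨ c.incidence d = -1 := by
  constructor
  · intro hle
    obtain ⟨x, hx, hd⟩ := exists_supp_eq_erase hle hcard
    rw [incidence_of_le hle hx hd]
    exact c.eps_eq_or x
  · intro h
    by_contra hle
    rw [incidence_of_not_le hle] at h
    simp at h

/-- The vertex of the complex given by an edge of the split graph. -/
def vertex : SplitCell n I := ofRest h ∅ (Finset.empty_subset _)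

theorem vertex_supp : (vertex h).supp = {i, j} := ofRest_supp ..

theorem vertex_lo : (vertex h).lo = i := ofRest_lo ..

theorem vertex_hi : (vertex h).hi = j := ofRest_hi ..

theorem vertex_card : (vertex h).supp.card = 2 := by
  rw [vertex_supp, Finset.card_pair h.2.1.ne]

/-- For independent `j` the vertex `ij` is a cone with apex `i`, which explains the additional
condition on `i`. -/
theorem vertex_le {c : SplitCell n I} (hi : i ∈ c.left) (hj : j ∈ c.right)
    (hij : n ≤ (j : ℕ) → i ∈ c.right) : vertex h ≤ c := by
  constructor <;> intro x hx
  · rw [mem_left_iff, vertex_supp, vertex_lo] at hx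
    simp only [Finset.mem_insert, Finset.mem_singleton] at hx
    rcases hx with ⟨rfl | rfl, hx⟩
    · exact hi
    · exact absurd h.2.1 (not_lt.2 hx)
  · rw [mem_right_iff, vertex_supp, vertex_lo] at hx
    simp only [Finset.mem_insert, Finset.mem_singleton] at hx
    rcases hx with ⟨rfl | rfl, hx⟩
    · obtain ⟨-, e, rfl | rfl, he⟩ := hx.resolve_left (lt_irrefl _)
      · exact absurd h.1 (by omega)
      · exact hij he
    · exact hj

theorem eq_vertex {c : SplitCell n I} (hc : c.supp.card = 2) : c = vertex c.isPair := by
  refine eq_of_rest_eq (vertex_lo _).symm (vertex_hi _).symm ?_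
  have h0 : c.rest.card = 0 := by
    have := c.card_rest
    omega
  rw [Finset.card_eq_zero.1 h0]
  exact (ofRest_rest ..).symm

theorem vertex_lo_hi_le (c : SplitCell n I) : vertex c.isPair ≤ c :=
  vertex_le _ c.lo_mem c.hi_mem fun hn => c.lo_mem_right_iff.2 ⟨_, c.hi_mem_supp, hn⟩

theorem mem_right_of_lo_lt {c : SplitCell n I} {x : Fin p} (hx : x ∈ c.supp) (h : c.lo < x) :
    x ∈ c.right := c.mem_right_iff.2 ⟨hx, Or.inl h⟩

theorem isPair_lo {c : SplitCell n I} {x : Fin p} (hx : x ∈ c.supp) (h : c.lo < x) :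
    IsPair n I c.lo x := ⟨c.lo_lt_n, h, c.related_lo hx⟩

theorem vertex_lo_le {c : SplitCell n I} {x : Fin p} (hx : x ∈ c.supp) (h : c.lo < x) :
    vertex (isPair_lo hx h) ≤ c :=
  vertex_le _ c.lo_mem (mem_right_of_lo_lt hx h) fun hn => c.lo_mem_right_iff.2 ⟨_, hx, hn⟩

/-- Every element of the support of a cell is in the support of a vertex of the cell. -/
theorem exists_vertex_le (c : SplitCell n I) {x : Fin p} (hx : x ∈ c.supp) :
    ∃ v ≤ c, v.supp.card = 2 ∧ x ∈ v.supp := by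
  rcases lt_trichotomy x c.lo with h | rfl | h
  · have hxl : x ∈ c.left := c.mem_left_iff.2 ⟨hx, h.le⟩
    have hxn := c.lt_of_mem_left x hxl
    by_cases hn : n ≤ (c.hi : ℕ)
    · have hp : IsPair n I x c.lo := ⟨hxn, h, fun h' => absurd c.lo_lt_n (by omega)⟩
      exact ⟨vertex hp, vertex_le _ hxl (c.lo_mem_right_iff.2 ⟨_, c.hi_mem_supp, hn⟩)
        fun h' => absurd c.lo_lt_n (by omega), vertex_card _, by simp [vertex_supp]⟩
    · have hp : IsPair n I x c.hi := ⟨hxn, h.trans c.lo_lt_hi, fun h' => absurd h' hn⟩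
      exact ⟨vertex hp, vertex_le _ hxl c.hi_mem fun h' => absurd h' hn, vertex_card _,
        by simp [vertex_supp]⟩
  · exact ⟨_, c.vertex_lo_hi_le, vertex_card _, by simp [vertex_supp]⟩
  · exact ⟨_, vertex_lo_le hx h, vertex_card _, by simp [vertex_supp]⟩

/-- Special to dimension zero: the support `{lo, hi}` has only one ordering with `lo < hi`, whereas
larger boxes with equal support can be cut at different places. -/
theorem eq_of_supp_eq_of_card {c d : SplitCell n I} (hc : c.supp.card = 2)
    (hs : c.supp = d.supp) : c = d := by
  have hd : d.supp.card = 2 := hs ▸ hc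
  refine eq_of_supp_eq ?_ hs
  have h1 : ({c.lo, c.hi} : Finset (Fin p)) = {d.lo, d.hi} := by
    rw [← vertex_supp c.isPair, ← vertex_supp d.isPair, ← eq_vertex hc, ← eq_vertex hd, hs]
  have h2 : c.lo = d.lo ∨ c.lo = d.hi := by
    have : c.lo ∈ ({d.lo, d.hi} : Finset (Fin p)) := h1 ▸ Finset.mem_insert_self _ _
    simpa using this
  have h3 : d.lo = c.lo ∨ d.lo = c.hi := by
    have : d.lo ∈ ({c.lo, c.hi} : Finset (Fin p)) := h1 ▸ Finset.mem_insert_self _ _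
    simpa using this
  have h4 := c.lo_lt_hi
  have h5 := d.lo_lt_hi
  grind

/-- An edge of the complex has two end points with opposite signs, so that the constant augmentation
with value `1` is compatible with the incidence function. -/
theorem finsum_incidence_eq_zero (c : SplitCell n I) (hc : c.supp.card = 3) :
    ∑ᶠ v : {v : SplitCell n I // v.supp.card = 2}, c.incidence v.1 = 0 := by
  obtain ⟨x, hx⟩ : ∃ x, c.rest = {x} := Finset.card_eq_one.1 (by
    have := c.card_rest
    omega)
  have hxl := c.rest_subset (hx ▸ Finset.mem_singleton_self x)
  rw [mem_linkSet] at hxl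
  have hsupp : c.supp = {c.lo, c.hi, x} := by rw [← c.insert_rest, hx]
  have hxs : x ∈ c.supp := by simp [hsupp]
  have hlh := c.lo_lt_hi
  have hv₁ : (vertex c.isPair).supp = c.supp.erase x := by
    rw [vertex_supp, hsupp]
    ext z
    simp only [Finset.mem_insert, Finset.mem_singleton, Finset.mem_erase]
    grind
  -- it suffices to give a second vertex and to exclude the third possibility
  have key : ∀ (v : SplitCell n I) (y z : Fin p), v ≤ c → v.supp = c.supp.erase y → y ∈ c.supp →
      y ≠ x → (∀ w ∈ c.supp, w = x ∨ w = y ∨ w = z) →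
      (∀ w ≤ c, w.supp ≠ c.supp.erase z) → c.eps x + c.eps y = 0 →
      ∑ᶠ v : {v : SplitCell n I // v.supp.card = 2}, c.incidence v.1 = 0 := by
    intro v y z hv hvs hy hyx hall hex heps
    refine finsum_eq_zero_of_pair _ ⟨vertex c.isPair, vertex_card _⟩ ⟨v, ?_⟩ ?_ ?_ ?_
    · rw [hvs, Finset.card_erase_of_mem hy, hc]
    · intro h
      have h1 := congrArg (fun v => v.1.supp) h
      dsimp only at h1
      rw [hv₁, hvs] at h1
      have h2 : y ∈ c.supp.erase x := Finset.mem_erase.2 ⟨hyx, hy⟩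
      rw [h1] at h2
      exact Finset.notMem_erase _ _ h2
    · rintro ⟨w, hw⟩ h1 h2
      refine incidence_of_not_le fun hwc => ?_
      obtain ⟨t, ht, hwt⟩ := exists_supp_eq_erase hwc (by rw [hc, hw])
      rcases hall t ht with rfl | rfl | rfl
      · exact h1 (Subtype.ext (eq_of_supp_eq_of_card hw (hwt.trans hv₁.symm)))
      · exact h2 (Subtype.ext (eq_of_supp_eq_of_card hw (hwt.trans hvs.symm)))
      · exact hex w hwc hwt
    · rw [incidence_of_le c.vertex_lo_hi_le hxs hv₁, incidence_of_le hv hy hvs, heps]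
  have mem_iff : ∀ w, w ∈ c.supp ↔ w = c.lo ∨ w = c.hi ∨ w = x := fun w => by simp [hsupp]
  have hpos : ∀ (y : Fin p) (A : Finset (Fin p)), (∀ w, w ∈ A ↔ w ∈ c.supp ∧ w < y) →
      c.supp.position y = A.card := fun y A hA => by
    unfold Finset.position
    congr 1
    ext w
    rw [Finset.mem_filter, hA]
  -- One end point is `(lo, hi)`. The other is `(x, lo)` if `x < lo` and `hi` is independent, `(x,
  -- hi)` if `x < lo` and `hi` is in the clique, and `(lo, x)` if `lo < x`.
  rcases lt_or_gt_of_ne hxl.2.1 with hlt | hgt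
  · have hxl' : x ∈ c.left := c.mem_left_iff.2 ⟨hxs, hlt.le⟩
    have hxn := c.lt_of_mem_left x hxl'
    have hxr : x ∉ c.right := fun h => absurd (c.lo_le_of_mem_right h) (not_le.2 hlt)
    have px : c.supp.position x = 0 := hpos x ∅ (by simp only [mem_iff]; grind)
    by_cases hn : n ≤ (c.hi : ℕ)
    · have hp : IsPair n I x c.lo := ⟨hxn, hlt, fun h' => absurd c.lo_lt_n (by omega)⟩
      refine key (vertex hp) c.hi c.lo ?_ ?_ c.hi_mem_supp hxl.1.ne' ?_ ?_ ?_
      · exact vertex_le _ hxl' (c.lo_mem_right_iff.2 ⟨_, c.hi_mem_supp, hn⟩)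
          fun h' => absurd c.lo_lt_n (by omega)
      · ext w
        simp only [vertex_supp, Finset.mem_insert, Finset.mem_singleton, Finset.mem_erase, mem_iff]
        grind
      · simp only [mem_iff]
        tauto
      · intro w hw hws
        have := (exists_apex_of_le hw c.lo_mem (c.lo_mem_right_iff.2 ⟨_, c.hi_mem_supp, hn⟩)
          (e := c.hi) (by rw [hws]; exact c.hi_mem_erase) hn).1
        exact Finset.notMem_erase _ _ (hws ▸ mem_supp.2 (Or.inl this))
      · have ph : c.supp.position c.hi = 2 := by
          rw [hpos c.hi {x, c.lo}, Finset.card_pair hlt.ne]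
          simp only [mem_iff, Finset.mem_insert, Finset.mem_singleton]
          grind
        simp [eps, px, ph, hxr, c.hi_mem]
    · have hp : IsPair n I x c.hi := ⟨hxn, hxl.1, fun h' => absurd h' hn⟩
      have hlr : c.lo ∉ c.right := by
        rw [lo_mem_right_iff]
        rintro ⟨e, he, hen⟩
        have : (e : ℕ) ≤ c.hi := c.le_hi_of_mem_supp he
        omega
      refine key (vertex hp) c.lo c.hi ?_ ?_ c.lo_mem_supp hlt.ne' ?_ ?_ ?_
      · exact vertex_le _ hxl' c.hi_mem fun h' => absurd h' hn
      · ext w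
        simp only [vertex_supp, Finset.mem_insert, Finset.mem_singleton, Finset.mem_erase, mem_iff]
        grind
      · simp only [mem_iff]
        tauto
      · intro w hw hws
        have h1 := w.hi_mem_supp
        rw [hws, Finset.mem_erase, mem_iff] at h1
        have h2 := hw.2 w.hi_mem
        grind
      · have pl : c.supp.position c.lo = 1 := by
          rw [hpos c.lo {x}, Finset.card_singleton]
          simp only [mem_iff, Finset.mem_singleton]
          grind
        simp [eps, px, pl, hxr, hlr]
  · have hxr := mem_right_of_lo_lt hxs hgt
    refine key (vertex (isPair_lo hxs hgt)) c.hi c.lo (vertex_lo_le hxs hgt) ?_ c.hi_mem_supp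
      hxl.1.ne' ?_ ?_ ?_
    · ext w
      simp only [vertex_supp, Finset.mem_insert, Finset.mem_singleton, Finset.mem_erase, mem_iff]
      grind
    · simp only [mem_iff]
      tauto
    · intro w hw hws
      have h1 := w.lo_mem_supp
      rw [hws, Finset.mem_erase, mem_iff] at h1
      have h2 := c.le_lo (hw.1 w.lo_mem)
      grind
    · have ph : c.supp.position c.hi = 2 := by
        rw [hpos c.hi {x, c.lo}, Finset.card_pair hgt.ne']
        simp only [mem_iff, Finset.mem_insert, Finset.mem_singleton]
        grind
      have px : c.supp.position x = 1 := by
        rw [hpos x {c.lo}, Finset.card_singleton]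
        simp only [mem_iff, Finset.mem_singleton]
        grind
      simp [eps, px, ph, hxr, c.hi_mem]

end SplitCell

/-- A bounded set given by finitely many affine inequalities which can be satisfied strictly is
the image of the closed unit ball. -/
theorem exists_partialEquiv_of_affine_inequalities {d : ℕ} {X : Type*} [TopologicalSpace X]
    {J : Type*} [Finite J] {g : J → (Fin d → ℝ) → ℝ} (hg : ∀ j, Continuous (g j))
    (hg' : ∀ j y y' (s t : ℝ), s + t = 1 → g j (s • y + t • y') = s * g j y + t * g j y')
    {y₀ : Fin d → ℝ} (hy₀ : ∀ j, 0 < g j y₀) (hb : Bornology.IsBounded {y | ∀ j, 0 ≤ g j y})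
    {A : (Fin d → ℝ) → X} {π : X → (Fin d → ℝ)} (hA : Continuous A) (hπ : Continuous π)
    (hπA : ∀ y, π (A y) = y) :
    ∃ φ : PartialEquiv (Fin d → ℝ) X, φ.source = Metric.ball 0 1 ∧ Continuous φ ∧
      Continuous φ.symm ∧ Function.Injective φ ∧
      φ '' Metric.ball 0 1 = A '' {y | ∀ j, 0 < g j y} ∧
      φ '' Metric.closedBall 0 1 = A '' {y | ∀ j, 0 ≤ g j y} := by
  set U : Set (Fin d → ℝ) := {y | ∀ j, 0 < g j y} with hU
  set P : Set (Fin d → ℝ) := {y | ∀ j, 0 ≤ g j y} with hP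
  have hUP : U ⊆ P := fun y hy j => (hy j).le
  have hopen : IsOpen U := by
    rw [hU, Set.ofPred_forall]
    exact isOpen_iInter_of_finite fun j => isOpen_lt continuous_const (hg j)
  have hclosed : IsClosed P := by
    rw [hP, Set.ofPred_forall]
    exact isClosed_iInter fun j => isClosed_le continuous_const (hg j)
  have hconv : Convex ℝ U := by
    intro y hy y' hy' s t hs ht hst j
    rw [hg' j y y' s t hst]
    rcases hs.eq_or_lt with rfl | hs
    · rw [zero_add] at hst
      simp [hst, hy' j]
    · exact add_pos_of_pos_of_nonneg (mul_pos hs (hy j)) (mul_nonneg ht (hy' j).le)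
  have hclosure : closure U = P := by
    refine (closure_minimal hUP hclosed).antisymm fun y hy => ?_
    -- Moving a point of `P` slightly towards the strict solution `y₀` makes all inequalities
    -- strict.
    have hlim : Filter.Tendsto (fun t : ℝ => (1 - t) • y + t • y₀) (𝓝[>] 0) (𝓝 y) := by
      have : Continuous fun t : ℝ => (1 - t) • y + t • y₀ := by fun_prop
      have := this.tendsto 0
      simp only [sub_zero, one_smul, zero_smul, add_zero] at this
      exact this.mono_left nhdsWithin_le_nhds
    refine mem_closure_of_tendsto hlim ?_
    filter_upwards [Ioo_mem_nhdsGT (zero_lt_one (α := ℝ))] with t ht j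
    rw [hg' j _ _ _ _ (sub_add_cancel 1 t)]
    exact add_pos_of_nonneg_of_pos (mul_nonneg (by linarith [ht.2]) (hy j)) (mul_pos ht.1 (hy₀ j))
  -- A homeomorphism of the whole space carrying the open convex set to the open ball and its
  -- closure to the closed ball. Hence `A ∘ h.symm` and `h ∘ π` are continuous everywhere.
  obtain ⟨h, h1, h2, -⟩ := exists_homeomorph_image_interior_closure_frontier_eq_unitBall hconv
    (by rw [hopen.interior_eq]; exact ⟨y₀, hy₀⟩) (hb.subset hUP)
  rw [hopen.interior_eq] at h1
  rw [hclosure] at h2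
  have himage : ∀ S : Set (Fin d → ℝ), (A ∘ h.symm) '' (h '' S) = A '' S := by
    intro S
    rw [Set.image_comp, ← Set.image_comp h.symm h, h.symm_comp_self, Set.image_id]
  refine ⟨{ toFun := A ∘ h.symm
            invFun := h ∘ π
            source := Metric.ball 0 1
            target := A '' U
            map_source' := fun y hy => ?_
            map_target' := ?_
            left_inv' := fun y _ => by simp [hπA]
            right_inv' := ?_ }, rfl, hA.comp h.symm.continuous, h.continuous.comp hπ, ?_, ?_, ?_⟩
  · rw [← h1] at hy
    rw [← himage]
    exact Set.mem_image_of_mem _ hy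
  · rintro _ ⟨y, hy, rfl⟩
    rw [← h1, Function.comp_apply, hπA]
    exact Set.mem_image_of_mem _ hy
  · rintro _ ⟨y, hy, rfl⟩
    simp [hπA]
  · exact (Function.LeftInverse.injective hπA).comp h.symm.injective
  · change (A ∘ h.symm) '' _ = _
    rw [← h1, himage]
  · change (A ∘ h.symm) '' _ = _
    rw [← h2, himage]

/-! ### Geometric realization of the cells -/

namespace SplitCell

variable {p n : ℕ} {I : Fin p → Fin p → Prop}

/-- The ambient space of the realization of the complex of cells. -/
abbrev Ambient (p : ℕ) : Type := (Fin p → ℝ) × (Fin p → Fin p → ℝ)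

/-- The normalization conditions for points of the realization: `z.1` is a signed measure of total
mass zero on the clique and `z.2` is a measure on the pairs of a clique vertex and an independent
vertex. -/
structure IsPoint (n : ℕ) (z : Ambient p) : Prop where
  lt : ∀ x, z.1 x ≠ 0 → (x : ℕ) < n
  nonneg : ∀ v e, 0 ≤ z.2 v e
  le : ∀ v e, z.2 v e ≠ 0 → n ≤ (e : ℕ)
  sum_eq_zero : ∑ x, z.1 x = 0
  sum_eq_one : ∑ x : Fin p, ((x : ℕ) : ℝ) * z.1 x + ∑ v, ∑ e, z.2 v e = 1

/-- The vertices that the left set of a cell containing the point has to contain. -/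
def negSet (z : Ambient p) : Set (Fin p) := {x | z.1 x < 0 ∨ ∃ e, z.2 x e ≠ 0}

/-- The vertices that the right set of a cell containing the point has to contain. -/
def posSet (z : Ambient p) : Set (Fin p) := {x | 0 < z.1 x ∨ (∃ e, z.2 x e ≠ 0) ∨ ∃ v, z.2 v x ≠ 0}

/-- The closed cell in the realization. -/
def closedSet (c : SplitCell n I) : Set (Ambient p) :=
  {z | IsPoint n z ∧ negSet z ⊆ c.left ∧ posSet z ⊆ c.right}

/-- The open cell in the realization. -/
def openSet (c : SplitCell n I) : Set (Ambient p) :=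
  {z | IsPoint n z ∧ negSet z = c.left ∧ posSet z = c.right}

theorem openSet_subset (c : SplitCell n I) : c.openSet ⊆ c.closedSet :=
  fun _ h => ⟨h.1, h.2.1.le, h.2.2.le⟩

theorem closedSet_mono {c d : SplitCell n I} (h : c ≤ d) : c.closedSet ⊆ d.closedSet :=
  fun _ hz => ⟨hz.1, hz.2.1.trans (Finset.coe_subset.2 h.1), hz.2.2.trans (Finset.coe_subset.2 h.2)⟩

/-- Both sets of the cell are read off from the point, so open cells are disjoint. -/
theorem eq_of_mem_openSet {c d : SplitCell n I} {z : Ambient p} (hc : z ∈ c.openSet)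
    (hd : z ∈ d.openSet) : c = d :=
  SplitCell.ext (Finset.coe_injective (hc.2.1.symm.trans hd.2.1))
    (Finset.coe_injective (hc.2.2.symm.trans hd.2.2))

theorem le_of_mem {c d : SplitCell n I} {z : Ambient p} (hc : z ∈ c.openSet)
    (hd : z ∈ d.closedSet) : c ≤ d :=
  ⟨Finset.coe_subset.1 (hc.2.1 ▸ hd.2.1), Finset.coe_subset.1 (hc.2.2 ▸ hd.2.2)⟩

/-- The negative and positive sets of the point are themselves the left and right sets of a cell; a
closed cell is thus the union of the open cells of its faces. -/
theorem exists_mem_openSet {c : SplitCell n I} {z : Ambient p} (hz : z ∈ c.closedSet) :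
    ∃ d ≤ c, z ∈ d.openSet := by
  classical
  obtain ⟨hp, hneg, hpos⟩ := hz
  have hedge : ∀ v e, z.2 v e ≠ 0 → n ≤ (e : ℕ) ∧ v ∈ c.left ∧ v ∈ c.right ∧ e ∈ c.right :=
    fun v e h => ⟨hp.le v e h, hneg (Or.inr ⟨e, h⟩), hpos (Or.inr (Or.inl ⟨e, h⟩)),
      hpos (Or.inr (Or.inr ⟨v, h⟩))⟩
  -- Otherwise `z.2 = 0` and `z.1` has constant sign and total mass zero, so `z = 0`, against the
  -- second normalization.
  have hexists : (∃ v e, z.2 v e ≠ 0) ∨ (∃ x, z.1 x < 0) ∧ ∃ x, 0 < z.1 x := by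
    by_contra! hcon
    obtain ⟨h1, h2⟩ := hcon
    have h3 : ∀ x, z.1 x = 0 := by
      by_cases h : ∃ x, z.1 x < 0
      · have h4 := h2 h
        intro x
        exact (Finset.sum_eq_zero_iff_of_nonpos fun i _ => h4 i).1 hp.sum_eq_zero x
          (Finset.mem_univ _)
      · push Not at h
        intro x
        exact (Finset.sum_eq_zero_iff_of_nonneg fun i _ => h i).1 hp.sum_eq_zero x
          (Finset.mem_univ _)
    have := hp.sum_eq_one
    simp [h1, h3] at this
  refine ⟨{ left := (negSet z).toFinset, right := (posSet z).toFinset,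
            left_nonempty := ?_, right_nonempty := ?_, le := ?_, lt_of_mem_left := ?_,
            exists_apex := ?_, exists_edge := ?_ }, ⟨?_, ?_⟩, hp, ?_, ?_⟩
  · rw [Set.toFinset_nonempty]
    rcases hexists with ⟨v, e, h⟩ | ⟨⟨x, hx⟩, -⟩
    exacts [⟨v, Or.inr ⟨e, h⟩⟩, ⟨x, Or.inl hx⟩]
  · rw [Set.toFinset_nonempty]
    rcases hexists with ⟨v, e, h⟩ | ⟨-, ⟨x, hx⟩⟩
    exacts [⟨v, Or.inr (Or.inl ⟨e, h⟩)⟩, ⟨x, Or.inl hx⟩]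
  · intro a ha b hb
    exact c.le a (hneg (Set.mem_toFinset.1 ha)) b (hpos (Set.mem_toFinset.1 hb))
  · intro a ha
    exact c.lt_of_mem_left a (hneg (Set.mem_toFinset.1 ha))
  · intro e he hn
    rw [Set.mem_toFinset] at he
    have : ∃ v, z.2 v e ≠ 0 := by
      rcases he with he | ⟨e', he⟩ | he
      · exact absurd (hp.lt e he.ne') (by omega)
      · exact absurd (hedge _ _ he).2.1 (notMem_left hn)
      · exact he
    obtain ⟨v, hv⟩ := this
    obtain ⟨-, h1, h2, h3⟩ := hedge v e hv
    refine ⟨v, Set.mem_toFinset.2 (Or.inr ⟨e, hv⟩), Set.mem_toFinset.2 (Or.inr (Or.inl ⟨e, hv⟩)), ?_⟩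
    rw [c.eq_lo h1 h2]
    exact c.related_lo (mem_supp.2 (Or.inr h3)) hn
  · intro u hu hu'
    rw [Set.mem_toFinset] at hu hu'
    have : ∃ v e, z.2 v e ≠ 0 := by
      rcases hu with hu | ⟨e, he⟩
      · rcases hu' with hu' | ⟨e, he⟩ | ⟨v, hv⟩
        exacts [absurd hu hu'.not_gt, ⟨u, e, he⟩, ⟨v, u, hv⟩]
      · exact ⟨u, e, he⟩
    obtain ⟨v, e, h⟩ := this
    exact ⟨e, Set.mem_toFinset.2 (Or.inr (Or.inr ⟨v, h⟩)), hp.le v e h⟩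
  · intro x hx
    exact hneg (Set.mem_toFinset.1 hx)
  · intro x hx
    exact hpos (Set.mem_toFinset.1 hx)
  · rw [Set.coe_toFinset]
  · rw [Set.coe_toFinset]

/-- The supports agree, so only the cut points could differ. They do not: a cone keeps its apex, and
in a box `d.lo` is not available on the right. -/
theorem eq_of_le_of_card {c d : SplitCell n I} (h : c ≤ d) (hc : d.supp.card ≤ c.supp.card) :
    c = d := by
  have hs : c.supp = d.supp := Finset.eq_of_subset_of_card_le (supp_mono h) hc
  refine eq_of_supp_eq (le_antisymm (lo_mono h) (c.le_lo ?_)) hs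
  by_cases hd : d.lo ∈ d.right
  · obtain ⟨e, he, hn⟩ := d.lo_mem_right_iff.1 hd
    exact (exists_apex_of_le h d.lo_mem hd (hs ▸ he) hn).1
  · have : d.lo ∈ c.supp := hs ▸ d.lo_mem_supp
    exact (mem_supp.1 this).resolve_right fun h' => hd (h.2 h')

/-! #### Coordinates on a closed cell -/

/-- The sign of a vertex of the clique, depending on its position. -/
def sgn (c : SplitCell n I) (x : Fin p) : ℝ := if n ≤ (x : ℕ) then 0 else if x < c.lo then -1 else 1

/-- The weight of a vertex in the normalization condition. -/
def weight (c : SplitCell n I) (x : Fin p) : ℝ :=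
  if n ≤ (x : ℕ) then 1 else c.sgn x * (((x : ℕ) : ℝ) - (c.lo : ℕ))

/-- The point of the ambient space with given coordinates. -/
def realize (c : SplitCell n I) (Y : Fin p → ℝ) : Ambient p :=
  (fun x => if x = c.lo then -∑ x', c.sgn x' * Y x' else c.sgn x * Y x,
    fun v e => if v = c.lo ∧ n ≤ (e : ℕ) then Y e else 0)

/-- The coordinates of a point. -/
def coord (c : SplitCell n I) (z : Ambient p) (x : Fin p) : ℝ :=
  if n ≤ (x : ℕ) then z.2 c.lo x else c.sgn x * z.1 x

variable (c : SplitCell n I)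

theorem sgn_of_le {x : Fin p} (h : n ≤ (x : ℕ)) : c.sgn x = 0 := if_pos h

theorem sgn_mul_sgn {x : Fin p} (h : (x : ℕ) < n) : c.sgn x * c.sgn x = 1 := by
  rw [sgn, if_neg (by omega)]
  split_ifs <;> norm_num

theorem coord_realize {Y : Fin p → ℝ} {x : Fin p} (h : x ≠ c.lo) : c.coord (c.realize Y) x = Y x := by
  by_cases hx : n ≤ (x : ℕ)
  · simp [coord, realize, hx]
  · simp only [coord, realize, hx, if_false, h]
    rw [← mul_assoc, sgn_mul_sgn c (by omega), one_mul]

theorem lo_not_ge : ¬ n ≤ (c.lo : ℕ) := by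
  have := c.lo_lt_n
  omega

/-- For a clique vertex the weight is the distance `|x - lo|` between distinct integers. -/
theorem one_le_weight {x : Fin p} (h : x ≠ c.lo) : 1 ≤ c.weight x := by
  unfold weight sgn
  split_ifs with h1 h2
  · exact le_rfl
  · have : ((x : ℕ) : ℝ) + 1 ≤ (c.lo : ℕ) := by exact_mod_cast Fin.lt_def.1 h2
    linarith
  · have : c.lo < x := lt_of_le_of_ne (not_lt.1 h2) h.symm
    have : ((c.lo : ℕ) : ℝ) + 1 ≤ (x : ℕ) := by exact_mod_cast Fin.lt_def.1 this
    linarith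

/-- The normalization conditions in coordinates. -/
theorem sum_realize (Y : Fin p → ℝ) (hY : Y c.lo = 0) :
    ∑ x, (c.realize Y).1 x = 0 ∧
    ∑ x : Fin p, ((x : ℕ) : ℝ) * (c.realize Y).1 x + ∑ v, ∑ e, (c.realize Y).2 v e =
      ∑ x, c.weight x * Y x := by
  have h1 : ∀ x, (c.realize Y).1 x =
      c.sgn x * Y x - if x = c.lo then ∑ x', c.sgn x' * Y x' else 0 := by
    intro x
    by_cases hx : x = c.lo
    · simp [realize, hx, hY]
    · simp [realize, hx]
  constructor
  · simp only [h1, Finset.sum_sub_distrib, Finset.sum_ite_eq', Finset.mem_univ, if_true, sub_self]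
  · have h2 : ∑ v, ∑ e, (c.realize Y).2 v e = ∑ e : Fin p, if n ≤ (e : ℕ) then Y e else 0 := by
      rw [Finset.sum_eq_single c.lo]
      · simp [realize]
      · intro v _ hv
        simp [realize, hv]
      · simp
    simp only [h1, h2, mul_sub, Finset.sum_sub_distrib, mul_ite, mul_zero, Finset.sum_ite_eq',
      Finset.mem_univ, if_true]
    rw [Finset.mul_sum, ← Finset.sum_sub_distrib, ← Finset.sum_add_distrib]
    refine Finset.sum_congr rfl fun x _ => ?_
    by_cases hx : n ≤ (x : ℕ)
    · simp [weight, hx, sgn_of_le]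
    · simp only [weight, hx, if_false]
      ring

/-- The entry of `z.1` at `lo` is recovered from total mass zero, and `z.2` is concentrated on pairs
whose first vertex is the apex `lo`. -/
theorem realize_coord {z : Ambient p} (hz : z ∈ c.closedSet) :
    c.realize (fun x => if x = c.lo then 0 else c.coord z x) = z := by
  obtain ⟨hp, hneg, hpos⟩ := hz
  have h0 : ∀ x : Fin p, n ≤ (x : ℕ) → z.1 x = 0 := fun x hx => by
    by_contra h
    exact absurd (hp.lt x h) (by omega)
  have h1 : ∀ x, c.sgn x * (if x = c.lo then 0 else c.coord z x) =
      z.1 x - if x = c.lo then z.1 x else 0 := by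
    intro x
    by_cases hx : x = c.lo
    · simp [hx]
    · by_cases hn : n ≤ (x : ℕ)
      · simp [hx, coord, hn, h0, sgn_of_le]
      · simp only [hx, if_false, coord, hn, sub_zero]
        rw [← mul_assoc, sgn_mul_sgn c (by omega), one_mul]
  refine Prod.ext (funext fun x => ?_) (funext fun v => funext fun e => ?_)
  · simp only [realize, h1]
    by_cases hx : x = c.lo
    · simp only [hx, if_true, Finset.sum_sub_distrib, hp.sum_eq_zero, Finset.sum_ite_eq',
        Finset.mem_univ]
      ring
    · simp [hx]
  · simp only [realize]
    by_cases h : z.2 v e = 0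
    · rw [h]
      by_cases hv : v = c.lo ∧ n ≤ (e : ℕ)
      · have he : e ≠ c.lo := fun h => c.lo_not_ge (h ▸ hv.2)
        rw [if_pos hv, if_neg he, coord, if_pos hv.2, ← hv.1, h]
      · rw [if_neg hv]
    · have hv : v = c.lo := c.eq_lo (hneg (Or.inr ⟨e, h⟩)) (hpos (Or.inr (Or.inl ⟨e, h⟩)))
      have hn := hp.le v e h
      have he : e ≠ c.lo := fun h => c.lo_not_ge (h ▸ hn)
      rw [if_pos ⟨hv, hn⟩, if_neg he, coord, if_pos hn, hv]

theorem coord_eq_zero {z : Ambient p} (hz : z ∈ c.closedSet) {x : Fin p} (hx : x ∉ c.supp) :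
    c.coord z x = 0 := by
  obtain ⟨hp, hneg, hpos⟩ := hz
  rw [mem_supp, not_or] at hx
  unfold coord
  split_ifs with hn
  · by_contra h
    exact hx.2 (hpos (Or.inr (Or.inr ⟨_, h⟩)))
  · have : z.1 x = 0 := by
      by_contra h
      rcases lt_or_gt_of_ne h with h | h
      · exact hx.1 (hneg (Or.inl h))
      · exact hx.2 (hpos (Or.inl h))
    rw [this, mul_zero]

variable {c}

theorem sgn_of_mem_left {x : Fin p} (hx : x ∈ c.left) (h : x ≠ c.lo) : c.sgn x = -1 := by
  rw [sgn, if_neg fun h => notMem_left h hx, if_pos (lt_of_le_of_ne (c.le_lo hx) h)]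

theorem sgn_of_mem_right {x : Fin p} (hx : x ∈ c.right) (hn : (x : ℕ) < n) : c.sgn x = 1 := by
  rw [sgn, if_neg (by omega), if_neg (not_lt.2 (c.lo_le_of_mem_right hx))]

theorem realize_fst_of_ne {Y : Fin p → ℝ} {x : Fin p} (h : x ≠ c.lo) :
    (c.realize Y).1 x = c.sgn x * Y x := by simp [realize, h]

theorem realize_fst_lo {Y : Fin p → ℝ} : (c.realize Y).1 c.lo = -∑ x, c.sgn x * Y x := by
  simp [realize]

theorem realize_snd_ne_zero {Y : Fin p → ℝ} {v e : Fin p} :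
    (c.realize Y).2 v e ≠ 0 ↔ (v = c.lo ∧ n ≤ (e : ℕ)) ∧ Y e ≠ 0 := by simp [realize, and_assoc]

/-- The signs turn the support conditions into nonnegativity of the coordinates. The value at `lo`
is unrestricted in a cone, but in a box it must not be positive, which is the last inequality. -/
theorem realize_mem_closedSet {Y : Fin p → ℝ} (hlo : Y c.lo = 0) (hsupp : ∀ x ∉ c.supp, Y x = 0)
    (hsum : ∑ x, c.weight x * Y x = 1) :
    c.realize Y ∈ c.closedSet ↔
      (∀ x ∈ c.supp, 0 ≤ Y x) ∧ (c.lo ∉ c.right → 0 ≤ ∑ x, c.sgn x * Y x) := by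
  constructor
  · rintro ⟨hp, hneg, hpos⟩
    refine ⟨fun x hx => ?_, fun hbox => ?_⟩
    · by_cases hxl : x = c.lo
      · rw [hxl, hlo]
      by_contra! hlt
      rcases mem_supp.1 hx with h | h
      · have hr : x ∉ c.right := fun h' => hxl (c.eq_lo h h')
        refine hr (hpos (Or.inl ?_))
        rw [realize_fst_of_ne hxl, sgn_of_mem_left h hxl]
        linarith
      · by_cases hn : n ≤ (x : ℕ)
        · have := hp.nonneg c.lo x
          simp only [realize, hn, and_self, if_true] at this
          linarith
        · refine hxl (c.eq_lo (hneg (Or.inl ?_)) h)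
          rw [realize_fst_of_ne hxl, sgn_of_mem_right h (by omega)]
          linarith
    · by_contra! hlt
      refine hbox (hpos (Or.inl ?_))
      rw [realize_fst_lo]
      linarith
  · rintro ⟨hnn, hbox⟩
    have hY : ∀ x, Y x ≠ 0 → x ∈ c.supp ∧ 0 < Y x := fun x hx => by
      have : x ∈ c.supp := by
        by_contra h
        exact hx (hsupp x h)
      exact ⟨this, lt_of_le_of_ne (hnn x this) hx.symm⟩
    have hedge : ∀ v e, (c.realize Y).2 v e ≠ 0 →
        v = c.lo ∧ n ≤ (e : ℕ) ∧ e ∈ c.right ∧ c.lo ∈ c.right := by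
      intro v e h
      obtain ⟨⟨h1, h2⟩, h3⟩ := realize_snd_ne_zero.1 h
      have h4 := (hY e h3).1
      exact ⟨h1, h2, (mem_supp.1 h4).resolve_left (notMem_left h2), c.lo_mem_right_iff.2 ⟨e, h4, h2⟩⟩
    obtain ⟨hs1, hs2⟩ := c.sum_realize Y hlo
    refine ⟨⟨?_, ?_, fun v e h => (hedge v e h).2.1, hs1, hs2.trans hsum⟩, ?_, ?_⟩
    · intro x hx
      by_contra hn
      have hxl : x ≠ c.lo := fun h => hn (h ▸ c.lo_lt_n)
      rw [realize_fst_of_ne hxl, sgn_of_le c (by omega), zero_mul] at hx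
      exact hx rfl
    · intro v e
      by_contra! h
      obtain ⟨h1, h2⟩ := realize_snd_ne_zero.1 h.ne
      have := (hY e h2).2
      simp only [realize, h1, and_self, if_true] at h
      linarith
    · rintro x (hx | ⟨e, he⟩)
      · by_cases hxl : x = c.lo
        · exact hxl ▸ c.lo_mem
        · rw [realize_fst_of_ne hxl] at hx
          obtain ⟨h1, h2⟩ := hY x (right_ne_zero_of_mul hx.ne)
          refine c.mem_left_iff.2 ⟨h1, ?_⟩
          by_contra! hlt
          have : 0 ≤ c.sgn x := by
            unfold sgn
            rw [if_neg hlt.not_gt]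
            split_ifs <;> norm_num
          exact absurd hx (not_lt.2 (mul_nonneg this h2.le))
      · exact (hedge x e he).1 ▸ c.lo_mem
    · rintro x (hx | ⟨e, he⟩ | ⟨v, hv⟩)
      · by_cases hxl : x = c.lo
        · subst hxl
          by_contra h
          have := hbox h
          rw [realize_fst_lo] at hx
          linarith
        · rw [realize_fst_of_ne hxl] at hx
          obtain ⟨h1, h2⟩ := hY x (right_ne_zero_of_mul hx.ne')
          refine mem_right_of_lo_lt h1 ?_
          by_contra! hle
          have hlt := lt_of_le_of_ne hle hxl
          have : c.sgn x ≤ 0 := by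
            unfold sgn
            rw [if_pos hlt]
            split_ifs <;> norm_num
          exact absurd hx (not_lt.2 (mul_nonpos_of_nonpos_of_nonneg this h2.le))
      · obtain ⟨rfl, -, -, h⟩ := hedge x e he
        exact h
      · exact (hedge v x hv).2.2.1

theorem realize_mem_openSet {Y : Fin p → ℝ} (hlo : Y c.lo = 0) (hsupp : ∀ x ∉ c.supp, Y x = 0)
    (hsum : ∑ x, c.weight x * Y x = 1) :
    c.realize Y ∈ c.openSet ↔
      (∀ x ∈ c.supp, x ≠ c.lo → 0 < Y x) ∧ (c.lo ∉ c.right → 0 < ∑ x, c.sgn x * Y x) := by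
  constructor
  · intro hz
    obtain ⟨hnn, hbox⟩ := (realize_mem_closedSet hlo hsupp hsum).1 (c.openSet_subset hz)
    obtain ⟨hp, hneg, hpos⟩ := hz
    refine ⟨fun x hx hxl => lt_of_le_of_ne (hnn x hx) fun h => ?_, fun hb => ?_⟩
    · have h1 : (c.realize Y).1 x = 0 := by rw [realize_fst_of_ne hxl, ← h, mul_zero]
      have h2 : ∀ e, (c.realize Y).2 x e = 0 := fun e => by
        by_contra h'
        exact hxl (realize_snd_ne_zero.1 h').1.1
      have h3 : ∀ v, (c.realize Y).2 v x = 0 := fun v => by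
        by_contra h'
        exact (realize_snd_ne_zero.1 h').2 h.symm
      rcases mem_supp.1 hx with h' | h'
      · rw [← Finset.mem_coe, ← hneg] at h'
        simp [negSet, h1, h2] at h'
      · rw [← Finset.mem_coe, ← hpos] at h'
        simp [posSet, h1, h2, h3] at h'
    · have h1 : c.lo ∈ negSet (c.realize Y) := by
        rw [hneg]
        exact c.lo_mem
      rcases h1 with h1 | ⟨e, he⟩
      · rw [realize_fst_lo] at h1
        linarith
      · refine absurd ?_ hb
        rw [← Finset.mem_coe, ← hpos]
        exact Or.inr (Or.inl ⟨e, he⟩)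
  · rintro ⟨hY, hbox⟩
    have hz : c.realize Y ∈ c.closedSet := by
      refine (realize_mem_closedSet hlo hsupp hsum).2 ⟨fun x hx => ?_, fun h => (hbox h).le⟩
      by_cases hxl : x = c.lo
      · rw [hxl, hlo]
      · exact (hY x hx hxl).le
    have hedge : ∀ e ∈ c.supp, n ≤ (e : ℕ) → (c.realize Y).2 c.lo e ≠ 0 := fun e he hn =>
      realize_snd_ne_zero.2 ⟨⟨rfl, hn⟩, (hY e he fun h => c.lo_not_ge (h ▸ hn)).ne'⟩
    refine ⟨hz.1, hz.2.1.antisymm fun x hx => ?_, hz.2.2.antisymm fun x hx => ?_⟩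
    · have hx : x ∈ c.left := hx
      by_cases hxl : x = c.lo
      · subst hxl
        by_cases hb : c.lo ∈ c.right
        · obtain ⟨e, he, hn⟩ := c.lo_mem_right_iff.1 hb
          exact Or.inr ⟨e, hedge e he hn⟩
        · refine Or.inl ?_
          rw [realize_fst_lo]
          linarith [hbox hb]
      · refine Or.inl ?_
        rw [realize_fst_of_ne hxl, sgn_of_mem_left hx hxl]
        linarith [hY x (mem_supp.2 (Or.inl hx)) hxl]
    · have hx : x ∈ c.right := hx
      by_cases hxl : x = c.lo
      · subst hxl
        obtain ⟨e, he, hn⟩ := c.lo_mem_right_iff.1 hx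
        exact Or.inr (Or.inl ⟨e, hedge e he hn⟩)
      · by_cases hn : n ≤ (x : ℕ)
        · exact Or.inr (Or.inr ⟨_, hedge x (mem_supp.2 (Or.inr hx)) hn⟩)
        · refine Or.inl ?_
          rw [realize_fst_of_ne hxl, sgn_of_mem_right hx (by omega), one_mul]
          exact hY x (mem_supp.2 (Or.inr hx)) hxl

end SplitCell

/-! ### Characteristic maps and the CW structure -/

namespace SplitCell

variable {p n : ℕ} {I : Fin p → Fin p → Prop} (c : SplitCell n I) {d : ℕ} (e : Fin d ≃ c.rest)

/-- All coordinates, computed from the independent ones by means of the normalization. -/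
def coords (y : Fin d → ℝ) (x : Fin p) : ℝ :=
  if h : x ∈ c.rest then y (e.symm ⟨x, h⟩)
  else if x = c.hi then (1 - ∑ i, c.weight (e i) * y i) / c.weight c.hi else 0

theorem lo_notMem_rest : c.lo ∉ c.rest := by simp [rest]

theorem hi_notMem_rest : c.hi ∉ c.rest := by simp [rest]

theorem mem_supp_iff_rest {x : Fin p} : x ∈ c.supp ↔ x = c.lo ∨ x = c.hi ∨ x ∈ c.rest := by
  rw [← c.insert_rest, Finset.mem_insert, Finset.mem_insert]

theorem weight_hi_pos : 0 < c.weight c.hi :=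
  zero_lt_one.trans_le (c.one_le_weight c.lo_lt_hi.ne')

theorem coords_apply (y : Fin d → ℝ) (i : Fin d) : c.coords e y (e i) = y i := by
  simp [coords]

theorem coords_hi (y : Fin d → ℝ) :
    c.coords e y c.hi = (1 - ∑ i, c.weight (e i) * y i) / c.weight c.hi := by
  simp [coords, c.hi_notMem_rest]

theorem coords_lo (y : Fin d → ℝ) : c.coords e y c.lo = 0 := by
  simp [coords, c.lo_notMem_rest, c.lo_lt_hi.ne]

theorem coords_of_notMem (y : Fin d → ℝ) {x : Fin p} (hx : x ∉ c.supp) : c.coords e y x = 0 := by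
  rw [mem_supp_iff_rest, not_or, not_or] at hx
  simp [coords, hx]

theorem sum_eq_sum_rest {Y : Fin p → ℝ} (hlo : Y c.lo = 0) (hsupp : ∀ x ∉ c.supp, Y x = 0)
    (a : Fin p → ℝ) : ∑ x, a x * Y x = a c.hi * Y c.hi + ∑ i, a (e i) * Y (e i) := by
  rw [e.sum_comp (fun x : c.rest => a x * Y x), Finset.sum_coe_sort c.rest (fun x => a x * Y x),
    ← Finset.sum_insert (f := fun x => a x * Y x) c.hi_notMem_rest]
  symm
  refine Finset.sum_subset (Finset.subset_univ _) fun x _ hx => ?_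
  rw [Finset.mem_insert, not_or] at hx
  by_cases hxl : x = c.lo
  · rw [hxl, hlo, mul_zero]
  · rw [hsupp x, mul_zero]
    rw [mem_supp_iff_rest]
    tauto

theorem sum_coords (y : Fin d → ℝ) (a : Fin p → ℝ) :
    ∑ x, a x * c.coords e y x = a c.hi * c.coords e y c.hi + ∑ i, a (e i) * y i := by
  rw [sum_eq_sum_rest c e (c.coords_lo e y) fun x hx => c.coords_of_notMem e y hx]
  simp only [coords_apply]

theorem sum_weight_coords (y : Fin d → ℝ) : ∑ x, c.weight x * c.coords e y x = 1 := by
  rw [sum_coords, coords_hi, mul_div_cancel₀ _ c.weight_hi_pos.ne']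
  ring

/-- The weighted normalization can be solved for the coordinate at `hi`, whose weight is positive;
the vertices of `rest` are independent coordinates. -/
theorem coords_eq {Y : Fin p → ℝ} (hlo : Y c.lo = 0) (hsupp : ∀ x ∉ c.supp, Y x = 0)
    (hsum : ∑ x, c.weight x * Y x = 1) : c.coords e (fun i => Y (e i)) = Y := by
  funext x
  by_cases hx : x ∈ c.supp
  · rcases c.mem_supp_iff_rest.1 hx with rfl | rfl | h
    · rw [coords_lo, hlo]
    · rw [sum_eq_sum_rest c e hlo hsupp] at hsum
      rw [coords_hi, div_eq_iff c.weight_hi_pos.ne']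
      linarith
    · simp [coords, h]
  · rw [coords_of_notMem _ _ _ hx, hsupp x hx]

theorem continuous_coords : Continuous (c.coords e) := by
  refine continuous_pi fun x => ?_
  unfold coords
  split_ifs <;> fun_prop

theorem continuous_realize : Continuous c.realize := by
  refine (continuous_pi fun x => ?_).prodMk (continuous_pi fun v => continuous_pi fun w => ?_)
  · split_ifs <;> fun_prop
  · split_ifs <;> fun_prop

theorem continuous_coord : Continuous c.coord := by
  refine continuous_pi fun x => ?_
  unfold coord
  split_ifs <;> fun_prop

theorem coords_affine (y y' : Fin d → ℝ) {s t : ℝ} (hst : s + t = 1) (x : Fin p) :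
    c.coords e (s • y + t • y') x = s * c.coords e y x + t * c.coords e y' x := by
  unfold coords
  split_ifs
  · simp
  · have h : ∑ i, c.weight (e i) * (s • y + t • y') i =
        s * ∑ i, c.weight (e i) * y i + t * ∑ i, c.weight (e i) * y' i := by
      rw [Finset.mul_sum, Finset.mul_sum, ← Finset.sum_add_distrib]
      refine Finset.sum_congr rfl fun i _ => ?_
      simp only [Pi.add_apply, Pi.smul_apply, smul_eq_mul]
      ring
    rw [h, mul_div_assoc', mul_div_assoc', ← add_div]
    congr 1
    linear_combination -hst
  · ring

/-- The affine functions whose signs decide about membership in the cell. -/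
def facetFun (x : Fin p) (y : Fin d → ℝ) : ℝ :=
  if x ∈ c.supp ∧ x ≠ c.lo then c.coords e y x
  -- The default value `1` makes the inequality void at indices that impose no condition.
  else if x = c.lo ∧ c.lo ∉ c.right then ∑ x', c.sgn x' * c.coords e y x' else 1

theorem facetFun_of_ne (y : Fin d → ℝ) {x : Fin p} (hx : x ∈ c.supp) (h : x ≠ c.lo) :
    c.facetFun e x y = c.coords e y x := if_pos ⟨hx, h⟩

theorem facetFun_lo (y : Fin d → ℝ) (h : c.lo ∉ c.right) :
    c.facetFun e c.lo y = ∑ x', c.sgn x' * c.coords e y x' := by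
  simp [facetFun, h]

theorem facetFun_forall {P : ℝ → Prop} (hP : P 1) (y : Fin d → ℝ) :
    (∀ x, P (c.facetFun e x y)) ↔ (∀ x ∈ c.supp, x ≠ c.lo → P (c.coords e y x)) ∧
      (c.lo ∉ c.right → P (∑ x', c.sgn x' * c.coords e y x')) := by
  refine ⟨fun h => ⟨fun x hx hxl => ?_, fun hb => ?_⟩, fun h x => ?_⟩
  · exact c.facetFun_of_ne e y hx hxl ▸ h x
  · exact c.facetFun_lo e y hb ▸ h c.lo
  · unfold facetFun
    split_ifs with h1 h2
    exacts [h.1 x h1.1 h1.2, h.2 h2.2, hP]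

theorem realize_coords_mem_openSet (y : Fin d → ℝ) :
    c.realize (c.coords e y) ∈ c.openSet ↔ ∀ x, 0 < c.facetFun e x y := by
  rw [realize_mem_openSet (c.coords_lo e y) (fun x hx => c.coords_of_notMem e y hx)
    (c.sum_weight_coords e y), facetFun_forall c e one_pos]

theorem realize_coords_mem_closedSet (y : Fin d → ℝ) :
    c.realize (c.coords e y) ∈ c.closedSet ↔ ∀ x, 0 ≤ c.facetFun e x y := by
  rw [realize_mem_closedSet (c.coords_lo e y) (fun x hx => c.coords_of_notMem e y hx)
    (c.sum_weight_coords e y), facetFun_forall c e zero_le_one]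
  refine and_congr_left fun _ => ⟨fun h x hx _ => h x hx, fun h x hx => ?_⟩
  by_cases hxl : x = c.lo
  · rw [hxl, coords_lo]
  · exact h x hx hxl

theorem coords_coord {z : Ambient p} (hz : z ∈ c.closedSet) :
    c.realize (c.coords e fun i => c.coord z (e i)) = z := by
  have h1 := c.realize_coord hz
  set Y : Fin p → ℝ := fun x => if x = c.lo then 0 else c.coord z x with hY
  have hlo : Y c.lo = 0 := by simp [hY]
  have hsupp : ∀ x ∉ c.supp, Y x = 0 := by
    intro x hx
    simp only [hY, c.coord_eq_zero hz hx, ite_self]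
  have hsum : ∑ x, c.weight x * Y x = 1 := by
    rw [← (c.sum_realize Y hlo).2, h1, hz.1.sum_eq_one]
  have h2 : (fun i => c.coord z (e i)) = fun i => Y (e i) := by
    funext i
    have : (e i : Fin p) ≠ c.lo := fun h => c.lo_notMem_rest (h ▸ (e i).2)
    simp [hY, this]
  rw [h2, c.coords_eq e hlo hsupp hsum, h1]

/-- All coordinates are taken equal except for a larger one at `hi`, whose sign is positive in a
box. -/
theorem exists_facetFun_pos : ∃ y : Fin d → ℝ, ∀ x, 0 < c.facetFun e x y := by
  have hw : ∀ i, 0 < c.weight (e i) := fun i =>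
    zero_lt_one.trans_le (c.one_le_weight fun h => c.lo_notMem_rest (h ▸ (e i).2))
  -- The coordinate at `hi` will be `N` times each of the `d` others, so it outweighs them even if
  -- all their signs are `-1`; `D` is the resulting normalization.
  set N : ℝ := d + 1
  have hN : 0 < N := by positivity
  set D : ℝ := ∑ i, c.weight (e i) + N * c.weight c.hi
  have hD : 0 < D := add_pos_of_nonneg_of_pos (Finset.sum_nonneg fun i _ => (hw i).le)
    (mul_pos hN c.weight_hi_pos)
  refine ⟨fun _ => D⁻¹, ?_⟩
  have hhi : c.coords e (fun _ => D⁻¹) c.hi = N * D⁻¹ := by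
    rw [coords_hi, ← Finset.sum_mul, div_eq_iff c.weight_hi_pos.ne']
    have : D * D⁻¹ = 1 := mul_inv_cancel₀ hD.ne'
    linear_combination -this
  refine (facetFun_forall c e one_pos _).2 ⟨fun x hx hxl => ?_, fun hb => ?_⟩
  · rcases c.mem_supp_iff_rest.1 hx with rfl | rfl | h
    · exact absurd rfl hxl
    · rw [hhi]
      positivity
    · obtain ⟨i, hi⟩ := e.surjective ⟨x, h⟩
      have : x = e i := by rw [hi]
      rw [this, coords_apply]
      positivity
  · have hn : (c.hi : ℕ) < n := by
      by_contra h
      exact hb (c.lo_mem_right_iff.2 ⟨_, c.hi_mem_supp, by omega⟩)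
    rw [sum_coords, sgn_of_mem_right c.hi_mem hn, hhi, ← Finset.sum_mul, one_mul, ← add_mul]
    refine mul_pos ?_ (by positivity)
    have h1 : ∀ x, -1 ≤ c.sgn x := fun x => by
      unfold sgn
      split_ifs <;> norm_num
    have h2 : ∑ _i : Fin d, (-1 : ℝ) ≤ ∑ i, c.sgn (e i) := Finset.sum_le_sum fun i _ => h1 _
    simp only [Finset.sum_const, Finset.card_univ, Fintype.card_fin, nsmul_eq_mul] at h2
    linarith

/-- The coordinates are nonnegative with weighted sum `1` and weights at least `1`, hence at most
`1`. -/
theorem isBounded_facetFun_nonneg :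
    Bornology.IsBounded {y : Fin d → ℝ | ∀ x, 0 ≤ c.facetFun e x y} := by
  refine (Metric.isBounded_closedBall (x := 0) (r := 1)).subset fun y hy => ?_
  have hy : ∀ x, 0 ≤ c.facetFun e x y := hy
  rw [facetFun_forall c e zero_le_one] at hy
  have hnn : ∀ x, x ≠ c.lo → 0 ≤ c.coords e y x := fun x hxl => by
    by_cases hx : x ∈ c.supp
    · exact hy.1 x hx hxl
    · rw [coords_of_notMem _ _ _ hx]
  rw [mem_closedBall_zero_iff, pi_norm_le_iff_of_nonneg zero_le_one]
  intro i
  have hi : (e i : Fin p) ≠ c.lo := fun h => c.lo_notMem_rest (h ▸ (e i).2)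
  have h1 := hnn _ hi
  have h2 : c.weight (e i) * c.coords e y (e i) ≤ 1 := by
    rw [← c.sum_weight_coords e y]
    refine Finset.single_le_sum (f := fun x => c.weight x * c.coords e y x) (fun x _ => ?_)
      (Finset.mem_univ _)
    by_cases hx : x = c.lo
    · simp [hx, coords_lo]
    · exact mul_nonneg (zero_le_one.trans (c.one_le_weight hx)) (hnn x hx)
  have h3 := c.one_le_weight hi
  rw [coords_apply] at h1 h2
  rw [Real.norm_eq_abs, abs_of_nonneg h1]
  nlinarith

/-- In the `d` coordinates indexed by `rest` the closed cell is a bounded set of solutions of affine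
inequalities with a strict solution; `coord` provides the continuous left inverse of the
parametrization. -/
theorem exists_characteristicMap (hc : c.supp.card = d + 2) :
    ∃ φ : PartialEquiv (Fin d → ℝ) (Ambient p), φ.source = Metric.ball 0 1 ∧ Continuous φ ∧
      Continuous φ.symm ∧ Function.Injective φ ∧
      φ '' Metric.ball 0 1 = c.openSet ∧ φ '' Metric.closedBall 0 1 = c.closedSet := by
  have hcard : c.rest.card = d := by
    have := c.card_rest
    omega
  let e : Fin d ≃ c.rest := (c.rest.equivFinOfCardEq hcard).symm
  obtain ⟨y₀, hy₀⟩ := c.exists_facetFun_pos e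
  have hcont : ∀ x, Continuous (c.facetFun e x) := fun x => by
    have h : ∀ x, Continuous fun y => c.coords e y x := fun x =>
      (continuous_apply x).comp (c.continuous_coords e)
    unfold facetFun
    split_ifs
    · exact h x
    · exact continuous_finsetSum _ fun x' _ => continuous_const.mul (h x')
    · exact continuous_const
  have haff : ∀ x y y' (s t : ℝ), s + t = 1 →
      c.facetFun e x (s • y + t • y') = s * c.facetFun e x y + t * c.facetFun e x y' := by
    intro x y y' s t hst
    unfold facetFun
    split_ifs
    · exact c.coords_affine e y y' hst x
    · rw [Finset.mul_sum, Finset.mul_sum, ← Finset.sum_add_distrib]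
      refine Finset.sum_congr rfl fun x' _ => ?_
      rw [c.coords_affine e y y' hst x']
      ring
    · linear_combination -hst
  have hinv : ∀ y, (fun i => c.coord ((c.realize ∘ c.coords e) y) (e i)) = y := by
    intro y
    funext i
    have hi : (e i : Fin p) ≠ c.lo := fun h => c.lo_notMem_rest (h ▸ (e i).2)
    rw [Function.comp_apply, coord_realize c hi, coords_apply]
  obtain ⟨φ, h1, h2, h3, h4, h5, h6⟩ := exists_partialEquiv_of_affine_inequalities
    (g := c.facetFun e) (A := c.realize ∘ c.coords e) (π := fun z i => c.coord z (e i))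
    hcont haff hy₀ (c.isBounded_facetFun_nonneg e)
    (c.continuous_realize.comp (c.continuous_coords e))
    (continuous_pi fun i => (continuous_apply (e i : Fin p)).comp c.continuous_coord) hinv
  refine ⟨φ, h1, h2, h3, h4, h5.trans ?_, h6.trans ?_⟩ <;> ext z <;> constructor
  · rintro ⟨y, hy, rfl⟩
    exact (c.realize_coords_mem_openSet e y).2 hy
  · intro hz
    have hz' := c.coords_coord e (c.openSet_subset hz)
    exact ⟨_, (c.realize_coords_mem_openSet e _).1 (hz'.symm ▸ hz), hz'⟩
  · rintro ⟨y, hy, rfl⟩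
    exact (c.realize_coords_mem_closedSet e y).2 hy
  · intro hz
    have hz' := c.coords_coord e hz
    exact ⟨_, (c.realize_coords_mem_closedSet e _).1 (hz'.symm ▸ hz), hz'⟩

/-- The cells of a given dimension. -/
abbrev OfDim (n : ℕ) (I : Fin p → Fin p → Prop) (d : ℕ) : Type :=
  {c : SplitCell n I // c.supp.card = d + 2}

/-- The characteristic map of a cell. -/
def charMap (d : ℕ) (c : OfDim n I d) : PartialEquiv (Fin d → ℝ) (Ambient p) :=
  (c.1.exists_characteristicMap c.2).choose

theorem charMap_source (d : ℕ) (c : OfDim n I d) : (charMap d c).source = Metric.ball 0 1 :=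
  (c.1.exists_characteristicMap c.2).choose_spec.1

theorem continuous_charMap (d : ℕ) (c : OfDim n I d) : Continuous (charMap d c) :=
  (c.1.exists_characteristicMap c.2).choose_spec.2.1

theorem continuous_charMap_symm (d : ℕ) (c : OfDim n I d) : Continuous (charMap d c).symm :=
  (c.1.exists_characteristicMap c.2).choose_spec.2.2.1

theorem charMap_injective (d : ℕ) (c : OfDim n I d) : Function.Injective (charMap d c) :=
  (c.1.exists_characteristicMap c.2).choose_spec.2.2.2.1

theorem charMap_image_ball (d : ℕ) (c : OfDim n I d) :
    charMap d c '' Metric.ball 0 1 = c.1.openSet :=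
  (c.1.exists_characteristicMap c.2).choose_spec.2.2.2.2.1

theorem charMap_image_closedBall (d : ℕ) (c : OfDim n I d) :
    charMap d c '' Metric.closedBall 0 1 = c.1.closedSet :=
  (c.1.exists_characteristicMap c.2).choose_spec.2.2.2.2.2

theorem openSet_nonempty (c : SplitCell n I) : c.openSet.Nonempty := by
  obtain ⟨d, hd⟩ := Nat.exists_eq_add_of_le' c.two_le_card
  rw [← charMap_image_ball d ⟨c, hd⟩]
  exact (Metric.nonempty_ball.2 one_pos).image _

/-- A point of the open cell of `c` forces every cell containing it to lie above `c`. Thus geometric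
containment is the combinatorial face relation. -/
theorem closedSet_subset_iff {c d : SplitCell n I} : c.closedSet ⊆ d.closedSet ↔ c ≤ d := by
  refine ⟨fun h => ?_, closedSet_mono⟩
  obtain ⟨z, hz⟩ := c.openSet_nonempty
  exact le_of_mem hz (h (c.openSet_subset hz))

theorem eventually_isEmpty : ∀ᶠ d in Filter.atTop, IsEmpty (OfDim n I d) := by
  filter_upwards [Filter.eventually_ge_atTop p] with d hd
  refine ⟨fun c => ?_⟩
  have h1 := c.2
  have h2 := Finset.card_le_univ c.1.supp
  rw [Fintype.card_fin] at h2
  omega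

theorem pairwiseDisjoint_charMap : (Set.univ : Set (Σ d, OfDim n I d)).PairwiseDisjoint
    fun c => charMap c.1 c.2 '' Metric.ball 0 1 := by
  rintro ⟨d, c⟩ - ⟨d', c'⟩ - hne
  rw [Function.onFun, Set.disjoint_left]
  intro z hz hz'
  rw [charMap_image_ball] at hz hz'
  have h : c.1 = c'.1 := eq_of_mem_openSet hz hz'
  have hd : d = d' := by
    have h1 := c.2
    have h2 := c'.2
    rw [h] at h1
    omega
  subst hd
  exact hne (congrArg _ (Subtype.ext h))

theorem mapsTo_charMap (d : ℕ) (c : OfDim n I d) : Set.MapsTo (charMap d c) (Metric.sphere 0 1)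
    (⋃ (m < d) (j : OfDim n I m), charMap m j '' Metric.closedBall 0 1) := by
  intro y hy
  have hz : charMap d c y ∈ c.1.closedSet := by
    rw [← charMap_image_closedBall]
    exact Set.mem_image_of_mem _ (Metric.sphere_subset_closedBall hy)
  have hz' : charMap d c y ∉ c.1.openSet := by
    rw [← charMap_image_ball, (charMap_injective d c).mem_set_image]
    intro h
    rw [Metric.mem_sphere] at hy
    rw [Metric.mem_ball] at h
    exact h.ne hy
  obtain ⟨g, hg, hzg⟩ := exists_mem_openSet hz
  obtain ⟨m, hm⟩ := Nat.exists_eq_add_of_le' g.two_le_card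
  -- A face of `c` of no smaller dimension is `c` itself, whose open cell does not contain the image
  -- of the sphere.
  have hlt : m < d := by
    by_contra! h
    have := c.2
    exact hz' (eq_of_le_of_card hg (by omega) ▸ hzg)
  simp only [Set.mem_iUnion]
  refine ⟨m, hlt, ⟨g, hm⟩, ?_⟩
  rw [charMap_image_closedBall]
  exact g.openSet_subset hzg

/-- The union of all cells. -/
def realization (n : ℕ) (I : Fin p → Fin p → Prop) : Set (Ambient p) :=
  ⋃ (d : ℕ) (c : OfDim n I d), charMap d c '' Metric.closedBall 0 1

/-- The cells form a finite CW complex. -/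
@[reducible] def cwComplex (n : ℕ) (I : Fin p → Fin p → Prop) : CWComplex (realization n I) :=
  CWComplex.mkFinite (realization n I) (OfDim n I) charMap eventually_isEmpty
    (fun _ => inferInstance) charMap_source (fun d c => (continuous_charMap d c).continuousOn)
    (fun d c => (continuous_charMap_symm d c).continuousOn) pairwiseDisjoint_charMap
    mapsTo_charMap rfl

/-- The regular cell complex of a split graph. -/
def cellComplex (n : ℕ) (I : Fin p → Fin p → Prop) : RegularCellComplex where
  space := Ambient p
  carrier := realization n I
  cwComplex := cwComplex n I
  finite := CWComplex.finite_mkFinite (realization n I) (OfDim n I) charMap eventually_isEmpty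
    (fun _ => inferInstance) charMap_source (fun d c => (continuous_charMap d c).continuousOn)
    (fun d c => (continuous_charMap_symm d c).continuousOn) pairwiseDisjoint_charMap
    mapsTo_charMap rfl
  regular d c := (charMap_injective d c).injOn

theorem closedFace_cellComplex (d : ℕ) (c : OfDim n I d) :
    (cellComplex n I).closedFace (d + 1) c = c.1.closedSet := charMap_image_closedBall d c

end SplitCell

/-! ### The labelled complex of a split graph -/

namespace SplitCell

variable {p n : ℕ} {I : Fin p → Fin p → Prop} {σ : Type v}

/-- The set of vertices of the split graph involved in a face. -/
def faceSupp : ∀ i, (cellComplex n I).Face i → Finset (Fin p)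
  | 0, _ => ∅
  | _ + 1, F => (show OfDim n I _ from F).1.supp

/-- The incidence function. -/
def faceSign : ∀ i, (cellComplex n I).Face (i + 1) → (cellComplex n I).Face i → ℤ
  | 0, _, _ => 1
  | _ + 1, F, G => (show OfDim n I _ from F).1.incidence (show OfDim n I _ from G).1

theorem closedFace_subset_iff {d d' : ℕ} (G : OfDim n I d) (F : OfDim n I d') :
    (cellComplex n I).closedFace (d + 1) G ⊆ (cellComplex n I).closedFace (d' + 1) F ↔
      G.1 ≤ F.1 := by
  refine Iff.trans (Eq.to_iff ?_) closedSet_subset_iff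
  exact congrArg₂ (fun A B : Set (Ambient p) => A ⊆ B) (closedFace_cellComplex d G)
    (closedFace_cellComplex d' F)

theorem isFacet_iff {d : ℕ} (G : OfDim n I d) (F : OfDim n I (d + 1)) :
    (cellComplex n I).IsFacet (i := d + 1) G F ↔ G.1 ≤ F.1 :=
  closedFace_subset_iff G F

/-- The cell complex of a split graph, labelled by the edge monomials. -/
def labelledComplex (n : ℕ) (I : Fin p → Fin p → Prop) (ν : Fin p → σ) : LabelledCellComplex σ where
  toRegularCellComplex := cellComplex n I
  vertexLabel v := ∑ x ∈ faceSupp 1 v, Finsupp.single (ν x) 1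
  sign := faceSign
  sign_facet i F G h := by
    cases i with
    | zero => exact Or.inl rfl
    | succ d =>
      refine (incidence_ne_zero_iff ?_).1 ((isFacet_iff G F).1 h)
      rw [F.2, G.2]
  sign_not_facet i F G h := by
    cases i with
    | zero => exact absurd (Set.empty_subset _) h
    | succ d => exact incidence_of_not_le fun h' => h ((isFacet_iff G F).2 h')
  sign_vertex v G := rfl
  sign_sign i F H := by
    cases i with
    | zero =>
      refine Eq.trans ?_ (finsum_incidence_eq_zero F.1 F.2)
      exact finsum_congr fun G => mul_one _
    | succ d => exact finsum_incidence_mul_incidence F.1 H.1 F.2 H.2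

variable {ν : Fin p → σ}

theorem label_zero (F : (labelledComplex n I ν).Face 0) :
    (labelledComplex n I ν).label 0 F = 0 := by
  unfold LabelledCellComplex.label
  have : (labelledComplex n I ν).verts 0 F = ∅ := by
    rw [Set.eq_empty_iff_forall_notMem]
    intro v hv
    have h1 : (cellComplex n I).closedFace 1 v ⊆ ∅ := hv
    have h2 := closedFace_cellComplex (n := n) (I := I) 0 v
    obtain ⟨z, hz⟩ := openSet_nonempty (show OfDim n I 0 from v).1
    exact h1 (h2.ge (openSet_subset _ hz))
  simp only [this, Set.Finite.toFinset_empty, Finset.sup_empty]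
  rfl

/-- The least common multiple of the squarefree vertex labels is the product over the union of their
supports, and the vertices of a cell cover its support. -/
theorem label_succ (hν : Function.Injective ν) {d : ℕ} (F : OfDim n I d) :
    (labelledComplex n I ν).label (d + 1) F = ∑ x ∈ F.1.supp, Finsupp.single (ν x) 1 := by
  unfold LabelledCellComplex.label
  refine le_antisymm (Finset.sup_le fun v hv => ?_) fun s => ?_
  · rw [Set.Finite.mem_toFinset] at hv
    exact Finset.sum_le_sum_of_subset (supp_mono ((closedFace_subset_iff v F).1 hv))
  · by_cases hs : ∃ x ∈ F.1.supp, ν x = s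
    · obtain ⟨x, hx, rfl⟩ := hs
      obtain ⟨v, hv, hcard, hxv⟩ := F.1.exists_vertex_le hx
      have h1 : (show (cellComplex n I).Face 1 from (⟨v, hcard⟩ : OfDim n I 0)) ∈
          (Set.toFinite ((cellComplex n I).verts (d + 1) F)).toFinset :=
        (Set.Finite.mem_toFinset _).2 ((closedFace_subset_iff ⟨v, hcard⟩ F).2 hv)
      have h2 := Finset.le_sup (f := (labelledComplex n I ν).vertexLabel) h1 (ν x)
      refine le_trans ?_ h2
      rw [sum_single_apply_of_injective hν, if_pos hx]
      refine le_of_eq ?_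
      symm
      refine (sum_single_apply_of_injective hν v.supp x).trans ?_
      rw [if_pos hxv]
    · push Not at hs
      have : (∑ x ∈ F.1.supp, Finsupp.single (ν x) 1 : σ →₀ ℕ) s = 0 := by
        rw [Finsupp.finsetSum_apply]
        exact Finset.sum_eq_zero fun x hx => Finsupp.single_eq_of_ne' (hs x hx)
      rw [this]
      exact zero_le

end SplitCell

/-! ### Linear quotients and the filtration by edges -/

namespace SplitCell

variable {p n : ℕ} {I : Fin p → Fin p → Prop} {σ : Type v} {ν : Fin p → σ}

/-- The exponent vector of the product of two variables. -/
def pairMonomial (ν : Fin p → σ) (q : Fin p ×ₗ Fin p) : σ →₀ ℕ :=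
  ∑ x ∈ {(ofLex q).2, (ofLex q).1}, Finsupp.single (ν x) 1

theorem pairMonomial_toLex {i j : Fin p} (h : i ≠ j) :
    pairMonomial ν (toLex (j, i)) = Finsupp.single (ν i) 1 + Finsupp.single (ν j) 1 :=
  Finset.sum_pair h

variable (n I) in
open Classical in
/-- The edges `i < j` of the split graph, ordered by `j` and then by `i`. -/
def pairList : List (Fin p ×ₗ Fin p) :=
  (Finset.univ.filter fun q : Fin p ×ₗ Fin p => IsPair n I (ofLex q).2 (ofLex q).1).sort

theorem mem_pairList {q : Fin p ×ₗ Fin p} :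
    q ∈ pairList n I ↔ IsPair n I (ofLex q).2 (ofLex q).1 := by simp [pairList]

theorem pairList_nodup : (pairList n I).Nodup := Finset.sort_nodup _ _

theorem mem_left_part {l₁ l₂ : List (Fin p ×ₗ Fin p)} {a : Fin p ×ₗ Fin p}
    (h : pairList n I = l₁ ++ [a] ++ l₂) {q : Fin p ×ₗ Fin p} :
    q ∈ l₁ ↔ IsPair n I (ofLex q).2 (ofLex q).1 ∧ q < a := by
  have hs : (pairList n I).SortedLT := Finset.sortedLT_sort _
  have hs := hs.pairwise
  rw [← mem_pairList, h]
  rw [h, List.append_assoc, List.pairwise_append] at hs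
  obtain ⟨-, h2, h3⟩ := hs
  rw [List.singleton_append, List.pairwise_cons] at h2
  simp only [List.mem_append, List.mem_singleton]
  constructor
  · intro hq
    exact ⟨Or.inl (Or.inl hq), h3 q hq a (by simp)⟩
  · rintro ⟨(hq | rfl) | hq, hlt⟩
    · exact hq
    · exact absurd hlt (lt_irrefl _)
    · exact absurd hlt (h2.1 q hq).not_gt

theorem mem_of_le {l₁ l₂ : List (Fin p ×ₗ Fin p)} (h : pairList n I = l₁ ++ l₂)
    {q q' : Fin p ×ₗ Fin p} (hq : IsPair n I (ofLex q).2 (ofLex q).1) (hle : q ≤ q')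
    (hq' : q' ∈ l₁) : q ∈ l₁ := by
  have hs : (pairList n I).SortedLT := Finset.sortedLT_sort _
  have hs := hs.pairwise
  rw [← mem_pairList, h, List.mem_append] at hq
  rw [h, List.pairwise_append] at hs
  exact hq.resolve_right fun hq => absurd (hs.2.2 q' hq' q hq) hle.not_gt

/-- Every pair preceding `(i, j)` contains an element of the link of `(i, j)`. -/
theorem exists_mem_linkSet {q a : Fin p ×ₗ Fin p} (hq : IsPair n I (ofLex q).2 (ofLex q).1)
    (hlt : q < a) :
    ∃ x ∈ linkSet n I (ofLex a).2 (ofLex a).1, x = (ofLex q).2 ∨ x = (ofLex q).1 := by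
  obtain ⟨h1, h2, h3⟩ := hq
  simp only [mem_linkSet]
  rcases (Prod.Lex.lt_iff.1 hlt) with h | ⟨h, h'⟩
  -- With equal smaller end points the larger end point of `q` is in the link; otherwise the smaller
  -- one is, being a clique vertex.
  · by_cases hi : (ofLex q).2 = (ofLex a).2
    · refine ⟨_, ⟨h, hi ▸ h2.ne', ?_⟩, Or.inr rfl⟩
      by_cases hn : n ≤ ((ofLex q).1 : ℕ)
      · exact Or.inr (hi ▸ h3 hn)
      · exact Or.inl (by omega)
    · exact ⟨_, ⟨h2.trans h, hi, Or.inl h1⟩, Or.inl rfl⟩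
  · exact ⟨_, ⟨h ▸ h2, h'.ne, Or.inl h1⟩, Or.inl rfl⟩

/-- Every element of the link of `(i, j)` gives a preceding pair. -/
theorem exists_pair_of_mem_linkSet {a : Fin p ×ₗ Fin p} (ha : IsPair n I (ofLex a).2 (ofLex a).1)
    {x : Fin p} (hx : x ∈ linkSet n I (ofLex a).2 (ofLex a).1) :
    ∃ q : Fin p ×ₗ Fin p, IsPair n I (ofLex q).2 (ofLex q).1 ∧ q < a ∧
      pairMonomial ν q ≤ Finsupp.single (ν x) 1 + pairMonomial ν a := by
  obtain ⟨h1, h2, h3⟩ := mem_linkSet.1 hx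
  have ha' : pairMonomial ν a = _ := pairMonomial_toLex (ν := ν) ha.2.1.ne
  rcases lt_or_gt_of_ne h2 with h | h
  · have hn : ¬ n ≤ ((ofLex a).2 : ℕ) := by
      have := ha.1
      omega
    refine ⟨toLex ((ofLex a).2, x), ⟨lt_trans h ha.1, h, fun h' => absurd h' hn⟩,
      Prod.Lex.lt_iff.2 (Or.inl ha.2.1), ?_⟩
    rw [pairMonomial_toLex h.ne, ha', ← add_assoc]
    exact le_self_add
  · refine ⟨toLex (x, (ofLex a).2), ⟨ha.1, h, fun h' => h3.resolve_left (by simp at h'; omega)⟩,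
      Prod.Lex.lt_iff.2 (Or.inl h1), ?_⟩
    rw [pairMonomial_toLex h.ne, ha', ← add_assoc, add_comm (Finsupp.single (ν x) 1)]
    exact le_self_add

variable {k : Type u} [Field k]

/-- Membership in monomial ideals is tested term by term. An earlier edge has an end point `x` in
the link of `a`; as `x` is not in `a`, it must divide the cofactor. Conversely, for `x` in the link
of `a = ij`, the edge joining `x` and `i` is earlier and divides `x_x m_a`. -/
theorem colonIdeal_pairList (hν : Function.Injective ν) {l₁ l₂ : List (Fin p ×ₗ Fin p)}
    {a : Fin p ×ₗ Fin p} (h : pairList n I = l₁ ++ [a] ++ l₂) :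
    colonIdeal k (l₁.map (pairMonomial ν)) (pairMonomial ν a) = Ideal.span
      (MvPolynomial.X '' (ν '' (linkSet n I (ofLex a).2 (ofLex a).1 : Set (Fin p)))) := by
  have ha : IsPair n I (ofLex a).2 (ofLex a).1 := mem_pairList.1 (by rw [h]; simp)
  have hL : {b | b ∈ l₁.map (pairMonomial ν)} = pairMonomial ν '' {q | q ∈ l₁} := by
    ext b
    simp
  ext f
  rw [mem_colonIdeal, hL, monomialIdeal, MvPolynomial.mem_ideal_span_monomial_image,
    MvPolynomial.mem_ideal_span_X_image]
  constructor
  · intro hf m hm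
    obtain ⟨_, ⟨q, hq, rfl⟩, hle⟩ := hf (m + pairMonomial ν a) (by
      rw [MvPolynomial.mem_support_iff, MvPolynomial.coeff_mul_monomial, mul_one]
      exact MvPolynomial.mem_support_iff.1 hm)
    obtain ⟨hqp, hqa⟩ := (mem_left_part h).1 hq
    obtain ⟨x, hx, hxq⟩ := exists_mem_linkSet hqp hqa
    refine ⟨ν x, ⟨x, hx, rfl⟩, ?_⟩
    have h1 := hle (ν x)
    obtain ⟨hx1, hx2, -⟩ := mem_linkSet.1 hx
    rw [Finsupp.add_apply, pairMonomial, pairMonomial, sum_single_apply_of_injective hν,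
      sum_single_apply_of_injective hν, if_pos (by simpa using hxq),
      if_neg (by simp [hx2, hx1.ne])] at h1
    omega
  · intro hf m hm
    have hle : pairMonomial ν a ≤ m := by
      by_contra hcon
      rw [MvPolynomial.mem_support_iff, MvPolynomial.coeff_mul_monomial', if_neg hcon] at hm
      exact hm rfl
    obtain ⟨_, ⟨x, hx, rfl⟩, hne⟩ := hf (m - pairMonomial ν a) (by
      rw [MvPolynomial.mem_support_iff] at hm ⊢
      rwa [MvPolynomial.coeff_mul_monomial', if_pos hle, mul_one] at hm)
    obtain ⟨q, hqp, hqa, hqle⟩ := exists_pair_of_mem_linkSet (ν := ν) ha hx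
    refine ⟨_, ⟨q, (mem_left_part h).2 ⟨hqp, hqa⟩, rfl⟩, hqle.trans ?_⟩
    rw [← tsub_add_cancel_of_le hle]
    refine add_le_add_left ?_ _
    rw [Finsupp.single_le_iff]
    omega

theorem hasLinearQuotients_pairList (hν : Function.Injective ν) :
    HasLinearQuotients k ((pairList n I).map (pairMonomial ν)) := by
  intro L₁ L₂ a hL
  obtain ⟨l₁, l', h1, rfl, h2⟩ := List.map_eq_append_iff.1 hL
  obtain ⟨b, l₂, rfl, rfl, -⟩ := List.map_eq_cons_iff.1 h2
  exact ⟨_, colonIdeal_pairList (l₂ := l₂) hν (by rw [h1]; simp)⟩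

/-- The complex of free modules associated with the cell complex. -/
abbrev cellScalar (k : Type u) [Field k] (n : ℕ) (I : Fin p → Fin p → Prop) (ν : Fin p → σ) :
    ScalarComplex k σ := (labelledComplex n I ν).scalar k

/-- The position of a cell in the filtration by vertices. -/
def rank (k : Type u) [Field k] (n : ℕ) (I : Fin p → Fin p → Prop) (ν : Fin p → σ) (d : ℕ)
    (c : (cellScalar k n I ν).gen (d + 1)) : Fin p ×ₗ Fin p :=
  toLex ((show OfDim n I d from c).1.hi, (show OfDim n I d from c).1.lo)

theorem coeff_ne_zero_iff {d : ℕ} (c : OfDim n I (d + 1)) (c' : OfDim n I d) :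
    (cellScalar k n I ν).coeff (d + 1) c c' ≠ 0 ↔ c'.1 ≤ c.1 := by
  change ((c.1.incidence c'.1 : ℤ) : k) ≠ 0 ↔ _
  constructor
  · intro h
    by_contra hle
    exact h (by rw [incidence_of_not_le hle, Int.cast_zero])
  · intro h
    rcases (incidence_ne_zero_iff (by rw [c.2, c'.2])).1 h with h | h <;> rw [h] <;> simp

/-- Passing to a face lowers both `hi` and `lo` weakly, hence the rank in the lexicographic order.
-/
theorem isSub_pairList {l₁ l₂ : List (Fin p ×ₗ Fin p)} (h : pairList n I = l₁ ++ l₂) :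
    (cellScalar k n I ν).IsSub (ScalarComplex.rankSet (rank k n I ν) {b | b ∈ l₁}) := by
  refine ScalarComplex.isSub_rankSet _ fun d c c' hne hc => ?_
  have hle := (coeff_ne_zero_iff (ν := ν) (k := k) c c').1 hne
  refine mem_of_le h (isPair _) ?_ hc
  refine Prod.Lex.le_iff.2 ?_
  rcases (hi_mono hle).lt_or_eq with h' | h'
  · exact Or.inl h'
  · exact Or.inr ⟨h', lo_mono hle⟩

theorem deg_cellScalar (hν : Function.Injective ν) {d : ℕ} (c : OfDim n I d) :
    (cellScalar k n I ν).deg (d + 1) c =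
      pairMonomial ν (rank k n I ν d c) + ∑ t ∈ c.1.rest, Finsupp.single (ν t) 1 := by
  refine (label_succ hν c).trans ?_
  rw [← c.1.insert_rest, Finset.sum_insert, Finset.sum_insert c.1.hi_notMem_rest, ← add_assoc]
  · exact congrArg (· + _) (pairMonomial_toLex c.1.lo_lt_hi.ne).symm
  · simp [c.1.lo_notMem_rest, c.1.lo_lt_hi.ne]

/-- The pieces of the filtration are Koszul complexes. -/
theorem isKoszul_quo (hν : Function.Injective ν) {l₁ l₂ : List (Fin p ×ₗ Fin p)}
    {a : Fin p ×ₗ Fin p} (h : pairList n I = l₁ ++ [a] ++ l₂) (h₁ h₂) :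
    (ScalarComplex.quo (Q := cellScalar k n I ν)
      (ScalarComplex.rankSet (rank k n I ν) {b | b ∈ l₁})
      (ScalarComplex.rankSet (rank k n I ν) {b | b ∈ l₁ ++ [a]}) h₁ h₂).IsKoszul ν
      (pairMonomial ν a) (linkSet n I (ofLex a).2 (ofLex a).1)
      (fun d b => (show OfDim n I d from b.1).1.rest) := by
  have ha : IsPair n I (ofLex a).2 (ofLex a).1 := mem_pairList.1 (by rw [h]; simp)
  have ha' : a ∉ l₁ := fun h' => lt_irrefl _ ((mem_left_part h).1 h').2
  have hrank : ∀ d (b : (ScalarComplex.rankSet (rank k n I ν) {b | b ∈ l₁ ++ [a]} (d + 1) \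
      ScalarComplex.rankSet (rank k n I ν) {b | b ∈ l₁} (d + 1) :
        Set ((cellScalar k n I ν).gen (d + 1)))), rank k n I ν d b.1 = a := by
    rintro d ⟨b, hb, hb'⟩
    have hb : rank k n I ν d b ∈ l₁ ++ [a] := hb
    rw [List.mem_append, List.mem_singleton] at hb
    exact hb.resolve_left hb'
  have hlo : ∀ d b, (show OfDim n I d from (show ((ScalarComplex.rankSet (rank k n I ν)
      {b | b ∈ l₁ ++ [a]} (d + 1) \ ScalarComplex.rankSet (rank k n I ν) {b | b ∈ l₁} (d + 1) :
        Set ((cellScalar k n I ν).gen (d + 1)))) from b).1).1.lo = (ofLex a).2 :=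
    fun d b => congrArg (fun q => (ofLex q).2) (hrank d b)
  have hhi : ∀ d b, (show OfDim n I d from (show ((ScalarComplex.rankSet (rank k n I ν)
      {b | b ∈ l₁ ++ [a]} (d + 1) \ ScalarComplex.rankSet (rank k n I ν) {b | b ∈ l₁} (d + 1) :
        Set ((cellScalar k n I ν).gen (d + 1)))) from b).1).1.hi = (ofLex a).1 :=
    fun d b => congrArg (fun q => (ofLex q).1) (hrank d b)
  refine ⟨fun d b b' hbb' => ?_, fun d b => ?_, fun d b => ?_, fun d α hα hcard => ?_,
    fun d b => ?_, fun d b b' => ?_⟩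
  · refine Subtype.ext (Subtype.ext (eq_of_rest_eq ?_ ?_ hbb'))
    · exact (hlo d b).trans (hlo d b').symm
    · exact (hhi d b).trans (hhi d b').symm
  · have := rest_subset (show OfDim n I d from b.1).1
    rwa [hlo d b, hhi d b] at this
  · have h1 := card_rest (show OfDim n I d from b.1).1
    have h2 := (show OfDim n I d from b.1).2
    exact Nat.add_right_cancel (h1.trans h2)
  · let c : OfDim n I d := ⟨ofRest ha α hα, by rw [← card_rest, ofRest_rest, hcard]⟩
    have hc : rank k n I ν d c = a := by
      change toLex ((ofRest ha α hα).hi, (ofRest ha α hα).lo) = a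
      rw [ofRest_hi, ofRest_lo]
      rfl
    refine ⟨⟨c, ?_, ?_⟩, ofRest_rest ha α hα⟩
    · change rank k n I ν d c ∈ l₁ ++ [a]
      rw [hc]
      simp
    · change rank k n I ν d c ∉ l₁
      rwa [hc]
  · refine (deg_cellScalar (k := k) hν (show OfDim n I d from b.1)).trans ?_
    rw [hrank d b]
  -- Since `lo` and `hi` are constant on the piece, the face relation becomes inclusion of the
  -- remaining vertices.
  · refine neg_ne_zero.trans ((coeff_ne_zero_iff (show OfDim n I (d + 1) from b.1)
      (show OfDim n I d from b'.1)).trans (rest_subset_iff ?_ ?_).symm)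
    · exact (hlo d b').trans (hlo (d + 1) b).symm
    · exact (hhi d b').trans (hhi (d + 1) b).symm

instance : Unique ((cellScalar k n I ν).gen 0) := inferInstanceAs (Unique Unit)

theorem exists_mappingCone (hν : Function.Injective ν) :
    ∃ (C : ChainComplex (MultiFree k σ) ℕ) (ε : C.X 0 ⟶ MultiFree.twist k 0),
      IsIteratedMappingCone ((pairList n I).map (pairMonomial ν)) C ε ∧
        Nonempty ((labelledComplex n I ν).cellularComplex k ≅ C) := by
  have hle : ∀ (l₁ l₂ : List (Fin p ×ₗ Fin p)) (a) (h : pairList n I = l₁ ++ [a] ++ l₂) b, _ :=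
    fun l₁ l₂ a h b => by
      have := (isKoszul_quo (k := k) hν h (isSub_pairList (l₂ := [a] ++ l₂)
        (by rw [h, List.append_assoc])) (isSub_pairList h)).deg 0 b
      exact this.ge.trans' le_self_add
  obtain ⟨C, ε, hC, i, -⟩ := ScalarComplex.exists_isIteratedMappingCone
    (Q := cellScalar k n I ν) (rank k n I ν) (pairList n I) (pairMonomial ν)
    (fun b => label_zero b) (fun b c => Int.cast_one) (fun l₁ l₂ h => isSub_pairList h)
    hle
    (fun l₁ l₂ a h => by
      rw [colonIdeal_pairList hν h]
      exact (isKoszul_quo hν h _ _).isFreeResolution hν _)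
    (fun l₁ l₂ a h => (isKoszul_quo hν h _ _).isMinimalComplex)
    (pairList n I) [] (List.append_nil _).symm
  refine ⟨C, ε, hC, ⟨?_ ≪≫ i⟩⟩
  -- The full list contains the rank of every cell, so the last stage of the filtration is the whole
  -- complex.
  refine (cellScalar k n I ν).subIso _ _ ?_
  rintro (_ | d) b
  · exact Set.mem_univ _
  · exact mem_pairList.2 (isPair _)

/-- Acyclicity is inherited from the mapping cone; no homology of the realization is computed. -/
theorem isAcyclicComplex (hν : Function.Injective ν) :
    IsAcyclicComplex ((labelledComplex n I ν).cellularComplex k) := by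
  obtain ⟨C, ε, hC, ⟨i⟩⟩ := exists_mappingCone (k := k) (n := n) (I := I) hν
  exact hC.isFreeResolution.acyclic.of_iso i.symm

theorem isMinimalComplex (hν : Function.Injective ν) :
    IsMinimalComplex ((labelledComplex n I ν).cellularComplex k) := by
  refine (cellScalar k n I ν).isMinimalComplex fun d b c _ heq => ?_
  have hcard : ∀ {d} (F : OfDim n I d),
      Finsupp.degree ((labelledComplex n I ν).label (d + 1) F) = d + 2 := by
    intro d F
    rw [label_succ hν F, map_sum]
    simp [F.2]
  have h := congrArg Finsupp.degree heq
  rcases d with _ | d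
  · have h2 := hcard (d := 0) b
    have h1 : Finsupp.degree ((labelledComplex n I ν).label 0 c) = 0 := by
      rw [label_zero c, map_zero]
    have h3 := h1.symm.trans (h.trans h2)
    omega
  · have h3 := (hcard (d := d) c).symm.trans (h.trans (hcard (d := d + 1) b))
    omega

theorem range_vertexLabel : Set.range (labelledComplex n I ν).vertexLabel =
    {a | ∃ i j, IsPair n I i j ∧ a = Finsupp.single (ν i) 1 + Finsupp.single (ν j) 1} := by
  ext a
  constructor
  · rintro ⟨v, rfl⟩
    have hv := eq_vertex (show OfDim n I 0 from v).2
    refine ⟨_, _, (show OfDim n I 0 from v).1.isPair, ?_⟩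
    change ∑ x ∈ (show OfDim n I 0 from v).1.supp, _ = _
    rw [← Finset.sum_pair (f := fun x => Finsupp.single (ν x) 1)
      (show OfDim n I 0 from v).1.lo_lt_hi.ne]
    refine congrArg (fun S => Finset.sum S _) ?_
    exact (congrArg supp hv).trans (vertex_supp _)
  · rintro ⟨i, j, h, rfl⟩
    refine ⟨(show OfDim n I 0 from ⟨vertex h, vertex_card h⟩), ?_⟩
    change ∑ x ∈ (vertex h).supp, _ = _
    rw [vertex_supp, Finset.sum_pair h.2.1.ne]

theorem mem_map_pairMonomial {a : σ →₀ ℕ} : a ∈ (pairList n I).map (pairMonomial ν) ↔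
    ∃ i j, IsPair n I i j ∧ a = Finsupp.single (ν i) 1 + Finsupp.single (ν j) 1 := by
  rw [List.mem_map]
  constructor
  · rintro ⟨q, hq, rfl⟩
    have := mem_pairList.1 hq
    exact ⟨_, _, this, pairMonomial_toLex this.2.1.ne⟩
  · rintro ⟨i, j, h, rfl⟩
    exact ⟨toLex (j, i), mem_pairList.2 h, pairMonomial_toLex h.2.1.ne⟩

theorem nodup_map_pairMonomial (hν : Function.Injective ν) :
    ((pairList n I).map (pairMonomial ν)).Nodup := by
  refine pairList_nodup.map_on fun q hq q' hq' heq => ?_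
  have h := (mem_pairList.1 hq).2.1
  have h' := (mem_pairList.1 hq').2.1
  have hmem : ∀ x, (x = (ofLex q).2 ∨ x = (ofLex q).1) ↔ (x = (ofLex q').2 ∨ x = (ofLex q').1) := by
    intro x
    have := DFunLike.congr_fun heq (ν x)
    rw [pairMonomial, pairMonomial, sum_single_apply_of_injective hν,
      sum_single_apply_of_injective hν] at this
    simp only [Finset.mem_insert, Finset.mem_singleton] at this
    split_ifs at this <;> tauto
  have e1 := hmem (ofLex q).1
  have e2 := hmem (ofLex q).2
  have h1 : (ofLex q).1 = (ofLex q').1 ∧ (ofLex q).2 = (ofLex q').2 := by grind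
  exact Prod.ext h1.1 h1.2

end SplitCell

/-! ### Booth–Lueker graphs as split graphs -/

/-- The edge monomials of a Booth–Lueker graph, for a numbering of its vertices which starts with
the vertices of the original graph. -/
theorem edgeMonomials_boothLueker {V : Type v} (G : SimpleGraph V) {p n : ℕ}
    (ν : Fin p ≃ V ⊕ G.edgeSet) (hn : ∀ i : Fin p, (i : ℕ) < n ↔ (ν i).isLeft) :
    edgeMonomials (boothLueker G) =
      {a | ∃ i j, SplitCell.IsPair n (fun i j => (boothLueker G).Adj (ν i) (ν j)) i j ∧
        a = Finsupp.single (ν i) 1 + Finsupp.single (ν j) 1} := by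
  have key : ∀ i j, i < j → ((boothLueker G).Adj (ν i) (ν j) ↔
      SplitCell.IsPair n (fun i j => (boothLueker G).Adj (ν i) (ν j)) i j) := by
    intro i j hij
    have hi := hn i
    have hj := hn j
    have hij' := Fin.lt_def.1 hij
    constructor
    · intro h
      refine ⟨?_, hij, fun _ => h⟩
      -- If `i ≥ n`, then `j > i` also lies in the independent part, and the two cannot be adjacent.
      by_contra hcon
      rcases h1 : ν i with a | a <;> rcases h2 : ν j with b | b <;> rw [h1] at h hi <;>
        rw [h2] at h hj
      · exact hcon (hi.2 rfl)
      · exact hcon (hi.2 rfl)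
      · exact hcon (hij'.trans (hj.2 rfl))
      · exact h
    · rintro ⟨h1, -, h3⟩
      by_cases hjn : n ≤ (j : ℕ)
      · exact h3 hjn
      · have h4 := hi.1 h1
        have h5 := hj.1 (by omega)
        obtain ⟨a, ha⟩ := Sum.isLeft_iff.1 h4
        obtain ⟨b, hb⟩ := Sum.isLeft_iff.1 h5
        rw [ha, hb]
        intro hab
        exact hij.ne (ν.injective (by rw [ha, hb, hab]))
  ext a
  constructor
  · rintro ⟨u, w, hadj, rfl⟩
    obtain ⟨i, rfl⟩ := ν.surjective u
    obtain ⟨j, rfl⟩ := ν.surjective w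
    rcases lt_trichotomy i j with h | rfl | h
    · exact ⟨i, j, (key i j h).1 hadj, rfl⟩
    · exact absurd hadj ((boothLueker G).loopless.irrefl _)
    · exact ⟨j, i, (key j i h).1 hadj.symm, add_comm _ _⟩
  · rintro ⟨i, j, h, rfl⟩
    exact ⟨_, _, (key i j h.2.1).2 h, rfl⟩

theorem monomialIdeal_edgeMonomials (k : Type u) [Field k] {W : Type v} (H : SimpleGraph W) :
    monomialIdeal k (edgeMonomials H) = edgeIdeal k H := by
  unfold monomialIdeal edgeIdeal
  congr 1
  ext f
  constructor
  · rintro ⟨_, ⟨u, w, h, rfl⟩, rfl⟩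
    refine ⟨u, w, h, ?_⟩
    simp [MvPolynomial.X, MvPolynomial.monomial_mul]
  · rintro ⟨u, w, h, rfl⟩
    refine ⟨_, ⟨u, w, h, rfl⟩, ?_⟩
    simp [MvPolynomial.X, MvPolynomial.monomial_mul]

theorem exists_equiv_sum (α β : Type*) [Finite α] [Finite β] :
    ∃ (p n : ℕ) (ν : Fin p ≃ α ⊕ β), ∀ i : Fin p, (i : ℕ) < n ↔ (ν i).isLeft := by
  obtain ⟨a, ⟨e⟩⟩ := Finite.exists_equiv_fin α
  obtain ⟨b, ⟨f⟩⟩ := Finite.exists_equiv_fin β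
  refine ⟨a + b, a, finSumFinEquiv.symm.trans (Equiv.sumCongr e.symm f.symm), fun i => ?_⟩
  obtain ⟨x, rfl⟩ := finSumFinEquiv.surjective i
  rw [Equiv.trans_apply, Equiv.symm_apply_apply]
  rcases x with x | x <;> simp

theorem mainTheorem11 {k : Type*} [Field k] {V : Type*} [Finite V] (G : SimpleGraph V) :
    ∃ X : LabelledCellComplex (V ⊕ G.edgeSet),
      X.SupportsResolution k (edgeIdeal k (boothLueker G)) ∧
      IsMinimalComplex (X.cellularComplex k) ∧
      ∃ L : List (V ⊕ G.edgeSet →₀ ℕ),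
        L.Nodup ∧ (∀ a, a ∈ L ↔ a ∈ edgeMonomials (boothLueker G)) ∧
        HasLinearQuotients k L ∧
        ∃ (C : ChainComplex (MultiFree k (V ⊕ G.edgeSet)) ℕ)
          (ε : C.X 0 ⟶ MultiFree.twist k 0),
          IsIteratedMappingCone L C ε ∧ Nonempty (X.cellularComplex k ≅ C) := by
  -- The clique `V` is numbered first; the link of an edge in this order then has the required form.
  obtain ⟨p, n, ν, hn⟩ := exists_equiv_sum V G.edgeSet
  have hE := edgeMonomials_boothLueker G ν hn
  refine ⟨SplitCell.labelledComplex n (fun i j => (boothLueker G).Adj (ν i) (ν j)) ν,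
    ⟨?_, SplitCell.isAcyclicComplex ν.injective⟩, SplitCell.isMinimalComplex ν.injective,
    _, SplitCell.nodup_map_pairMonomial ν.injective, fun a => ?_,
    SplitCell.hasLinearQuotients_pairList ν.injective, SplitCell.exists_mappingCone ν.injective⟩
  · rw [SplitCell.range_vertexLabel, ← hE, monomialIdeal_edgeMonomials]
  · rw [SplitCell.mem_map_pairMonomial, hE]
    rfl

end
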